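/- For a scheme $Y$ let $D(\mathcal O_Y)$ be the unbounded derived category of sheaves of $\mathcal O_Y$-modules, let $\mathcal D(Y)\subset D(\mathcal O_Y)$ be the full subcategory of complexes with quasi-coherent cohomology sheaves and, for $Y$ Noetherian, let $\mathcal D^b_{\mathrm{coh}}(Y)$ be the full subcategory of complexes whose cohomology sheaves are coherent and almost all equal to zero. For a flat morphism $p\colon X\to S$ and $\mathcal C=\mathcal D$ or $\mathcal C=\mathcal D^b_{\mathrm{coh}}$, the descent category $\mathcal C(X)/p$ is defined as follows. Let $p_1,p_2\colon X\times_SX\to X$ and $p_{12},p_{23},p_{13}\colon X\times_SX\times_SX\to X\times_SX$ be the projections. The objects of $\mathcal C(X)/p$ are the pairs $(F,\theta)$ of an object $F$ of $\mathcal C(X)$ and an isomorphism $\theta\colon Lp_1^*F\xrightarrow{\sim}Lp_2^*F$ with $Lp_{23}^*\theta\circ Lp_{12}^*\theta=Lp_{13}^*\theta$ (up to the canonical isomorphisms). The morphisms $(F,\theta)\to(F',\theta')$ are the morphisms $f\colon F\to F'$ in $\mathcal C(X)$ with $Lp_2^*f\circ\theta=\theta'\circ Lp_1^*f$. The comparison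 functor $\mathcal C(S)\to\mathcal C(X)/p$ sends $H$ to $Lp^*H$ with the canonical isomorphism $Lp_1^*Lp^*H\cong Lp_2^*Lp^*H$. Let $\Bbbk$ be an algebraically closed field, let $P_1\neq P_2$ be two closed points of the affine line $S=\mathbb A^1_{\Bbbk}$, let $X=(\mathbb A^1\setminus P_1)\sqcup(\mathbb A^1\setminus P_2)$, and let $p\colon X\to S$ be the natural map. Then: 1. the comparison functor $\mathcal D^b_{\mathrm{coh}}(S)\to\mathcal D^b_{\mathrm{coh}}(X)/p$ is an equivalence; 2. the natural morphism $\mathcal O_S\to Rp_*\mathcal O_X$ in $D(\mathcal O_S)$ does not split, i.e. it has no left inverse; 3. the comparison functor $\mathcal D(S)\to\mathcal D(X)/p$ is not an equivalence. -/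

import Mathlib

universe u

open CategoryTheory Limits AlgebraicGeometry TopologicalSpace

namespace AlgebraicGeometry.Scheme.Modules

section
variable (X : Scheme.{u})

theorem ab5 (K : Type u) [SmallCategory K] [IsFiltered K] :
    HasExactColimitsOfShape K (SheafOfModules.{u} X.ringCatSheaf) := by
  have : HasExactColimitsOfShape K X.PresheafOfModules :=
    HasExactColimitsOfShape.domain_of_functor K (PresheafOfModules.toPresheaf X.ringCatSheaf.obj)
  exact Adjunction.hasExactColimitsOfShape (PresheafOfModules.sheafificationAdjunction (𝟙 X.ringCatSheaf.obj)) K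

instance : AB5OfSize.{u, u} X.Modules where
  ofShape K _ _ := ab5 X K

theorem hasSeparator_sheaf : HasSeparator (SheafOfModules.{u} X.ringCatSheaf) := by
  have h : IsSeparator (∐ (yoneda ⋙ PresheafOfModules.free X.ringCatSheaf.obj).obj) :=
    (PresheafOfModules.freeYoneda.isSeparating X.ringCatSheaf.obj).isSeparator_coproduct
  let adj := PresheafOfModules.sheafificationAdjunction (𝟙 X.ringCatSheaf.obj)
  refine ⟨(PresheafOfModules.sheafification (𝟙 X.ringCatSheaf.obj)).obj
    (∐ (yoneda ⋙ PresheafOfModules.free X.ringCatSheaf.obj).obj), ?_⟩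
  intro A B f g hfg
  refine (SheafOfModules.forget X.ringCatSheaf ⋙ PresheafOfModules.restrictScalars (𝟙 X.ringCatSheaf.obj)).map_injective ?_
  refine h _ _ fun G hG a ↦ ?_
  rw [ObjectProperty.singleton_iff] at hG
  subst hG
  apply (adj.homEquiv _ _).symm.injective
  have e := hfg _ ((ObjectProperty.singleton_iff _ _).2 rfl) ((adj.homEquiv _ A).symm a)
  exact (adj.homEquiv_naturality_right_symm a f).trans
    (e.trans (adj.homEquiv_naturality_right_symm a g).symm)

instance : HasSeparator X.Modules := hasSeparator_sheaf X
instance : IsGrothendieckAbelian.{u} X.Modules where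
instance : EnoughInjectives X.Modules := inferInstance
end

end AlgebraicGeometry.Scheme.Modules
namespace AlgebraicGeometry.Scheme.Modules
section
variable {X Y : Scheme.{u}}

theorem preservesLimitsOfShape_restrictFunctor (f : X ⟶ Y) [IsOpenImmersion f] (K : Type) [SmallCategory K] [FinCategory K] :
    PreservesLimitsOfShape K (restrictFunctor f) := by
  have : PreservesLimitsOfShape K (restrictFunctor f ⋙ toPresheaf X) := by
    have : PreservesLimitsOfShape K (toPresheaf Y ⋙ (Functor.whiskeringLeft _ _ Ab).obj f.opensFunctor.op) := by
      have : PreservesLimitsOfShape K (toPresheaf Y) := inferInstance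
      have : PreservesLimitsOfShape K ((Functor.whiskeringLeft _ _ Ab.{u}).obj f.opensFunctor.op) := inferInstance
      exact comp_preservesLimitsOfShape _ _
    exact this
  have : ReflectsLimitsOfShape K (toPresheaf X) := reflectsLimitsOfShape_of_reflectsIsomorphisms
  exact preservesLimitsOfShape_of_reflects_of_preserves _ (toPresheaf X)
instance (f : X ⟶ Y) [IsOpenImmersion f] : PreservesFiniteLimits (restrictFunctor f) where
  preservesFiniteLimits K _ _ := preservesLimitsOfShape_restrictFunctor f K
instance (f : X ⟶ Y) [IsOpenImmersion f] : PreservesFiniteLimits (pullback f) :=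
  preservesFiniteLimits_of_natIso (restrictFunctorIsoPullback f)


theorem jointlyReflect_restrict (U : X → X.Opens) (hU : ∀ x, x ∈ U x) :
    JointlyReflectIsomorphisms (fun x ↦ restrictFunctor (U x).ι) where
  isIso {M N} φ h := by
    have hst (x : X) : IsIso ((TopCat.Presheaf.stalkFunctor Ab.{u} x).map φ.mapPresheaf) := by
      have := h x
      have e := (NatIso.isIso_map_iff (restrictStalkNatIso (U x).ι ⟨x, hU x⟩) φ).1
        (inferInstanceAs (IsIso ((toPresheaf _ ⋙ TopCat.Presheaf.stalkFunctor Ab.{u}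
          (⟨x, hU x⟩ : U x)).map ((restrictFunctor (U x).ι).map φ))))
      exact e
    let M' : TopCat.Sheaf Ab.{u} X := ⟨M.presheaf, M.isSheaf⟩
    let N' : TopCat.Sheaf Ab.{u} X := ⟨N.presheaf, N.isSheaf⟩
    let ψ : M' ⟶ N' := ⟨φ.mapPresheaf⟩
    have : IsIso ψ := by
      rw [TopCat.Presheaf.isIso_iff_stalkFunctor_map_iso]
      exact hst
    have : IsIso ((TopCat.Sheaf.forget Ab X).map ψ) := inferInstance
    have : IsIso ((toPresheaf X).map φ) := this
    exact isIso_of_reflects_iso φ (toPresheaf X)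

instance (f : X ⟶ Y) [IsLocalIso f] : PreservesFiniteLimits (pullback f) where
  preservesFiniteLimits K _ _ := by
    choose U hxU hU using IsLocalIso.exists_isOpenImmersion (f := f)
    have (x : X) : PreservesLimitsOfShape K (pullback f ⋙ restrictFunctor (U x).ι) := by
      have := hU x
      exact preservesLimitsOfShape_of_natIso ((pullbackComp (U x).ι f).symm ≪≫
        Functor.isoWhiskerLeft (pullback f) (restrictFunctorIsoPullback (U x).ι).symm)
    refine ⟨fun {G} ↦ ⟨fun {c} hc ↦ ⟨(jointlyReflect_restrict U hxU).jointlyReflectsLimit fun x ↦ ?_⟩⟩⟩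
    exact isLimitOfPreserves (pullback f ⋙ restrictFunctor (U x).ι) hc
end

end AlgebraicGeometry.Scheme.Modules

namespace DerivedPullback
section
variable {A B C D : Type*} [Category* A] [Category* B] [Category* C] [Category* D]
  [Abelian A] [Abelian B] [Abelian C] [Abelian D]
  [HasDerivedCategory A] [HasDerivedCategory B] [HasDerivedCategory C] [HasDerivedCategory D]

noncomputable section

/-- An isomorphism `G ⋙ F ≅ H` of additive functors, applied degreewise to cochain complexes. -/
def mapComplexComp {G : A ⥤ B} {F : B ⥤ C} {H : A ⥤ C} [G.Additive] [F.Additive] [H.Additive]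
    (e : G ⋙ F ≅ H) :
    G.mapHomologicalComplex (ComplexShape.up ℤ) ⋙ F.mapHomologicalComplex (ComplexShape.up ℤ) ≅
      H.mapHomologicalComplex (ComplexShape.up ℤ) :=
  NatIso.ofComponents
    (fun K ↦ HomologicalComplex.Hom.isoOfComponents (fun i ↦ e.app (K.X i))
      (fun i j _ ↦ (e.hom.naturality (K.d i j)).symm))
    (fun φ ↦ by ext i; exact e.hom.naturality (φ.f i))

section
variable {G : A ⥤ B} {F : B ⥤ C} {H : A ⥤ C}
  [G.Additive] [PreservesFiniteLimits G] [PreservesFiniteColimits G]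
  [F.Additive] [PreservesFiniteLimits F] [PreservesFiniteColimits F]
  [H.Additive] [PreservesFiniteLimits H] [PreservesFiniteColimits H]

def mapDerivedAux (e : G ⋙ F ≅ H) :
    DerivedCategory.Q ⋙ (G.mapDerivedCategory ⋙ F.mapDerivedCategory) ≅
      DerivedCategory.Q ⋙ H.mapDerivedCategory :=
  Functor.isoWhiskerRight G.mapDerivedCategoryFactors F.mapDerivedCategory ≪≫
    Functor.isoWhiskerLeft (G.mapHomologicalComplex (ComplexShape.up ℤ)) F.mapDerivedCategoryFactors ≪≫
    Functor.isoWhiskerRight (mapComplexComp e) DerivedCategory.Q ≪≫ H.mapDerivedCategoryFactors.symm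

/-- The isomorphism of functors between derived categories induced by an isomorphism
`G ⋙ F ≅ H` of exact functors: on complexes it is `e`, applied degreewise. -/
def mapDerivedComp (e : G ⋙ F ≅ H) :
    G.mapDerivedCategory ⋙ F.mapDerivedCategory ≅ H.mapDerivedCategory :=
  ((Localization.fullyFaithfulWhiskeringLeft DerivedCategory.Q
    (HomologicalComplex.quasiIso A (ComplexShape.up ℤ)) (DerivedCategory C)).preimageIso
      (mapDerivedAux e))

theorem mapDerivedComp_app (e : G ⋙ F ≅ H) (K : CochainComplex A ℤ) :
    (mapDerivedComp e).hom.app (DerivedCategory.Q.obj K) ≫ H.mapDerivedCategoryFactors.hom.app K =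
      F.mapDerivedCategory.map (G.mapDerivedCategoryFactors.hom.app K) ≫
        F.mapDerivedCategoryFactors.hom.app ((G.mapHomologicalComplex _).obj K) ≫
          DerivedCategory.Q.map ((mapComplexComp e).hom.app K) := by
  have h : (mapDerivedComp e).hom.app (DerivedCategory.Q.obj K) = (mapDerivedAux e).hom.app K :=
    congr_app ((Localization.fullyFaithfulWhiskeringLeft DerivedCategory.Q
    (HomologicalComplex.quasiIso A (ComplexShape.up ℤ)) (DerivedCategory C)).map_preimage
      (mapDerivedAux e).hom) K
  rw [h]
  simp [mapDerivedAux]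
end

theorem mapDerivedComp_assoc {G : A ⥤ B} {F : B ⥤ C} {E : C ⥤ D} {H₁ : A ⥤ C} {H₂ : B ⥤ D} {H : A ⥤ D}
    [G.Additive] [PreservesFiniteLimits G] [PreservesFiniteColimits G]
    [F.Additive] [PreservesFiniteLimits F] [PreservesFiniteColimits F]
    [E.Additive] [PreservesFiniteLimits E] [PreservesFiniteColimits E]
    [H₁.Additive] [PreservesFiniteLimits H₁] [PreservesFiniteColimits H₁]
    [H₂.Additive] [PreservesFiniteLimits H₂] [PreservesFiniteColimits H₂]
    [H.Additive] [PreservesFiniteLimits H] [PreservesFiniteColimits H]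
    (e₁ : G ⋙ F ≅ H₁) (e₂ : F ⋙ E ≅ H₂) (e₃ : H₁ ⋙ E ≅ H) (e₄ : G ⋙ H₂ ≅ H)
    (h : ∀ X, E.map (e₁.hom.app X) ≫ e₃.hom.app X = e₂.hom.app (G.obj X) ≫ e₄.hom.app X)
    (X : DerivedCategory A) :
    E.mapDerivedCategory.map ((mapDerivedComp e₁).hom.app X) ≫ (mapDerivedComp e₃).hom.app X =
      (mapDerivedComp e₂).hom.app (G.mapDerivedCategory.obj X) ≫ (mapDerivedComp e₄).hom.app X := by
  let τ : (G.mapDerivedCategory ⋙ F.mapDerivedCategory) ⋙ E.mapDerivedCategory ⟶ H.mapDerivedCategory :=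
    Functor.whiskerRight (mapDerivedComp e₁).hom _ ≫ (mapDerivedComp e₃).hom
  let τ' : (G.mapDerivedCategory ⋙ F.mapDerivedCategory) ⋙ E.mapDerivedCategory ⟶ H.mapDerivedCategory :=
    Functor.whiskerLeft G.mapDerivedCategory (mapDerivedComp e₂).hom ≫ (mapDerivedComp e₄).hom
  suffices τ = τ' from congr_app this X
  refine Localization.natTrans_ext DerivedCategory.Q
    (HomologicalComplex.quasiIso A (ComplexShape.up ℤ)) fun K ↦ ?_
  change E.mapDerivedCategory.map ((mapDerivedComp e₁).hom.app _) ≫ (mapDerivedComp e₃).hom.app _ =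
      (mapDerivedComp e₂).hom.app (G.mapDerivedCategory.obj _) ≫ (mapDerivedComp e₄).hom.app _
  have h' : (E.mapHomologicalComplex _).map ((mapComplexComp e₁).hom.app K) ≫ (mapComplexComp e₃).hom.app K =
      (mapComplexComp e₂).hom.app ((G.mapHomologicalComplex _).obj K) ≫ (mapComplexComp e₄).hom.app K := by
    ext i
    exact h (K.X i)
  rw [← cancel_mono (H.mapDerivedCategoryFactors.hom.app K), Category.assoc, Category.assoc,
    mapDerivedComp_app, mapDerivedComp_app, ← E.mapDerivedCategory.map_comp_assoc,
    mapDerivedComp_app, Functor.map_comp, Functor.map_comp, Category.assoc, Category.assoc,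
    E.mapDerivedCategoryFactors_hom_naturality_assoc, ← Functor.map_comp, h']
  have n := (mapDerivedComp e₂).hom.naturality (G.mapDerivedCategoryFactors.hom.app K)
  have a := mapDerivedComp_app e₂ ((G.mapHomologicalComplex (ComplexShape.up ℤ)).obj K)
  refine Eq.trans ?_ (congrArg (· ≫ H₂.mapDerivedCategoryFactors.hom.app _ ≫ DerivedCategory.Q.map
    ((mapComplexComp e₄).hom.app K)) n |>.trans (Category.assoc _ _ _))
  dsimp
  rw [Category.assoc, reassoc_of% a, Functor.map_comp]

end
end
end DerivedPullback
namespace AlgebraicGeometry.Scheme.Modules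
section
variable {X Y : Scheme.{u}}

noncomputable section

/-- Restriction along `j`, on sheaves of modules on the sites over `V` and over `W`. -/
def overPullback (W : X.Opens) (V : Y.Opens) (j : (W : Scheme.{u}) ⟶ V) [IsOpenImmersion j] :
    SheafOfModules.{u} (Y.ringCatSheaf.over V) ⥤ SheafOfModules.{u} (X.ringCatSheaf.over W) :=
  (overEquiv V).functor ⋙ restrictFunctor j ⋙ (overEquiv W).inverse

def overPullbackIso (f : X ⟶ Y) (W : X.Opens) (V : Y.Opens) (j : (W : Scheme.{u}) ⟶ V) [IsOpenImmersion j]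
    [IsOpenImmersion (W.ι ≫ f)]
    (h : j ≫ V.ι = W.ι ≫ f) :
    SheafOfModules.overFunctor Y.ringCatSheaf V ⋙ overPullback W V j ≅
      pullback f ⋙ SheafOfModules.overFunctor X.ringCatSheaf W :=
  (Functor.associator _ _ _).symm ≪≫
  Functor.isoWhiskerRight (overFunctorEquiv V) (restrictFunctor j ⋙ (overEquiv W).inverse) ≪≫
  (Functor.associator _ _ _).symm ≪≫
  Functor.isoWhiskerRight ((restrictFunctorComp j V.ι).symm ≪≫ restrictFunctorCongr h ≪≫
    restrictFunctorIsoPullback _ ≪≫ (pullbackComp W.ι f).symm ≪≫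
    Functor.isoWhiskerLeft (pullback f) ((restrictFunctorIsoPullback W.ι).symm ≪≫ (overFunctorEquiv W).symm))
    (overEquiv W).inverse ≪≫
  Functor.isoWhiskerLeft (pullback f) (Functor.associator _ _ _ ≪≫
    Functor.isoWhiskerLeft (SheafOfModules.overFunctor X.ringCatSheaf W) (overEquiv W).unitIso.symm ≪≫
    Functor.rightUnitor _)

def overPullbackUnit (W : X.Opens) (V : Y.Opens) (j : (W : Scheme.{u}) ⟶ V) [IsOpenImmersion j] :
    SheafOfModules.unit (X.ringCatSheaf.over W) ≅
      (overPullback W V j).obj (SheafOfModules.unit (Y.ringCatSheaf.over V)) :=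
  (overEquiv W).unitIso.app _ ≪≫ (overEquiv W).inverse.mapIso (restrictUnitIso j).symm

theorem preservesColimits_overPullback (W : X.Opens) (V : Y.Opens) (j : (W : Scheme.{u}) ⟶ V) [IsOpenImmersion j] :
   PreservesColimitsOfSize.{u, u} (overPullback W V j) := by
  have : PreservesColimitsOfSize.{u, u} (restrictFunctor j ⋙ (overEquiv W).inverse) := by
    have : PreservesColimitsOfSize.{u, u} (restrictFunctor j) := inferInstance
    exact comp_preservesColimits _ _
  exact comp_preservesColimits _ _

theorem exists_overPullback (f : X ⟶ Y) [IsLocalIso f] {I : Type*} (V : I → Y.Opens)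
    (hV : (Opens.grothendieckTopology Y).CoversTop V) :
    ∃ (W : X → X.Opens) (i : X → I) (j : ∀ x, (W x : Scheme.{u}) ⟶ V (i x)),
      (Opens.grothendieckTopology X).CoversTop W ∧ ∀ x, IsOpenImmersion (j x) ∧
        IsOpenImmersion ((W x).ι ≫ f) ∧ j x ≫ (V (i x)).ι = (W x).ι ≫ f := by
  choose U hxU hU using IsLocalIso.exists_isOpenImmersion (f := f)
  rw [Opens.coversTop_iff, IsOpenCover] at hV
  have h (x : X) : ∃ i, f x ∈ V i := by
    have : f x ∈ ⨆ i, V i := hV ▸ trivial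
    simpa using this
  choose i hi using h
  let W (x : X) : X.Opens := U x ⊓ f ⁻¹ᵁ (V (i x))
  have hW (x : X) : IsOpenImmersion ((W x).ι ≫ f) := by
    have := hU x
    have e : (W x).ι ≫ f = X.homOfLE (inf_le_left : W x ≤ U x) ≫ (U x).ι ≫ f := by simp [W]
    rw [e]
    infer_instance
  let j (x : X) : (W x : Scheme.{u}) ⟶ V (i x) := IsOpenImmersion.lift (V (i x)).ι ((W x).ι ≫ f) (by
    rw [Scheme.Opens.range_ι]
    rintro _ ⟨y, rfl⟩
    exact y.2.2)
  have hj (x : X) : j x ≫ (V (i x)).ι = (W x).ι ≫ f := IsOpenImmersion.lift_fac _ _ _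
  refine ⟨W, i, j, ?_, fun x ↦ ⟨?_, hW x, hj x⟩⟩
  · rw [Opens.coversTop_iff, IsOpenCover, eq_top_iff]
    intro x _
    exact Opens.mem_iSup.2 ⟨x, hxU x, hi x⟩
  · have := hW x
    rw [← hj x] at this
    exact IsOpenImmersion.of_comp (j x) (V (i x)).ι

theorem isIso_overPullbackIso (f : X ⟶ Y) (W : X.Opens) (V : Y.Opens) (j : (W : Scheme.{u}) ⟶ V) [IsOpenImmersion j]
    [IsOpenImmersion (W.ι ≫ f)] (h : j ≫ V.ι = W.ι ≫ f) (M : Y.Modules) :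
    IsIso (C := SheafOfModules.{u} (X.ringCatSheaf.over W))
      ((overPullbackIso f W V j h).hom.app M) :=
  ((overPullbackIso f W V j h).app M).isIso_hom

theorem isQuasicoherent_pullback (f : X ⟶ Y) [IsLocalIso f] (M : Y.Modules) (hM : M.IsQuasicoherent) :
    ((pullback f).obj M).IsQuasicoherent := by
  obtain ⟨⟨I, V, cov, pres⟩⟩ := SheafOfModules.IsQuasicoherent.nonempty_quasicoherentData (M := M)
  obtain ⟨W, i, j, hW, h⟩ := exists_overPullback f V cov
  have := fun x ↦ (h x).1
  have := fun x ↦ (h x).2.1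
  have := fun x ↦ preservesColimits_overPullback (W x) (V (i x)) (j x)
  suffices q : SheafOfModules.QuasicoherentData.{u, u, u, u} (R := X.ringCatSheaf) ((pullback f).obj M) from
    q.isQuasicoherent
  have := fun x ↦ isIso_overPullbackIso f (W x) (V (i x)) (j x) (h x).2.2 M
  refine { I := X, X := W, coversTop := hW, presentation := fun x ↦ ?_ }
  exact SheafOfModules.Presentation.ofIsIso
    ((overPullbackIso f (W x) (V (i x)) (j x) (h x).2.2).hom.app M)
    ((pres (i x)).map (overPullback (W x) (V (i x)) (j x)) (overPullbackUnit _ _ _))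

theorem isFiniteType_pullback (f : X ⟶ Y) [IsLocalIso f] (M : Y.Modules) (hM : M.IsFiniteType) :
    ((pullback f).obj M).IsFiniteType := by
  obtain ⟨⟨I, V, cov, pres⟩, hfin⟩ := SheafOfModules.IsFiniteType.exists_localGeneratorsData M
  obtain ⟨W, i, j, hW, h⟩ := exists_overPullback f V cov
  have := fun x ↦ (h x).1
  have := fun x ↦ (h x).2.1
  have := fun x ↦ preservesColimits_overPullback (W x) (V (i x)) (j x)
  have := fun x ↦ isIso_overPullbackIso f (W x) (V (i x)) (j x) (h x).2.2 M
  let q : SheafOfModules.LocalGeneratorsData.{u, u, u, u} (R := X.ringCatSheaf) ((pullback f).obj M) :=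
    { I := X
      X := W
      coversTop := hW
      generators := fun x ↦ SheafOfModules.GeneratingSections.ofEpi
        ((pres (i x)).map (overPullback (W x) (V (i x)) (j x)) (overPullbackUnit _ _ _))
        ((overPullbackIso f (W x) (V (i x)) (j x) (h x).2.2).hom.app M) }
  refine SheafOfModules.IsFiniteType.mk (R := X.ringCatSheaf)
    ⟨q, SheafOfModules.LocalGeneratorsData.IsFiniteType.mk (p := q) fun x ↦ ?_⟩
  have : (pres (i x)).IsFiniteType := hfin.isFiniteType (i x)
  exact SheafOfModules.GeneratingSections.IsFiniteType.mk (inferInstanceAs (Finite (pres (i x)).I))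

end
end

end AlgebraicGeometry.Scheme.Modules

namespace DerivedDescent
noncomputable section
variable {X Y Z T S : Scheme.{u}}

instance (X : Scheme.{u}) : HasDerivedCategory.{u + 1} X.Modules := HasDerivedCategory.standard _

/-- The unbounded derived category of sheaves of `𝒪_X`-modules. -/
abbrev DMod (X : Scheme.{u}) := DerivedCategory X.Modules

/-- The derived inverse image functor `Lf^* : D(𝒪_Y) ⥤ D(𝒪_X)` of a local isomorphism `f`. The
functor `f^*` on sheaves of modules is exact, hence `Lf^*` is `f^*`, applied termwise to complexes. -/
def pullbackD (f : X ⟶ Y) [IsLocalIso f] : DMod Y ⥤ DMod X :=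
  (Scheme.Modules.pullback f).mapDerivedCategory

/-- The canonical isomorphism `f^* g^* ≅ h^*` on sheaves of modules, when `h = g ∘ f`. -/
def pullbackComp (f : X ⟶ Y) (g : Y ⟶ Z) (h : X ⟶ Z) (w : f ≫ g = h) :
    Scheme.Modules.pullback g ⋙ Scheme.Modules.pullback f ≅ Scheme.Modules.pullback h :=
  Scheme.Modules.pullbackComp f g ≪≫ Scheme.Modules.pullbackCongr w

theorem pullbackComp_assoc (f : X ⟶ Y) (g : Y ⟶ Z) (k : Z ⟶ T) (fg : X ⟶ Z) (gk : Y ⟶ T) (h : X ⟶ T)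
    (w₁ : f ≫ g = fg) (w₂ : g ≫ k = gk) (w₃ : fg ≫ k = h) (w₄ : f ≫ gk = h) (M : T.Modules) :
    (Scheme.Modules.pullback f).map ((pullbackComp g k gk w₂).hom.app M) ≫
      (pullbackComp f gk h w₄).hom.app M =
    (pullbackComp f g fg w₁).hom.app ((Scheme.Modules.pullback k).obj M) ≫
      (pullbackComp fg k h w₃).hom.app M := by
  subst w₁ w₂ w₄
  have e := congr_app (Scheme.Modules.pseudofunctor_associativity f g k) M
  simp [pullbackComp, Scheme.Modules.pullbackCongr] at e ⊢
  rw [← cancel_epi ((Scheme.Modules.pullback f).map ((Scheme.Modules.pullbackComp g k).inv.app M)),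
    ← cancel_epi ((Scheme.Modules.pullbackComp f (g ≫ k)).inv.app M), reassoc_of% e,
    ← Functor.map_comp_assoc, Iso.inv_hom_id_app]
  simp

/-- The canonical isomorphism `Lf^* Lg^* ≅ Lh^*` on derived categories, when `h = g ∘ f`. -/
def pullbackDComp (f : X ⟶ Y) (g : Y ⟶ Z) (h : X ⟶ Z) [IsLocalIso f] [IsLocalIso g] [IsLocalIso h]
    (w : f ≫ g = h) : pullbackD g ⋙ pullbackD f ≅ pullbackD h :=
  DerivedPullback.mapDerivedComp (pullbackComp f g h w)

theorem pullbackDComp_assoc (f : X ⟶ Y) (g : Y ⟶ Z) (k : Z ⟶ T) (fg : X ⟶ Z) (gk : Y ⟶ T) (h : X ⟶ T)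
    [IsLocalIso f] [IsLocalIso g] [IsLocalIso k] [IsLocalIso fg] [IsLocalIso gk] [IsLocalIso h]
    (w₁ : f ≫ g = fg) (w₂ : g ≫ k = gk) (w₃ : fg ≫ k = h) (w₄ : f ≫ gk = h) (M : DMod T) :
    (pullbackD f).map ((pullbackDComp g k gk w₂).hom.app M) ≫
      (pullbackDComp f gk h w₄).hom.app M =
    (pullbackDComp f g fg w₁).hom.app ((pullbackD k).obj M) ≫
      (pullbackDComp fg k h w₃).hom.app M :=
  DerivedPullback.mapDerivedComp_assoc _ _ _ _
    (fun M ↦ pullbackComp_assoc f g k fg gk h w₁ w₂ w₃ w₄ M) M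

instance isLocalIso_comp (f : X ⟶ Y) (g : Y ⟶ Z) [IsLocalIso f] [IsLocalIso g] : IsLocalIso (f ≫ g) :=
  let P : MorphismProperty Scheme.{u} := @IsLocalIso
  have : P.IsMultiplicative := IsLocalIso.instIsMultiplicativeScheme
  P.comp_mem f g inferInstance inferInstance

theorem isLocalIso_fst (f : X ⟶ Z) (g : Y ⟶ Z) [IsLocalIso g] : IsLocalIso (pullback.fst f g) :=
  let P : MorphismProperty Scheme.{u} := @IsLocalIso
  have : P.IsStableUnderBaseChange := IsLocalIso.instIsStableUnderBaseChangeScheme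
  P.pullback_fst f g inferInstance

theorem isLocalIso_snd (f : X ⟶ Z) (g : Y ⟶ Z) [IsLocalIso f] : IsLocalIso (pullback.snd f g) :=
  let P : MorphismProperty Scheme.{u} := @IsLocalIso
  have : P.IsStableUnderBaseChange := IsLocalIso.instIsStableUnderBaseChangeScheme
  P.pullback_snd f g inferInstance

theorem isLocalIso_of_comp (f : X ⟶ Y) (g : Y ⟶ Z) [IsLocalIso g] [IsLocalIso (f ≫ g)] : IsLocalIso f := by
  refine ⟨fun x ↦ ?_⟩
  obtain ⟨U, hxU, hU⟩ := IsLocalIso.exists_isOpenImmersion (f := f ≫ g) x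
  obtain ⟨V, hxV, hV⟩ := IsLocalIso.exists_isOpenImmersion (f := g) (f x)
  let W : X.Opens := U ⊓ f ⁻¹ᵁ V
  refine ⟨W, ⟨hxU, hxV⟩, ?_⟩
  let j : (W : Scheme.{u}) ⟶ V := IsOpenImmersion.lift V.ι (W.ι ≫ f) (by
    rw [Scheme.Opens.range_ι]
    rintro _ ⟨y, rfl⟩
    exact y.2.2)
  have hj : j ≫ V.ι = W.ι ≫ f := IsOpenImmersion.lift_fac _ _ _
  have e : j ≫ V.ι ≫ g = X.homOfLE (inf_le_left : W ≤ U) ≫ U.ι ≫ f ≫ g := by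
    rw [reassoc_of% hj]
    simp [W]
  have : IsOpenImmersion (j ≫ V.ι ≫ g) := by
    rw [e]
    infer_instance
  have : IsOpenImmersion j := IsOpenImmersion.of_comp j (V.ι ≫ g)
  rw [← hj]
  infer_instance

section
variable (p : X ⟶ S)

/-- The fibre product `X ×_S X`. -/
abbrev X₂ : Scheme.{u} := pullback p p

/-- The first projection `X ×_S X ⟶ X`. -/
abbrev p₁ : X₂ p ⟶ X := pullback.fst p p

/-- The second projection `X ×_S X ⟶ X`. -/
abbrev p₂ : X₂ p ⟶ X := pullback.snd p p

/-- The triple fibre product `X ×_S X ×_S X`, as the fibre product of `p₂` and `p₁` over `X`: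
`((x₁, x₂), (x₂, x₃))` stands for `(x₁, x₂, x₃)`. -/
abbrev X₃ : Scheme.{u} := pullback (p₂ p) (p₁ p)

/-- The projection `(x₁, x₂, x₃) ↦ (x₁, x₂)`. -/
abbrev p₁₂ : X₃ p ⟶ X₂ p := pullback.fst (p₂ p) (p₁ p)

/-- The projection `(x₁, x₂, x₃) ↦ (x₂, x₃)`. -/
abbrev p₂₃ : X₃ p ⟶ X₂ p := pullback.snd (p₂ p) (p₁ p)

/-- The projection `(x₁, x₂, x₃) ↦ x₁`. -/
abbrev q₁ : X₃ p ⟶ X := p₁₂ p ≫ p₁ p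

/-- The projection `(x₁, x₂, x₃) ↦ x₂`. -/
abbrev q₂ : X₃ p ⟶ X := p₁₂ p ≫ p₂ p

/-- The projection `(x₁, x₂, x₃) ↦ x₃`. -/
abbrev q₃ : X₃ p ⟶ X := p₂₃ p ≫ p₂ p

theorem q₂_eq : p₂₃ p ≫ p₁ p = q₂ p := pullback.condition.symm

theorem q₁_q₃ : q₁ p ≫ p = q₃ p ≫ p := by
  have h : p₁ p ≫ p = p₂ p ≫ p := pullback.condition
  have h₂ : p₁₂ p ≫ p₂ p = p₂₃ p ≫ p₁ p := pullback.condition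
  rw [Category.assoc, Category.assoc, h, reassoc_of% h₂, h]

/-- The projection `(x₁, x₂, x₃) ↦ (x₁, x₃)`. -/
def p₁₃ : X₃ p ⟶ X₂ p := pullback.lift (q₁ p) (q₃ p) (q₁_q₃ p)

@[simp] theorem p₁₃_p₁ : p₁₃ p ≫ p₁ p = q₁ p := pullback.lift_fst _ _ _

@[simp] theorem p₁₃_p₂ : p₁₃ p ≫ p₂ p = q₃ p := pullback.lift_snd _ _ _

variable [IsLocalIso p]

instance : IsLocalIso (p₁ p) := isLocalIso_fst p p
instance : IsLocalIso (p₂ p) := isLocalIso_snd p p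
instance : IsLocalIso (p₁₂ p) := isLocalIso_fst _ _
instance : IsLocalIso (p₂₃ p) := isLocalIso_snd _ _
instance : IsLocalIso (p₁₃ p) :=
  have : IsLocalIso (p₁₃ p ≫ p₁ p) := by rw [p₁₃_p₁]; infer_instance
  isLocalIso_of_comp (p₁₃ p) (p₁ p)

/-- The pullback of `θ : Lf^* F ⟶ Lg^* F` along `h`, regarded as a morphism `La^* F ⟶ Lb^* F`
through the canonical isomorphisms, where `a = f ∘ h` and `b = g ∘ h`. -/
def transport {V W : Scheme.{u}} {f g : V ⟶ X} [IsLocalIso f] [IsLocalIso g] {F : DMod X}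
    (θ : (pullbackD f).obj F ⟶ (pullbackD g).obj F) (h : W ⟶ V) (a b : W ⟶ X)
    [IsLocalIso h] [IsLocalIso a] [IsLocalIso b] (ha : h ≫ f = a) (hb : h ≫ g = b) :
    (pullbackD a).obj F ⟶ (pullbackD b).obj F :=
  (pullbackDComp h f a ha).inv.app F ≫ (pullbackD h).map θ ≫ (pullbackDComp h g b hb).hom.app F

/-- An object of `D(𝒪_X)` with a descent datum relative to `p`: an isomorphism
`θ : Lp₁^* F ≅ Lp₂^* F` with `p₂₃^* θ ∘ p₁₂^* θ = p₁₃^* θ`. -/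
structure DescentDatum where
  /-- The object `F` of the derived category. -/
  obj : DMod X
  /-- The isomorphism `θ`. -/
  iso : (pullbackD (p₁ p)).obj obj ≅ (pullbackD (p₂ p)).obj obj
  cocycle :
    transport iso.hom (p₁₂ p) (q₁ p) (q₂ p) rfl rfl ≫
        transport iso.hom (p₂₃ p) (q₂ p) (q₃ p) (q₂_eq p) rfl =
      transport iso.hom (p₁₃ p) (q₁ p) (q₃ p) (p₁₃_p₁ p) (p₁₃_p₂ p)

namespace DescentDatum
variable {p}

/-- A morphism `(F, θ) ⟶ (G, η)` is a morphism `f : F ⟶ G` with `Lp₂^* f ∘ θ = η ∘ Lp₁^* f`. -/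
@[ext]
structure Hom (A B : DescentDatum p) where
  /-- The underlying morphism of the derived category. -/
  hom : A.obj ⟶ B.obj
  comm : (pullbackD (p₁ p)).map hom ≫ B.iso.hom = A.iso.hom ≫ (pullbackD (p₂ p)).map hom

instance : Category (DescentDatum p) where
  Hom := Hom
  id A := ⟨𝟙 A.obj, by simp⟩
  comp f g := ⟨f.hom ≫ g.hom, by
    rw [Functor.map_comp, Functor.map_comp, Category.assoc, g.comm, reassoc_of% f.comm]⟩
  id_comp _ := Hom.ext (Category.id_comp _)
  comp_id _ := Hom.ext (Category.comp_id _)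
  assoc _ _ _ := Hom.ext (Category.assoc _ _ _)

variable (p) in
/-- The canonical isomorphism `Lp₁^* Lp^* H ≅ Lp₂^* Lp^* H`, from `p ∘ p₁ = p ∘ p₂`. -/
def canonicalIso (H : DMod S) : (pullbackD (p₁ p)).obj ((pullbackD p).obj H) ≅
    (pullbackD (p₂ p)).obj ((pullbackD p).obj H) :=
  (pullbackDComp (p₁ p) p (p₁ p ≫ p) rfl).app H ≪≫
    ((pullbackDComp (p₂ p) p (p₁ p ≫ p) pullback.condition.symm).app H).symm

theorem transport_canonicalIso {W : Scheme.{u}} (h : W ⟶ X₂ p) (a b : W ⟶ X) (r : W ⟶ S)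
    [IsLocalIso h] [IsLocalIso a] [IsLocalIso b] [IsLocalIso r] (ha : h ≫ p₁ p = a) (hb : h ≫ p₂ p = b)
    (har : a ≫ p = r) (hbr : b ≫ p = r) (H : DMod S) :
    transport (canonicalIso p H).hom h a b ha hb =
      (pullbackDComp a p r har).hom.app H ≫ (pullbackDComp b p r hbr).inv.app H := by
  have e : h ≫ p₁ p ≫ p = r := by rw [← har, ← ha, Category.assoc]
  have e₁ := pullbackDComp_assoc h (p₁ p) p a (p₁ p ≫ p) r ha rfl har e H
  have e₂ := pullbackDComp_assoc h (p₂ p) p b (p₁ p ≫ p) r hb pullback.condition.symm hbr e H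
  rw [← cancel_mono ((pullbackDComp b p r hbr).hom.app H),
    ← cancel_epi ((pullbackDComp h (p₁ p) a ha).hom.app ((pullbackD p).obj H))]
  simp only [Category.assoc, Iso.inv_hom_id_app, Category.comp_id, ← e₁]
  simp only [transport, canonicalIso, Category.assoc, Iso.hom_inv_id_app_assoc, ← e₂]
  rw [← Functor.map_comp_assoc]
  simp

/-- The comparison functor, which sends `H` to `Lp^* H` with its canonical descent datum. -/
def comparison (p : X ⟶ S) [IsLocalIso p] : DMod S ⥤ DescentDatum p where
  obj H :=
    { obj := (pullbackD p).obj H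
      iso := canonicalIso p H
      cocycle := by
        rw [transport_canonicalIso (r := q₁ p ≫ p) _ _ _ rfl rfl rfl
            (by rw [Category.assoc, Category.assoc, pullback.condition]),
          transport_canonicalIso (r := q₁ p ≫ p) _ _ _ (q₂_eq p) rfl (by rw [Category.assoc, Category.assoc, pullback.condition]) (q₁_q₃ p).symm,
          transport_canonicalIso (r := q₁ p ≫ p) _ _ _ (p₁₃_p₁ p) (p₁₃_p₂ p) rfl (q₁_q₃ p).symm]
        simp }
  map φ :=
    { hom := (pullbackD p).map φ
      comm := by
        have n₁ := (pullbackDComp (p₁ p) p (p₁ p ≫ p) rfl).hom.naturality φ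
        have n₂ := (pullbackDComp (p₂ p) p (p₁ p ≫ p) pullback.condition.symm).inv.naturality φ
        dsimp [canonicalIso] at n₁ n₂ ⊢
        rw [reassoc_of% n₁, n₂, Category.assoc] }
  map_id H := Hom.ext ((pullbackD p).map_id H)
  map_comp φ ψ := Hom.ext ((pullbackD p).map_comp φ ψ)
end DescentDatum
end

/-- Quasi-coherent sheaves of `𝒪_X`-modules. -/
def quasiCoherent (X : Scheme.{u}) : ObjectProperty X.Modules := fun M ↦ M.IsQuasicoherent

/-- Coherent sheaves on a (locally) Noetherian scheme: quasi-coherent sheaves of finite type. -/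
def coherent (X : Scheme.{u}) : ObjectProperty X.Modules :=
  fun M ↦ M.IsQuasicoherent ∧ M.IsFiniteType

instance (X : Scheme.{u}) : (quasiCoherent X).IsClosedUnderIsomorphisms :=
  inferInstanceAs (SheafOfModules.isQuasicoherent X.ringCatSheaf).IsClosedUnderIsomorphisms

/-- The cohomology sheaf in degree `n`. -/
abbrev cohomology (X : Scheme.{u}) (n : ℤ) : DMod X ⥤ X.Modules := DerivedCategory.homologyFunctor X.Modules n

/-- The unbounded derived category of complexes with quasi-coherent cohomology. -/
def Dqcoh (X : Scheme.{u}) : ObjectProperty (DMod X) :=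
  fun K ↦ ∀ n : ℤ, quasiCoherent X ((cohomology X n).obj K)

/-- The complexes whose cohomology sheaves are coherent and almost all equal to zero. -/
def Dbcoh (X : Scheme.{u}) : ObjectProperty (DMod X) :=
  fun K ↦ (∀ n : ℤ, coherent X ((cohomology X n).obj K)) ∧ {n : ℤ | ¬ IsZero ((cohomology X n).obj K)}.Finite

instance (f : X ⟶ Y) : PreservesFiniteColimits (Scheme.Modules.pullback f) := inferInstance

theorem nonempty_homology_pullbackD (f : X ⟶ Y) [IsLocalIso f] (K : DMod Y) (n : ℤ) :
    Nonempty ((cohomology X n).obj ((pullbackD f).obj K) ≅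
      (Scheme.Modules.pullback f).obj ((cohomology Y n).obj K)) := by
  let L := DerivedCategory.Q.objPreimage K
  let e : DerivedCategory.Q.obj L ≅ K := DerivedCategory.Q.objObjPreimageIso K
  let F := Scheme.Modules.pullback f
  let e₁ : (pullbackD f).obj K ≅
      DerivedCategory.Q.obj ((F.mapHomologicalComplex (ComplexShape.up ℤ)).obj L) :=
    (pullbackD f).mapIso e.symm ≪≫ F.mapDerivedCategoryFactors.app L
  let e₂ := (cohomology X n).mapIso e₁ ≪≫ (DerivedCategory.homologyFunctorFactors X.Modules n).app _
  let e₃ : (HomologicalComplex.homologyFunctor X.Modules (ComplexShape.up ℤ) n).obj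
      ((F.mapHomologicalComplex (ComplexShape.up ℤ)).obj L) ≅ F.obj (L.homology n) :=
    (L.sc n).mapHomologyIso F
  exact ⟨e₂ ≪≫ e₃ ≪≫ F.mapIso (((DerivedCategory.homologyFunctorFactors Y.Modules n).app L).symm ≪≫
    (cohomology Y n).mapIso e)⟩

theorem finiteType_of_iso {M N : X.Modules} (e : M ≅ N) (h : M.IsFiniteType) : N.IsFiniteType := by
  obtain ⟨σ, hσ⟩ := SheafOfModules.IsFiniteType.exists_localGeneratorsData M
  let e' : Quiver.Hom (V := SheafOfModules.{u} X.ringCatSheaf) M N := e.hom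
  have he' : IsIso (C := SheafOfModules.{u} X.ringCatSheaf) e' := e.isIso_hom
  have h' (i : σ.I) : IsIso (C := SheafOfModules.{u} (X.ringCatSheaf.over (σ.X i))) (e'.over (σ.X i)) :=
    Functor.map_isIso (SheafOfModules.overFunctor X.ringCatSheaf (σ.X i)) e'
  have h'' (i : σ.I) : Epi (C := SheafOfModules.{u} (X.ringCatSheaf.over (σ.X i))) (e'.over (σ.X i)) :=
    IsIso.epi_of_iso _
  let q : SheafOfModules.LocalGeneratorsData.{u, u, u, u} (R := X.ringCatSheaf) N :=
    { I := σ.I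
      X := σ.X
      coversTop := σ.coversTop
      generators := fun i ↦ (σ.generators i).ofEpi (e'.over (σ.X i)) }
  refine SheafOfModules.IsFiniteType.mk (R := X.ringCatSheaf)
    ⟨q, SheafOfModules.LocalGeneratorsData.IsFiniteType.mk (p := q) fun i ↦ ?_⟩
  have := hσ.isFiniteType i
  exact SheafOfModules.GeneratingSections.IsFiniteType.mk
    (inferInstanceAs (Finite (σ.generators i).I))

theorem coherent_of_iso {M N : X.Modules} (e : M ≅ N) (h : coherent X M) : coherent X N :=
  ⟨(quasiCoherent X).prop_of_iso e h.1, finiteType_of_iso e h.2⟩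

theorem pullbackD_Dqcoh (f : X ⟶ Y) [IsLocalIso f] (K : DMod Y) (hK : Dqcoh Y K) :
    Dqcoh X ((pullbackD f).obj K) := fun n ↦ by
  obtain ⟨e⟩ := nonempty_homology_pullbackD f K n
  exact (quasiCoherent X).prop_of_iso e.symm (Scheme.Modules.isQuasicoherent_pullback f _ (hK n))

theorem pullbackD_Dbcoh (f : X ⟶ Y) [IsLocalIso f] (K : DMod Y) (hK : Dbcoh Y K) :
    Dbcoh X ((pullbackD f).obj K) := by
  refine ⟨fun n ↦ ?_, hK.2.subset fun n hn hz ↦ hn ?_⟩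
  · obtain ⟨e⟩ := nonempty_homology_pullbackD f K n
    exact coherent_of_iso e.symm ⟨Scheme.Modules.isQuasicoherent_pullback f _ (hK.1 n).1,
      Scheme.Modules.isFiniteType_pullback f _ (hK.1 n).2⟩
  · obtain ⟨e⟩ := nonempty_homology_pullbackD f K n
    exact ((Scheme.Modules.pullback f).map_isZero hz).of_iso e

section
variable (p : X ⟶ S) [IsLocalIso p]

/-- The descent category relative to `p` of the full subcategory `P` of `D(𝒪_X)`: descent data
`(F, θ)` with `F` in `P`. -/
abbrev Descent (P : ObjectProperty (DMod X)) :=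
  ObjectProperty.FullSubcategory (fun A : DescentDatum p ↦ P A.obj)

/-- The comparison functor between full subcategories `Q ⊆ D(𝒪_S)` and `P ⊆ D(𝒪_X)` such that
`Lp^*` sends `Q` to `P`. -/
def comparison (P : ObjectProperty (DMod X)) (Q : ObjectProperty (DMod S))
    (h : ∀ K, Q K → P ((pullbackD p).obj K)) : Q.FullSubcategory ⥤ Descent p P :=
  ObjectProperty.lift _ (Q.ι ⋙ DescentDatum.comparison p) (fun K ↦ h _ K.property)

/-- The comparison functor `D_qcoh(S) ⥤ D_qcoh(X)/p`. -/
def comparisonDqcoh : (Dqcoh S).FullSubcategory ⥤ Descent p (Dqcoh X) :=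
  comparison p _ _ (pullbackD_Dqcoh p)

/-- The comparison functor `D^b_coh(S) ⥤ D^b_coh(X)/p`. -/
def comparisonDbcoh : (Dbcoh S).FullSubcategory ⥤ Descent p (Dbcoh X) :=
  comparison p _ _ (pullbackD_Dbcoh p)
end

section
variable (p : X ⟶ S)

/-- The structure sheaf `𝒪_X`, as a sheaf of modules. -/
abbrev structureSheaf (X : Scheme.{u}) : X.Modules := SheafOfModules.unit X.ringCatSheaf

/-- The natural morphism `𝒪_S ⟶ p_* 𝒪_X`. -/
def unitToPushforward : structureSheaf S ⟶ (Scheme.Modules.pushforward p).obj (structureSheaf X) :=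
  SheafOfModules.unitToPushforwardObjUnit p.toRingCatSheafHom

theorem unitToPushforward_app (U : S.Opens) (a : Γ(S, U)) :
    (unitToPushforward p).app U a = p.app U a := rfl

variable (X) in
/-- `𝒪_X` in degree `0`, as a bounded below complex of sheaves of modules. -/
def structureComplex : CochainComplex.Plus X.Modules :=
  ⟨(HomologicalComplex.single X.Modules (ComplexShape.up ℤ) 0).obj (structureSheaf X),
    ⟨0, inferInstanceAs (CochainComplex.IsStrictlyGE ((CochainComplex.singleFunctor X.Modules 0).obj (structureSheaf X)) 0)⟩⟩

/-- The morphism of complexes `𝒪_S ⟶ p_* 𝒪_X`. -/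
def structureComplexToPushforward :
    structureComplex S ⟶ (Scheme.Modules.pushforward p).mapCochainComplexPlus.obj (structureComplex X) :=
  ObjectProperty.homMk
    ((HomologicalComplex.single S.Modules (ComplexShape.up ℤ) 0).map (unitToPushforward p) ≫
      (HomologicalComplex.singleMapHomologicalComplex (Scheme.Modules.pushforward p)
        (ComplexShape.up ℤ) 0).inv.app (structureSheaf X))

variable (X) in
/-- `𝒪_X`, as an object of the bounded below derived category. -/
def structureDPlus : DerivedCategory.Plus X.Modules := DerivedCategory.Plus.Q.obj (structureComplex X)

/-- The right derived functor `Rp_*` of `p_*`, on the bounded below derived category of all sheaves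
of modules. -/
def derivedPushforward : DerivedCategory.Plus X.Modules ⥤ DerivedCategory.Plus S.Modules :=
  (Scheme.Modules.pushforward p).rightDerivedFunctorPlus

/-- The natural morphism `𝒪_S ⟶ p_* 𝒪_X ⟶ Rp_* 𝒪_X`, in the bounded below derived category. -/
def toDerivedPushforwardPlus :
    structureDPlus S ⟶ (derivedPushforward p).obj (structureDPlus X) :=
  DerivedCategory.Plus.Q.map (structureComplexToPushforward p) ≫
    (Scheme.Modules.pushforward p).rightDerivedFunctorPlusUnit.app
      ((HomotopyCategory.Plus.quotient X.Modules).obj (structureComplex X))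

/-- The natural morphism `𝒪_S ⟶ Rp_* 𝒪_X`, in the unbounded derived category `D(𝒪_S)`. -/
def toDerivedPushforward :
    (DerivedCategory.Plus.ι.obj (structureDPlus S) : DMod S) ⟶
      DerivedCategory.Plus.ι.obj ((derivedPushforward p).obj (structureDPlus X)) :=
  DerivedCategory.Plus.ι.map (toDerivedPushforwardPlus p)
end

theorem isLocalIso_of_cover (f : X ⟶ Y)
    (h : ∀ x : X, ∃ (V : Scheme.{u}) (j : V ⟶ X), IsOpenImmersion j ∧ x ∈ Set.range j ∧
      IsOpenImmersion (j ≫ f)) : IsLocalIso f := by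
  refine ⟨fun x ↦ ?_⟩
  obtain ⟨V, j, hj, hx, hjf⟩ := h x
  refine ⟨j.opensRange, hx, ?_⟩
  have e : j.opensRange.ι ≫ f = j.isoOpensRange.inv ≫ j ≫ f := by
    rw [← Category.assoc, Scheme.Hom.isoOpensRange_inv_comp]
  rw [e]
  infer_instance

/-- The affine line `𝔸¹ = Spec k[t]` over `k`. -/
abbrev AffineLine (k : Type u) [Field k] : Scheme.{u} := Spec (CommRingCat.of (Polynomial k))

/-- The open subscheme `S ∖ {P}`, where `P` is a closed point of `S`. -/
def complement (P : S) (hP : IsClosed ({P} : Set S)) : S.Opens := ⟨{P}ᶜ, hP.isOpen_compl⟩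

/-- The disjoint union `(S ∖ {P}) ⊔ (S ∖ {Q})`, where `P` and `Q` are closed points of `S`. -/
abbrev TwoComplements (P Q : S) (hP : IsClosed ({P} : Set S)) (hQ : IsClosed ({Q} : Set S)) :
    Scheme.{u} :=
  (complement P hP : Scheme.{u}) ⨿ (complement Q hQ : Scheme.{u})

/-- The natural map `(S ∖ {P}) ⊔ (S ∖ {Q}) ⟶ S`, given by the inclusions. -/
def twoComplementsMap (P Q : S) (hP : IsClosed ({P} : Set S)) (hQ : IsClosed ({Q} : Set S)) :
    TwoComplements P Q hP hQ ⟶ S :=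
  coprod.desc (complement P hP).ι (complement Q hQ).ι

instance (P Q : S) (hP : IsClosed ({P} : Set S)) (hQ : IsClosed ({Q} : Set S)) :
    IsLocalIso (twoComplementsMap P Q hP hQ) := by
  refine isLocalIso_of_cover _ fun x ↦ ?_
  obtain ⟨y | y, rfl⟩ := (coprodMk _ _).surjective x
  · refine ⟨_, coprod.inl, inferInstance, ?_, ?_⟩
    · rw [coprodMk_inl]
      exact ⟨y, rfl⟩
    · rw [twoComplementsMap, coprod.inl_desc]
      infer_instance
  · refine ⟨_, coprod.inr, inferInstance, ?_, ?_⟩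
    · rw [coprodMk_inr]
      exact ⟨y, rfl⟩
    · rw [twoComplementsMap, coprod.inr_desc]
      infer_instance

end

end DerivedDescent

/-! Write `S = Spec R` with `R = k[t]`, a principal ideal domain, and let `U_i = D(f_i)` be the
complement of `P_i`, with inclusion `j_i`; the `f_i` are coprime because the points are distinct.
Since `X = U₁ ⊔ U₂`, a descent datum is an object on each `U_i` together with an isomorphism on `U₀
= U₁ ∩ U₂`.

Gluing needs no finiteness. Extension by zero `j_!` is exact and left adjoint to `j^*`. Given `F₁`,
`F₂` and an isomorphism on `U₀`, the cone `H` of `j₀_! F₀ ⟶ j₁_! F₁ ⊕ j₂_! F₂` restricts to `F₁` and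
`F₂`, and compatible morphisms from the `F_i` extend to `H` (`exists_gluing`). Hence the comparison
functor on all of `D(𝒪)` is full and every descent datum comes from `S` (`comparison_full`,
`exists_comparison_obj_iso`); coherence of the glued object is a local question. A glued morphism is
unique only up to morphisms factoring through `j₀_! F₀[1]`, so faithfulness is the only issue.

Faithfulness on `D^b_coh`: a morphism `φ : K ⟶ M` vanishing on `D(f)` is killed by a power of `f`.
Applied to `f₁` and `f₂`, whose powers generate the unit ideal, this gives `φ = 0`
(`eq_zero_of_isCoprime`). For the claim, one shows that `Hom(K, M) ⟶ Hom(j_! j^* K, M)` has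
`f`-power torsion kernel and cokernel when `K` is bounded coherent and `M` is bounded
quasi-coherent. Dévissage reduces `K` to `𝒪_S` and `M` to a flasque quasi-coherent sheaf: over a
principal ideal domain each module has a two-term resolution by divisible modules, whose sheaves are
flasque. In that case the higher cohomology vanishes, sections extend, and sections vanishing on
`D(f)` are torsion.

Non-splitting: a left inverse of `𝒪_S ⟶ Rp_* 𝒪_X` gives an `R`-linear map `r : R[1/f₁] × R[1/f₂] ⟶
R` with `r(1) = 1`. The idempotent `(1, 0)` is divisible by all powers of `f₁`, so `r(1, 0) = 0` by
Krull's intersection theorem; likewise `r(0, 1) = 0`, a contradiction.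

Failure on `D`: the class `δ : C ⟶ 𝒪_S[1]` of `0 ⟶ 𝒪_S ⟶ p_* 𝒪_X ⟶ C ⟶ 0` is nonzero by
non-splitting, but `p^* δ = 0`, since `𝒪_S ⟶ p_* 𝒪_X` splits after pullback by a triangle identity.
So the comparison functor is not faithful. The sheaf `C` is quasi-coherent and not coherent, which
is why the first argument does not apply to it. -/

namespace AlgebraicGeometry.Scheme.Modules
-- Sections, subsheaves and local tests for exactness; sections supported in an open set
section
variable {X : Scheme.{u}} {M N : X.Modules} {U V W : X.Opens}

/-- Restriction of sections of a sheaf of modules. -/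
noncomputable def res (M : X.Modules) (h : V ≤ U) : Γ(M, U) →+ Γ(M, V) :=
  (M.presheaf.map (homOfLE h).op).hom

theorem res_res (h : V ≤ U) (h' : W ≤ V) (s : Γ(M, U)) :
    M.res h' (M.res h s) = M.res (h'.trans h) s :=
  congr($(M.presheaf.map_comp (homOfLE h).op (homOfLE h').op).hom s).symm

theorem res_self (h : U ≤ U) (s : Γ(M, U)) : M.res h s = s :=
  congr($(M.presheaf.map_id (.op U)).hom s)

theorem res_smul (h : V ≤ U) (a : Γ(X, U)) (s : Γ(M, U)) :
    M.res h (a • s) = X.presheaf.map (homOfLE h).op a • M.res h s :=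
  M.map_smul _ _ _

theorem app_res (φ : M ⟶ N) (h : V ≤ U) (s : Γ(M, U)) :
    φ.app V (M.res h s) = N.res h (φ.app U s) :=
  congr($(φ.mapPresheaf.naturality (homOfLE h).op).hom s)

theorem comp_app_apply {K : X.Modules} (φ : M ⟶ N) (ψ : N ⟶ K) (s : Γ(M, U)) :
    (φ ≫ ψ).app U s = ψ.app U (φ.app U s) := rfl

theorem eq_of_forall_exists_res_eq {s t : Γ(M, U)}
    (h : ∀ x ∈ U, ∃ (V : X.Opens) (hV : V ≤ U), x ∈ V ∧ M.res hV s = M.res hV t) : s = t := by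
  choose V hV hx e using h
  exact TopCat.Sheaf.eq_of_locally_eq' ⟨M.presheaf, M.isSheaf⟩ (fun x : U ↦ V x x.2) U
    (fun x ↦ homOfLE (hV x x.2)) (fun x hxU ↦ Opens.mem_iSup.2 ⟨⟨x, hxU⟩, hx x hxU⟩) s t
    (fun x ↦ e x x.2)

theorem exists_glue {ι : Type u} (V : ι → X.Opens) (hV : ∀ i, V i ≤ U)
    (hU : ∀ x ∈ U, ∃ i, x ∈ V i) (s : ∀ i, Γ(M, V i))
    (h : ∀ i j, M.res (inf_le_left : V i ⊓ V j ≤ V i) (s i) = M.res inf_le_right (s j)) :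
    ∃ t : Γ(M, U), ∀ i, M.res (hV i) t = s i := by
  obtain ⟨t, ht, -⟩ := TopCat.Sheaf.existsUnique_gluing' ⟨M.presheaf, M.isSheaf⟩ V U
    (fun i ↦ homOfLE (hV i)) (fun x hx ↦ Opens.mem_iSup.2 (hU x hx)) s h
  exact ⟨t, ht⟩

theorem mono_of_injective (φ : M ⟶ N) (h : ∀ U, Function.Injective (φ.app U)) : Mono φ := by
  constructor
  intro Z a b hab
  ext U s
  exact h U congr(($hab).app U s)

theorem injective_of_mono (φ : M ⟶ N) [Mono φ] (U : X.Opens) : Function.Injective (φ.app U) := by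
  have h : Mono ((toPresheaf X).map φ) := inferInstance
  have h' := (NatTrans.mono_iff_mono_app ((toPresheaf X).map φ)).1 h (.op U)
  exact (AddCommGrpCat.mono_iff_injective _).1 h'

/-- A morphism of sheaves of modules is locally surjective if each section of the target is, near
each point, the image of a section. -/
def LocallySurjective (φ : M ⟶ N) : Prop :=
  ∀ (U : X.Opens) (s : Γ(N, U)), ∀ x ∈ U, ∃ (V : X.Opens) (hV : V ≤ U), x ∈ V ∧
    ∃ t : Γ(M, V), φ.app V t = N.res hV s

theorem LocallySurjective.epi {φ : M ⟶ N} (h : LocallySurjective φ) : Epi φ := by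
  constructor
  intro Z a b hab
  ext U s
  refine eq_of_forall_exists_res_eq fun x hx ↦ ?_
  obtain ⟨V, hV, hxV, t, ht⟩ := h U s x hx
  refine ⟨V, hV, hxV, ?_⟩
  rw [← app_res, ← app_res, ← ht]
  exact congr(($hab).app V t)

/-- A family of submodules of sections, closed under restriction and defined by a local condition. -/
structure LocalSubmodule (M : X.Modules) where
  /-- The sections over `U`. -/
  carrier (U : X.Opens) : Submodule Γ(X, U) Γ(M, U)
  res_mem {U V : X.Opens} (h : V ≤ U) {s : Γ(M, U)} (hs : s ∈ carrier U) : M.res h s ∈ carrier V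
  mem_of_local {U : X.Opens} {s : Γ(M, U)}
    (h : ∀ x ∈ U, ∃ (V : X.Opens) (hV : V ≤ U), x ∈ V ∧ M.res hV s ∈ carrier V) : s ∈ carrier U

namespace LocalSubmodule
variable (P : M.LocalSubmodule)

/-- The presheaf of submodules of a local family of submodules. -/
def presheafSubmodule : PresheafOfModules.Submodule M.val where
  obj U := P.carrier U.unop
  map f _ hs := P.res_mem (leOfHom f.unop) hs

/-- Sections glue in `M`, and the result lies in the submodule because membership is a local
condition. -/
theorem isSheaf : TopCat.Presheaf.IsSheaf (X := X) P.presheafSubmodule.toPresheafOfModules.presheaf := by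
  rw [TopCat.Presheaf.isSheaf_iff_isSheafUniqueGluing]
  intro ι V s hs
  obtain ⟨t, ht, htu⟩ := TopCat.Sheaf.existsUnique_gluing ⟨M.presheaf, M.isSheaf⟩ V
    (fun i ↦ (s i).1) (fun i j ↦ congr_arg Subtype.val (hs i j))
  have hmem : t ∈ P.carrier (iSup V) := P.mem_of_local fun x hx ↦ by
    obtain ⟨i, hi⟩ := Opens.mem_iSup.1 hx
    refine ⟨V i, le_iSup V i, hi, ?_⟩
    have := ht i
    change M.res (le_iSup V i) t = (s i).1 at this
    rw [this]
    exact (s i).2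
  refine ⟨⟨t, hmem⟩, fun i ↦ Subtype.ext (ht i), fun t' ht' ↦ Subtype.ext (htu _ fun i ↦ ?_)⟩
  exact congr_arg Subtype.val (ht' i)

/-- The subsheaf of modules given by a local family of submodules. -/
noncomputable def toModules : X.Modules := ⟨P.presheafSubmodule.toPresheafOfModules, P.isSheaf⟩

/-- The inclusion of a subsheaf. -/
noncomputable def ι : P.toModules ⟶ M := ⟨P.presheafSubmodule.ι⟩

theorem ι_injective (U : X.Opens) : Function.Injective (P.ι.app U) := Subtype.val_injective

theorem ι_app_mem (s : Γ(P.toModules, U)) : P.ι.app U s ∈ P.carrier U := s.2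

theorem exists_ι_app {s : Γ(M, U)} (hs : s ∈ P.carrier U) : ∃ t, P.ι.app U t = s := ⟨⟨s, hs⟩, rfl⟩

instance : Mono P.ι := mono_of_injective _ P.ι_injective

/-- The factorization of a morphism through a subsheaf. -/
noncomputable def lift (φ : N ⟶ M) (h : ∀ U s, φ.app U s ∈ P.carrier U) : N ⟶ P.toModules :=
  ⟨PresheafOfModules.homMk { 
      app U := AddCommGrpCat.ofHom ((φ.app U.unop).hom.codRestrict (P.carrier U.unop).toAddSubgroup (h U.unop))
      naturality U V f := by
        ext s
        exact Subtype.ext (app_res φ (leOfHom f.unop) s) } 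
    (fun U r s ↦ Subtype.ext (φ.app_smul r s))⟩

end LocalSubmodule

/-- The image of a morphism of sheaves of modules. -/
def imageSubmodule (φ : M ⟶ N) : N.LocalSubmodule where
  carrier U :=
    { carrier := {s | ∀ x ∈ U, ∃ (V : X.Opens) (hV : V ≤ U), x ∈ V ∧
        ∃ t : Γ(M, V), φ.app V t = N.res hV s}
      add_mem' {a b} ha hb x hx := by
        obtain ⟨V, hV, hxV, t, ht⟩ := ha x hx
        obtain ⟨V', hV', hxV', t', ht'⟩ := hb x hx
        refine ⟨V ⊓ V', inf_le_left.trans hV, ⟨hxV, hxV'⟩, M.res inf_le_left t + M.res inf_le_right t', ?_⟩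
        rw [map_add, map_add, app_res, app_res, ht, ht', res_res, res_res]
      zero_mem' x hx := ⟨U, le_rfl, hx, 0, by rw [map_zero, map_zero]⟩
      smul_mem' a b hb x hx := by
        obtain ⟨V, hV, hxV, t, ht⟩ := hb x hx
        refine ⟨V, hV, hxV, X.presheaf.map (homOfLE hV).op a • t, ?_⟩
        rw [Hom.app_smul, ht, res_smul] }
  res_mem {U V} h s hs x hx := by
    obtain ⟨W, hW, hxW, t, ht⟩ := hs x (h hx)
    refine ⟨V ⊓ W, inf_le_left, ⟨hx, hxW⟩, M.res inf_le_right t, ?_⟩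
    rw [app_res, ht, res_res, res_res]
  mem_of_local {U s} h x hx := by
    obtain ⟨V, hV, hxV, hs⟩ := h x hx
    obtain ⟨W, hW, hxW, t, ht⟩ := hs x hxV
    exact ⟨W, hW.trans hV, hxW, t, by rw [ht, res_res]⟩

/-- `φ` factors through its image subsheaf, whose inclusion is then both mono and epi, hence
invertible; every section of the image is locally hit by definition. -/
theorem locallySurjective_of_epi (φ : M ⟶ N) [Epi φ] : LocallySurjective φ := by
  let P := imageSubmodule φ
  let φ' : M ⟶ P.toModules := P.lift φ fun U s x hx ↦ ⟨U, le_rfl, hx, s, by rw [res_self]⟩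
  have : Epi (φ' ≫ P.ι) := inferInstanceAs (Epi φ)
  have : Epi P.ι := epi_of_epi φ' P.ι
  have : IsIso P.ι := isIso_of_mono_of_epi _
  intro U s
  obtain ⟨t, rfl⟩ : ∃ t, P.ι.app U t = s :=
    ⟨(inv P.ι).app U s, by rw [← comp_app_apply, IsIso.inv_hom_id]; rfl⟩
  exact P.ι_app_mem t

/-- The sectionwise kernel of `S.g` is a subsheaf, so its inclusion lifts to the cycles; exactness
makes `S.toCycles` epi, hence locally surjective. -/
theorem exists_local_of_exact {S : ShortComplex X.Modules} (hS : S.Exact) (s : Γ(S.X₂, U))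
    (hs : S.g.app U s = 0) : ∀ x ∈ U, ∃ (V : X.Opens) (hV : V ≤ U), x ∈ V ∧
      ∃ t : Γ(S.X₁, V), S.f.app V t = S.X₂.res hV s := by
  let P : S.X₂.LocalSubmodule :=
    { carrier := fun U ↦
        { carrier := {s | S.g.app U s = 0}
          add_mem' := fun {a b} ha hb ↦ by
            rw [Set.mem_ofPred_eq] at ha hb ⊢
            rw [map_add, ha, hb, add_zero]
          zero_mem' := map_zero _
          smul_mem' := fun a b hb ↦ by
            rw [Set.mem_ofPred_eq] at hb ⊢
            rw [Hom.app_smul, hb, smul_zero] }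
      res_mem := fun {U V} h s hs ↦ by
        change S.g.app V _ = 0
        rw [app_res, show S.g.app U s = 0 from hs, map_zero]
      mem_of_local := fun {U s} h ↦ eq_of_forall_exists_res_eq fun x hx ↦ by
        obtain ⟨V, hV, hxV, h⟩ := h x hx
        exact ⟨V, hV, hxV, by rw [← app_res, map_zero]; exact h⟩ }
  have hP : P.ι ≫ S.g = 0 := by
    ext U s
    exact P.ι_app_mem s
  obtain ⟨t, ht⟩ := P.exists_ι_app (s := s) hs
  intro x hx
  have := (S.exact_iff_epi_toCycles).1 hS
  obtain ⟨V, hV, hxV, a, ha⟩ := locallySurjective_of_epi S.toCycles U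
    ((S.liftCycles P.ι hP).app U t) x hx
  refine ⟨V, hV, hxV, a, ?_⟩
  rw [← S.toCycles_i, comp_app_apply, ha, app_res, ← comp_app_apply, S.liftCycles_i, ht]

theorem exact_of_exists_local (S : ShortComplex X.Modules)
    (h : ∀ (U : X.Opens) (s : Γ(S.X₂, U)), S.g.app U s = 0 → ∀ x ∈ U, ∃ (V : X.Opens) (hV : V ≤ U),
      x ∈ V ∧ ∃ t : Γ(S.X₁, V), S.f.app V t = S.X₂.res hV s) : S.Exact := by
  rw [S.exact_iff_epi_toCycles]
  refine LocallySurjective.epi fun U c x hx ↦ ?_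
  obtain ⟨V, hV, hxV, t, ht⟩ := h U (S.iCycles.app U c)
    (by rw [← comp_app_apply, S.iCycles_g]; rfl) x hx
  refine ⟨V, hV, hxV, t, injective_of_mono S.iCycles V ?_⟩
  rw [← comp_app_apply, S.toCycles_i, ht, app_res]

theorem shortExact_of_exists_local (S : ShortComplex X.Modules)
    (hf : ∀ U, Function.Injective (S.f.app U)) (hg : LocallySurjective S.g)
    (h : ∀ (U : X.Opens) (s : Γ(S.X₂, U)), S.g.app U s = 0 → ∀ x ∈ U, ∃ (V : X.Opens) (hV : V ≤ U),
      x ∈ V ∧ ∃ t : Γ(S.X₁, V), S.f.app V t = S.X₂.res hV s) : S.ShortExact where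
  exact := exact_of_exists_local S h
  mono_f := mono_of_injective _ hf
  epi_g := hg.epi

/-- The sections which vanish near each point outside of `U`. -/
def supportedIn (M : X.Modules) (U : X.Opens) : M.LocalSubmodule where
  carrier W :=
    { carrier := {s | ∀ x ∈ W, x ∉ U → ∃ (V : X.Opens) (hV : V ≤ W), x ∈ V ∧ M.res hV s = 0}
      add_mem' {a b} ha hb x hx hxU := by
        obtain ⟨V, hV, hxV, h⟩ := ha x hx hxU
        obtain ⟨V', hV', hxV', h'⟩ := hb x hx hxU
        refine ⟨V ⊓ V', inf_le_left.trans hV, ⟨hxV, hxV'⟩, ?_⟩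
        rw [map_add, ← res_res hV inf_le_left, ← res_res hV' inf_le_right, h, h', map_zero,
          map_zero, add_zero]
      zero_mem' x hx _ := ⟨W, le_rfl, hx, map_zero _⟩
      smul_mem' a b hb x hx hxU := by
        obtain ⟨V, hV, hxV, h⟩ := hb x hx hxU
        exact ⟨V, hV, hxV, by rw [res_smul, h, smul_zero]⟩ }
  res_mem {W W'} h s hs x hx hxU := by
    obtain ⟨V, hV, hxV, e⟩ := hs x (h hx) hxU
    refine ⟨W' ⊓ V, inf_le_left, ⟨hx, hxV⟩, ?_⟩
    rw [res_res, ← res_res hV inf_le_right, e, map_zero]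
  mem_of_local {W s} h x hx hxU := by
    obtain ⟨V, hV, hxV, hs⟩ := h x hx
    obtain ⟨V', hV', hxV', e⟩ := hs x hxV hxU
    exact ⟨V', hV'.trans hV, hxV', by rw [← e, res_res]⟩

theorem mem_supportedIn_of_le {W : X.Opens} (h : W ≤ U) (s : Γ(M, W)) :
    s ∈ (M.supportedIn U).carrier W := fun _ hx hxU ↦ (hxU (h hx)).elim

theorem app_mem_supportedIn (φ : M ⟶ N) {W : X.Opens} {s : Γ(M, W)}
    (hs : s ∈ (M.supportedIn U).carrier W) : φ.app W s ∈ (N.supportedIn U).carrier W := by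
  intro x hx hxU
  obtain ⟨V, hV, hxV, e⟩ := hs x hx hxU
  exact ⟨V, hV, hxV, by rw [← app_res, e, map_zero]⟩

variable (U) in
/-- The functor which sends a sheaf of modules to its subsheaf of the sections vanishing near each
point outside of the open set `U`. -/
noncomputable def supportFunctor : X.Modules ⥤ X.Modules where
  obj M := (M.supportedIn U).toModules
  map {M N} φ := (N.supportedIn U).lift ((M.supportedIn U).ι ≫ φ) fun _ s ↦
    app_mem_supportedIn φ ((M.supportedIn U).ι_app_mem s)
  map_id _ := rfl
  map_comp _ _ := rfl

variable (U M) in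
/-- The inclusion of the subsheaf of the sections vanishing near each point outside of `U`. -/
noncomputable def supportIncl : (supportFunctor U).obj M ⟶ M := (M.supportedIn U).ι

theorem supportFunctor_map_incl (φ : M ⟶ N) :
    (supportFunctor U).map φ ≫ supportIncl N U = supportIncl M U ≫ φ := rfl

instance : Mono (supportIncl M U) := inferInstanceAs (Mono (M.supportedIn U).ι)

theorem supportIncl_injective (W : X.Opens) : Function.Injective ((supportIncl M U).app W) :=
  LocalSubmodule.ι_injective _ _

theorem supportIncl_app_map (φ : M ⟶ N) {W : X.Opens} (s : Γ((supportFunctor U).obj M, W)) :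
    (supportIncl N U).app W (((supportFunctor U).map φ).app W s) =
      φ.app W ((supportIncl M U).app W s) := rfl

theorem exists_supportIncl {W : X.Opens} {s : Γ(M, W)} (hs : s ∈ (M.supportedIn U).carrier W) :
    ∃ t, (supportIncl M U).app W t = s := LocalSubmodule.exists_ι_app _ hs

theorem supportIncl_mem {W : X.Opens} (s : Γ((supportFunctor U).obj M, W)) :
    (supportIncl M U).app W s ∈ (M.supportedIn U).carrier W := LocalSubmodule.ι_app_mem _ s

instance : (supportFunctor (X := X) U).Additive where
  map_add {M N f g} := by
    rw [← cancel_mono (supportIncl N U), Preadditive.add_comp, supportFunctor_map_incl,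
      supportFunctor_map_incl, supportFunctor_map_incl, Preadditive.comp_add]

/-- The functor `supportFunctor U` sends to an injection a morphism which is injective over `U`. -/
theorem supportFunctor_map_injective (φ : M ⟶ N) (h : ∀ V ≤ U, Function.Injective (φ.app V))
    (W : X.Opens) : Function.Injective (((supportFunctor U).map φ).app W) := by
  rw [injective_iff_map_eq_zero]
  intro s hs
  refine supportIncl_injective W ?_
  rw [map_zero]
  refine eq_of_forall_exists_res_eq fun x hx ↦ ?_
  -- At points of `U` injectivity of `φ` applies; at other points the section vanishes nearby by its
  -- support condition.
  by_cases hxU : x ∈ U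
  · refine ⟨W ⊓ U, inf_le_left, ⟨hx, hxU⟩, h _ inf_le_right ?_⟩
    rw [app_res, ← supportIncl_app_map, hs, map_zero, map_zero, map_zero, map_zero]
  · obtain ⟨V, hV, hxV, e⟩ := supportIncl_mem s x hx hxU
    exact ⟨V, hV, hxV, by rw [e, map_zero]⟩

theorem supportFunctor_map_locallySurjective (φ : M ⟶ N)
    (h : ∀ V ≤ U, ∀ (s : Γ(N, V)), ∀ x ∈ V, ∃ (W : X.Opens) (hW : W ≤ V), x ∈ W ∧
    ∃ t : Γ(M, W), φ.app W t = N.res hW s) : LocallySurjective ((supportFunctor U).map φ) := by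
  intro W s x hx
  by_cases hxU : x ∈ U
  · obtain ⟨V, hV, hxV, t, ht⟩ := h (W ⊓ U) inf_le_right
      (N.res inf_le_left ((supportIncl N U).app W s)) x ⟨hx, hxU⟩
    obtain ⟨t', rfl⟩ := exists_supportIncl (mem_supportedIn_of_le (hV.trans inf_le_right) t)
    refine ⟨V, hV.trans inf_le_left, hxV, t', supportIncl_injective _ ?_⟩
    rw [supportIncl_app_map, ht, res_res, app_res]
  · obtain ⟨V, hV, hxV, e⟩ := supportIncl_mem s x hx hxU
    refine ⟨V, hV, hxV, 0, supportIncl_injective _ ?_⟩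
    rw [map_zero, map_zero, app_res]
    exact e.symm

/-- Exactness is tested near each point: the functor changes nothing over `U`, and outside `U` all
its sections are locally zero. -/
theorem supportFunctor_shortExact {S : ShortComplex X.Modules} (hS : S.ShortExact) :
    (S.map (supportFunctor U)).ShortExact := by
  change (ShortComplex.mk ((supportFunctor U).map S.f) ((supportFunctor U).map S.g) _).ShortExact
  have := hS.mono_f
  have := hS.epi_g
  refine shortExact_of_exists_local _
    (supportFunctor_map_injective _ fun V _ ↦ injective_of_mono _ _)
    (supportFunctor_map_locallySurjective _ fun V _ ↦ locallySurjective_of_epi S.g V) ?_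
  intro W s hs x hx
  have hs' : S.g.app W ((supportIncl S.X₂ U).app W s) = 0 := by
    rw [← supportIncl_app_map]
    erw [hs]
    exact map_zero _
  obtain ⟨V, hV, hxV, t, ht⟩ := exists_local_of_exact hS.exact _ hs' x hx
  -- The local preimage again has support in `U`, because `S.f` is injective on sections.
  obtain ⟨t', rfl⟩ : ∃ t', (supportIncl S.X₁ U).app V t' = t := exists_supportIncl fun y hy hyU ↦ by
    obtain ⟨V', hV', hyV', e⟩ := (S.X₂.supportedIn U).res_mem hV (supportIncl_mem s) y hy hyU
    refine ⟨V', hV', hyV', injective_of_mono S.f _ ?_⟩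
    rw [app_res, ht, e, map_zero]
  refine ⟨V, hV, hxV, t', supportIncl_injective _ ?_⟩
  exact (supportIncl_app_map S.f t').trans (ht.trans (app_res (supportIncl S.X₂ U) _ s).symm)

theorem preservesFiniteLimits_and_colimits_supportFunctor :
    PreservesFiniteLimits (supportFunctor U) ∧ PreservesFiniteColimits (supportFunctor U) :=
  ((supportFunctor U).exact_tfae.out 0 3).1 fun _ hS ↦ supportFunctor_shortExact hS

instance : PreservesFiniteLimits (supportFunctor U) :=
  preservesFiniteLimits_and_colimits_supportFunctor.1

theorem isIso_of_injective_of_locallySurjective (φ : M ⟶ N) (h : ∀ U, Function.Injective (φ.app U))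
    (h' : LocallySurjective φ) : IsIso φ := by
  have := mono_of_injective φ h
  have := h'.epi
  exact isIso_of_mono_of_epi φ

/-- Only the values on open sets inside `U` matter. Applied to the unit `M ⟶ j_* j^* M`, this is
what produces the left adjoint `j_!` of `j^*`. -/
theorem isIso_supportFunctor_map (φ : M ⟶ N) (h : ∀ V ≤ U, IsIso (φ.app V)) :
    IsIso ((supportFunctor U).map φ) := by
  have hb (V : X.Opens) (hV : V ≤ U) : Function.Bijective (φ.app V) := by
    have := h V hV
    exact ConcreteCategory.bijective_of_isIso (φ.app V)
  refine isIso_of_injective_of_locallySurjective _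
    (supportFunctor_map_injective φ fun V hV ↦ (hb V hV).1)
    (supportFunctor_map_locallySurjective φ fun V hV s x hx ↦ ?_)
  obtain ⟨t, ht⟩ := (hb V hV).2 s
  exact ⟨V, le_rfl, hx, t, by rw [ht, res_self]⟩

theorem isIso_supportIncl_app (V : X.Opens) (hV : V ≤ U) : IsIso ((supportIncl M U).app V) := by
  rw [ConcreteCategory.isIso_iff_bijective]
  exact ⟨supportIncl_injective V, fun s ↦ exists_supportIncl (mem_supportedIn_of_le hV s)⟩

end
end AlgebraicGeometry.Scheme.Modules

/-! ### A left adjoint built from a right adjoint and a subfunctor -/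

namespace CategoryTheory.Adjunction

section
variable {A B : Type*} [Category* A] [Category* B] {L : A ⥤ B} {R : B ⥤ A}

/-- If `L ⊣ R` with `R` fully faithful and `E ⟶ 𝟭` is a monomorphism of functors inverted by `L`
such that `E` inverts the unit, then `R ⋙ E` is left adjoint to `L`. -/
noncomputable def leftAdjointOfSubfunctor (adj : L ⊣ R) [∀ N, IsIso (adj.counit.app N)] (E : A ⥤ A)
    (ε : ∀ M, E.obj M ⟶ M) (nat : ∀ {M N : A} (φ : M ⟶ N), E.map φ ≫ ε N = ε M ≫ φ)
    [∀ M, Mono (ε M)] [∀ M, IsIso (L.map (ε M))] [∀ M, IsIso (E.map (adj.unit.app M))] :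
    R ⋙ E ⊣ L :=
  Adjunction.mkOfUnitCounit
    { unit :=
        -- The unit is `N ≅ L R N ≅ L E R N`, and the counit below is `E R L M ≅ E M ⟶ M`.
        { app N := inv (adj.counit.app N) ≫ inv (L.map (ε (R.obj N)))
          naturality N N' φ := by
            dsimp
            have e : φ ≫ inv (adj.counit.app N') = inv (adj.counit.app N) ≫ L.map (R.map φ) := by
              rw [IsIso.comp_inv_eq, Category.assoc, IsIso.eq_inv_comp]
              exact (adj.counit.naturality φ).symm
            rw [← Category.assoc, e, Category.assoc, Category.assoc]
            congr 1
            rw [IsIso.comp_inv_eq, Category.assoc, IsIso.eq_inv_comp, ← L.map_comp, ← L.map_comp, nat] }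
      counit :=
        { app M := inv (E.map (adj.unit.app M)) ≫ ε M
          naturality M N φ := by
            dsimp
            rw [Category.assoc, ← nat φ, ← Category.assoc, ← Category.assoc]
            congr 1
            rw [IsIso.comp_inv_eq, Category.assoc, IsIso.eq_inv_comp, ← E.map_comp, ← E.map_comp]
            exact congrArg E.map (adj.unit.naturality φ).symm }
      left_triangle := by
        ext N
        have e₁ : R.map (inv (adj.counit.app N)) = adj.unit.app (R.obj N) := by
          rw [Functor.map_inv, IsIso.inv_eq_of_inv_hom_id (adj.right_triangle_components N)]
        -- Both sides agree after composition with the monomorphism `ε`, by naturality of `ε`.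
        have e₂ : E.map (ε (R.obj N)) = ε (E.obj (R.obj N)) := by
          rw [← cancel_mono (ε (R.obj N))]
          exact nat _
        have e₃ : E.map (adj.unit.app (E.obj (R.obj N))) ≫ E.map (R.map (L.map (ε (R.obj N)))) =
            E.map (ε (R.obj N)) ≫ E.map (adj.unit.app (R.obj N)) := by
          rw [← E.map_comp, ← E.map_comp]
          exact congrArg E.map (adj.unit.naturality _).symm
        dsimp
        rw [Category.id_comp, Functor.map_comp, Functor.map_comp, e₁, Functor.map_inv,
          Functor.map_inv, ← e₂, Category.assoc]
        rw [← cancel_mono (E.map (adj.unit.app (R.obj N)))]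
        simp only [Category.assoc, ← e₃, IsIso.inv_hom_id_assoc, IsIso.inv_hom_id, Category.comp_id,
          Category.id_comp]
      right_triangle := by
        ext M
        have e : L.map (ε M) ≫ L.map (adj.unit.app M) =
            L.map (E.map (adj.unit.app M)) ≫ L.map (ε (R.obj (L.obj M))) := by
          rw [← L.map_comp, ← L.map_comp]
          exact congrArg L.map (nat _).symm
        dsimp
        rw [Category.id_comp, Functor.map_comp, Functor.map_inv, Category.assoc, IsIso.inv_comp_eq,
          IsIso.inv_comp_eq, IsIso.inv_comp_eq, ← reassoc_of% e]
        rw [Category.comp_id, adj.left_triangle_components M]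
        exact (Category.comp_id _).symm }

instance isIso_leftAdjointOfSubfunctor_unit_app (adj : L ⊣ R) [∀ N, IsIso (adj.counit.app N)] (E : A ⥤ A)
    (ε : ∀ M, E.obj M ⟶ M) (nat : ∀ {M N : A} (φ : M ⟶ N), E.map φ ≫ ε N = ε M ≫ φ)
    [∀ M, Mono (ε M)] [∀ M, IsIso (L.map (ε M))] [∀ M, IsIso (E.map (adj.unit.app M))] (N : B) :
    IsIso ((adj.leftAdjointOfSubfunctor E ε nat).unit.app N) :=
  IsIso.comp_isIso (f := inv (adj.counit.app N)) (h := inv (L.map (ε (R.obj N))))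
end

end CategoryTheory.Adjunction

/-! ### Adjunctions of exact functors on derived categories -/

namespace CategoryTheory.Adjunction
section
variable {A B : Type*} [Category* A] [Category* B] [Abelian A] [Abelian B]
  {F : A ⥤ B} {G : B ⥤ A} [F.Additive] [G.Additive]

/-- An adjunction between additive functors, applied degreewise to cochain complexes. -/
def mapCochainComplex (adj : F ⊣ G) :
    F.mapHomologicalComplex (ComplexShape.up ℤ) ⊣ G.mapHomologicalComplex (ComplexShape.up ℤ) :=
  Adjunction.mkOfUnitCounit
    { unit :=
        { app K :=
            { f i := adj.unit.app (K.X i)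
              comm' i j _ := (adj.unit.naturality (K.d i j)).symm }
          naturality K L φ := by ext i; exact adj.unit.naturality (φ.f i) }
      counit :=
        { app K :=
            { f i := adj.counit.app (K.X i)
              comm' i j _ := (adj.counit.naturality (K.d i j)).symm }
          naturality K L φ := by ext i; exact adj.counit.naturality (φ.f i) }
      left_triangle := by
        ext K i
        have := adj.left_triangle_components (K.X i)
        simp
        exact this
      right_triangle := by
        ext K i
        have := adj.right_triangle_components (K.X i)
        simp
        exact this }

variable [HasDerivedCategory A] [HasDerivedCategory B]
  [PreservesFiniteLimits F] [PreservesFiniteColimits F]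
  [PreservesFiniteLimits G] [PreservesFiniteColimits G]

/-- The adjunction between the derived categories induced by an adjunction of exact functors. -/
noncomputable def mapDerivedCategory (adj : F ⊣ G) : F.mapDerivedCategory ⊣ G.mapDerivedCategory :=
  letI : CatCommSq (F.mapHomologicalComplex (ComplexShape.up ℤ)) DerivedCategory.Q DerivedCategory.Q
    F.mapDerivedCategory := ⟨F.mapDerivedCategoryFactors.symm⟩
  letI : CatCommSq (G.mapHomologicalComplex (ComplexShape.up ℤ)) DerivedCategory.Q DerivedCategory.Q
    G.mapDerivedCategory := ⟨G.mapDerivedCategoryFactors.symm⟩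
  adj.mapCochainComplex.localization DerivedCategory.Q
    (HomologicalComplex.quasiIso A (ComplexShape.up ℤ)) DerivedCategory.Q
    (HomologicalComplex.quasiIso B (ComplexShape.up ℤ)) F.mapDerivedCategory G.mapDerivedCategory

/-- Every object is isomorphic to the image of a complex, where the derived unit is the degreewise
unit up to the comparison isomorphisms of the localization. -/
instance isIso_mapDerivedCategory_unit_app (adj : F ⊣ G) [∀ M, IsIso (adj.unit.app M)] (K : DerivedCategory A) :
    IsIso (adj.mapDerivedCategory.unit.app K) := by
  suffices ∀ L : CochainComplex A ℤ, IsIso (adj.mapDerivedCategory.unit.app (DerivedCategory.Q.obj L)) by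
    have := this (DerivedCategory.Q.objPreimage K)
    exact (NatTrans.isIso_app_iff_of_iso _ (DerivedCategory.Q.objObjPreimageIso K)).1 this
  intro L
  let : CatCommSq (F.mapHomologicalComplex (ComplexShape.up ℤ)) DerivedCategory.Q DerivedCategory.Q
    F.mapDerivedCategory := ⟨F.mapDerivedCategoryFactors.symm⟩
  let : CatCommSq (G.mapHomologicalComplex (ComplexShape.up ℤ)) DerivedCategory.Q DerivedCategory.Q
    G.mapDerivedCategory := ⟨G.mapDerivedCategoryFactors.symm⟩
  have e := adj.mapCochainComplex.localization_unit_app DerivedCategory.Q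
    (HomologicalComplex.quasiIso A (ComplexShape.up ℤ)) DerivedCategory.Q
    (HomologicalComplex.quasiIso B (ComplexShape.up ℤ)) F.mapDerivedCategory G.mapDerivedCategory L
  have : IsIso (adj.mapCochainComplex.unit.app L) :=
    have (i : ℤ) : IsIso ((adj.mapCochainComplex.unit.app L).f i) :=
      inferInstanceAs (IsIso (adj.unit.app (L.X i)))
    HomologicalComplex.Hom.isIso_of_components _
  change IsIso ((adj.mapCochainComplex.localization DerivedCategory.Q
    (HomologicalComplex.quasiIso A (ComplexShape.up ℤ)) DerivedCategory.Q
    (HomologicalComplex.quasiIso B (ComplexShape.up ℤ)) F.mapDerivedCategory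
    G.mapDerivedCategory).unit.app (DerivedCategory.Q.obj L))
  rw [e]
  infer_instance
end
end CategoryTheory.Adjunction

/-! ### Extension by zero along an open immersion -/

namespace AlgebraicGeometry.Scheme.Modules
section
variable {X Y : Scheme.{u}} (f : X ⟶ Y) [IsOpenImmersion f]

theorem isIso_of_isIso_app {M N : X.Modules} (φ : M ⟶ N) (h : ∀ U, IsIso (φ.app U)) : IsIso φ :=
  isIso_of_injective_of_locallySurjective φ (fun U ↦ ((ConcreteCategory.isIso_iff_bijective _).1 (h U)).1)
    (fun U s x hx ↦ by
      obtain ⟨t, ht⟩ := ((ConcreteCategory.isIso_iff_bijective _).1 (h U)).2 s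
      exact ⟨U, le_rfl, hx, t, by rw [ht, res_self]⟩)

/-- Extension by zero along an open immersion. -/
noncomputable def extendByZero : X.Modules ⥤ Y.Modules := pushforward f ⋙ supportFunctor f.opensRange

instance : (extendByZero f).Additive := by unfold extendByZero; infer_instance

instance : PreservesFiniteLimits (extendByZero f) := by
  unfold extendByZero
  have : PreservesFiniteLimits (pushforward f) := inferInstance
  exact comp_preservesFiniteLimits _ _

instance isIso_restrictFunctor_map_supportIncl (M : Y.Modules) :
    IsIso ((restrictFunctor f).map (supportIncl M f.opensRange)) :=
  isIso_of_isIso_app _ fun U ↦ isIso_supportIncl_app (f ''ᵁ U) (f.image_le_opensRange U)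

/-- Over an open subset `V` of the image of `f`, the unit is the restriction map from `V` to `f ''ᵁ
f ⁻¹ᵁ V = V`. -/
instance isIso_supportFunctor_map_unit (M : Y.Modules) :
    IsIso ((supportFunctor f.opensRange).map ((restrictAdjunction f).unit.app M)) :=
  isIso_supportFunctor_map _ fun V hV ↦ by
    rw [restrictAdjunction_unit_app_app]
    have e : f ''ᵁ f ⁻¹ᵁ V = V := by rw [f.image_preimage_eq_opensRange_inf, inf_eq_right.2 hV]
    have : homOfLE (f.image_preimage_le V) = (eqToIso e).hom := Subsingleton.elim _ _
    rw [this]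
    exact Functor.map_isIso M.presheaf (eqToIso e).hom.op

/-- Extension by zero is left adjoint to restriction. -/
noncomputable def extendByZeroRestrictAdjunction : extendByZero f ⊣ restrictFunctor f :=
  (restrictAdjunction f).leftAdjointOfSubfunctor (supportFunctor f.opensRange)
    (fun M ↦ supportIncl M f.opensRange) (fun φ ↦ supportFunctor_map_incl φ)

/-- Extension by zero is left adjoint to the inverse image. -/
noncomputable def extendByZeroAdjunction : extendByZero f ⊣ pullback f :=
  (extendByZeroRestrictAdjunction f).ofNatIsoRight (restrictFunctorIsoPullback f)

instance : PreservesFiniteColimits (extendByZero f) where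
  preservesFiniteColimits _ _ _ := (extendByZeroAdjunction f).leftAdjoint_preservesColimits.preservesColimitsOfShape

instance (M : X.Modules) : IsIso ((extendByZeroAdjunction f).unit.app M) := by
  have : IsIso ((extendByZeroRestrictAdjunction f).unit.app M) := by
    exact Adjunction.isIso_leftAdjointOfSubfunctor_unit_app (restrictAdjunction f) _ _
      (fun φ ↦ supportFunctor_map_incl φ) M
  have e : (extendByZeroAdjunction f).unit.app M = (extendByZeroRestrictAdjunction f).unit.app M ≫
      (restrictFunctorIsoPullback f).hom.app _ := by
    rw [← Adjunction.homEquiv_id, extendByZeroAdjunction, Adjunction.homEquiv_ofNatIsoRight_apply,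
      Adjunction.homEquiv_id]
  rw [e]
  infer_instance
end
end AlgebraicGeometry.Scheme.Modules

/-! ### Cohomology, exact functors and shifts -/

namespace DerivedCategory
section
variable {C D : Type*} [Category* C] [Abelian C] [HasDerivedCategory C]
  [Category* D] [Abelian D] [HasDerivedCategory D]

theorem isZero_of_homology {K : DerivedCategory C} (h : ∀ n, IsZero ((homologyFunctor C n).obj K)) :
    IsZero K := by
  obtain ⟨Z, hZ⟩ : ∃ Z : DerivedCategory C, IsZero Z := HasZeroObject.zero
  have : IsIso (hZ.from_ K) := (isIso_iff C _).2 fun n ↦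
    ⟨0, (h n).eq_of_src _ _, ((homologyFunctor C n).map_isZero hZ).eq_of_src _ _⟩
  exact hZ.of_iso (asIso (hZ.from_ K))

/-- An exact functor commutes with cohomology. -/
theorem nonempty_homology_mapDerivedCategory (F : C ⥤ D) [F.Additive] [PreservesFiniteLimits F]
    [PreservesFiniteColimits F] (K : DerivedCategory C) (n : ℤ) :
    Nonempty ((homologyFunctor D n).obj (F.mapDerivedCategory.obj K) ≅
      F.obj ((homologyFunctor C n).obj K)) := by
  let L := Q.objPreimage K
  let e : Q.obj L ≅ K := Q.objObjPreimageIso K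
  let e₁ : F.mapDerivedCategory.obj K ≅
      Q.obj ((F.mapHomologicalComplex (ComplexShape.up ℤ)).obj L) :=
    F.mapDerivedCategory.mapIso e.symm ≪≫ F.mapDerivedCategoryFactors.app L
  let e₂ := (homologyFunctor D n).mapIso e₁ ≪≫ (homologyFunctorFactors D n).app _
  let e₃ : (HomologicalComplex.homologyFunctor D (ComplexShape.up ℤ) n).obj
      ((F.mapHomologicalComplex (ComplexShape.up ℤ)).obj L) ≅ F.obj (L.homology n) :=
    (L.sc n).mapHomologyIso F
  exact ⟨e₂ ≪≫ e₃ ≪≫ F.mapIso (((homologyFunctorFactors C n).app L).symm ≪≫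
    (homologyFunctor C n).mapIso e)⟩

theorem nonempty_homology_shift (K : DerivedCategory C) (n : ℤ) (a : ℤ) :
    Nonempty ((homologyFunctor C n).obj ((shiftFunctor _ a).obj K) ≅ (homologyFunctor C (a + n)).obj K) :=
  ⟨((homologyFunctor C 0).shiftIso a n (a + n) rfl).app K⟩
end
end DerivedCategory

/-! ### Vanishing of stalks -/

namespace AlgebraicGeometry.Scheme.Modules
section
variable {X Y : Scheme.{u}} {M N : X.Modules}

/-- The stalk of `M` at `x` is zero. -/
def VanishesAt (M : X.Modules) (x : X) : Prop :=
  ∀ (U : X.Opens) (s : Γ(M, U)), x ∈ U → ∃ (V : X.Opens) (hV : V ≤ U), x ∈ V ∧ M.res hV s = 0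

theorem VanishesAt.of_iso {x : X} (h : M.VanishesAt x) (e : M ≅ N) : N.VanishesAt x := by
  intro U s hx
  obtain ⟨V, hV, hxV, hs⟩ := h U (e.inv.app U s) hx
  refine ⟨V, hV, hxV, ?_⟩
  have : N.res hV s = e.hom.app V (M.res hV (e.inv.app U s)) := by
    rw [app_res, ← comp_app_apply, e.inv_hom_id]
    rfl
  rw [this, hs, map_zero]

theorem VanishesAt.of_exact {S : ShortComplex X.Modules} (hS : S.Exact) {x : X}
    (h₁ : S.X₁.VanishesAt x) (h₃ : S.X₃.VanishesAt x) : S.X₂.VanishesAt x := by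
  intro U s hx
  obtain ⟨V, hV, hxV, hs⟩ := h₃ U (S.g.app U s) hx
  rw [← app_res] at hs
  obtain ⟨W, hW, hxW, t, ht⟩ := exists_local_of_exact hS _ hs x hxV
  obtain ⟨W', hW', hxW', e⟩ := h₁ W t hxW
  refine ⟨W', (hW'.trans hW).trans hV, hxW', ?_⟩
  rw [← res_res hV (hW'.trans hW), ← res_res hW hW', ← ht, ← app_res, e, map_zero]

theorem isZero_iff_forall_app_eq_zero : IsZero M ↔ ∀ (U : X.Opens) (s : Γ(M, U)), s = 0 := by
  rw [IsZero.iff_id_eq_zero]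
  refine ⟨fun h U s ↦ ?_, fun h ↦ ?_⟩
  · exact congr($(h).app U s)
  · ext U s
    exact h U s

theorem isZero_iff_forall_vanishesAt : IsZero M ↔ ∀ x, M.VanishesAt x := by
  rw [isZero_iff_forall_app_eq_zero]
  refine ⟨fun h x U s hx ↦ ⟨U, le_rfl, hx, h _ _⟩, fun h U s ↦ eq_of_forall_exists_res_eq fun x hx ↦ ?_⟩
  obtain ⟨V, hV, hxV, hs⟩ := h x U s hx
  exact ⟨V, hV, hxV, by rw [hs, map_zero]⟩

theorem isZero_pullback_iff (f : X ⟶ Y) [IsOpenImmersion f] (M : Y.Modules) :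
    IsZero ((pullback f).obj M) ↔ ∀ x ∈ f.opensRange, M.VanishesAt x := by
  rw [← ((restrictFunctorIsoPullback f).app M).isZero_iff, isZero_iff_forall_app_eq_zero]
  constructor
  · intro h x hx U s hxU
    have hV : f ''ᵁ f ⁻¹ᵁ U ≤ U := f.image_preimage_le U
    refine ⟨f ''ᵁ f ⁻¹ᵁ U, hV, ?_, h (f ⁻¹ᵁ U) (M.res hV s)⟩
    rw [f.image_preimage_eq_opensRange_inf]
    exact ⟨hx, hxU⟩
  · intro h U s
    change (show Γ(M, f ''ᵁ U) from s) = 0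
    refine eq_of_forall_exists_res_eq fun x hx ↦ ?_
    obtain ⟨V, hV, hxV, hs⟩ := h x (f.image_le_opensRange U hx) (f ''ᵁ U) s hx
    exact ⟨V, hV, hxV, by rw [map_zero]; exact hs⟩

theorem vanishesAt_extendByZero (f : X ⟶ Y) [IsOpenImmersion f] (M : X.Modules) (x : Y)
    (hx : x ∉ f.opensRange) : ((extendByZero f).obj M).VanishesAt x := by
  intro U s hxU
  obtain ⟨V, hV, hxV, hs⟩ := supportIncl_mem (M := (pushforward f).obj M) (U := f.opensRange) s x hxU hx
  exact ⟨V, hV, hxV, supportIncl_injective (M := (pushforward f).obj M) (U := f.opensRange) V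
    ((app_res _ hV s).trans (hs.trans (map_zero _).symm))⟩
end
end AlgebraicGeometry.Scheme.Modules

/-! ### Extension by zero and supports in the derived category -/

namespace DerivedDescent
section
open Pretriangulated
variable {X Y : Scheme.{u}}

instance isLocalIso_of_isOpenImmersion (f : X ⟶ Y) [IsOpenImmersion f] : IsLocalIso f :=
  ⟨fun _ ↦ ⟨⊤, trivial, inferInstance⟩⟩

/-- All cohomology sheaves of `K` have zero stalk at `x`. -/
def VanishesAt (K : DMod X) (x : X) : Prop := ∀ n : ℤ, ((cohomology X n).obj K).VanishesAt x

theorem VanishesAt.shift {K : DMod X} {x : X} (h : VanishesAt K x) (a : ℤ) : VanishesAt (K⟦a⟧) x :=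
  fun n ↦ by
    obtain ⟨e⟩ := DerivedCategory.nonempty_homology_shift K n a
    exact (h _).of_iso e.symm

theorem VanishesAt.obj₂ {T : Triangle (DMod X)} (hT : T ∈ distTriang _) {x : X}
    (h₁ : VanishesAt T.obj₁ x) (h₃ : VanishesAt T.obj₃ x) : VanishesAt T.obj₂ x := fun n ↦
  (h₁ n).of_exact (DerivedCategory.HomologySequence.exact₂ T hT n) (h₃ n)

theorem VanishesAt.obj₃ {T : Triangle (DMod X)} (hT : T ∈ distTriang _) {x : X}
    (h₁ : VanishesAt T.obj₁ x) (h₂ : VanishesAt T.obj₂ x) : VanishesAt T.obj₃ x :=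
  VanishesAt.obj₂ (rot_of_distTriang _ hT) h₂ (h₁.shift 1)

theorem isZero_iff_forall_vanishesAt {K : DMod X} : IsZero K ↔ ∀ x, VanishesAt K x := by
  refine ⟨fun h x n ↦ ?_, fun h ↦ DerivedCategory.isZero_of_homology fun n ↦ ?_⟩
  · exact Scheme.Modules.isZero_iff_forall_vanishesAt.1 ((cohomology X n).map_isZero h) x
  · exact Scheme.Modules.isZero_iff_forall_vanishesAt.2 fun x ↦ h x n

theorem isZero_pullbackD_iff (f : X ⟶ Y) [IsOpenImmersion f] (K : DMod Y) :
    IsZero ((pullbackD f).obj K) ↔ ∀ x ∈ f.opensRange, VanishesAt K x := by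
  have (n : ℤ) : IsZero ((cohomology X n).obj ((pullbackD f).obj K)) ↔
      ∀ x ∈ f.opensRange, ((cohomology Y n).obj K).VanishesAt x := by
    obtain ⟨e⟩ := nonempty_homology_pullbackD f K n
    rw [e.isZero_iff, Scheme.Modules.isZero_pullback_iff]
  refine ⟨fun h x hx n ↦ (this n).1 ((cohomology X n).map_isZero h) x hx, fun h ↦
    DerivedCategory.isZero_of_homology fun n ↦ (this n).2 fun x hx ↦ h x hx n⟩

noncomputable section

/-- Extension by zero along an open immersion, on derived categories. -/
def extendByZeroD (f : X ⟶ Y) [IsOpenImmersion f] : DMod X ⥤ DMod Y :=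
  (Scheme.Modules.extendByZero f).mapDerivedCategory

/-- Extension by zero is left adjoint to the inverse image. -/
def extendByZeroDAdjunction (f : X ⟶ Y) [IsOpenImmersion f] : extendByZeroD f ⊣ pullbackD f :=
  (Scheme.Modules.extendByZeroAdjunction f).mapDerivedCategory

instance (f : X ⟶ Y) [IsOpenImmersion f] (K : DMod X) : IsIso ((extendByZeroDAdjunction f).unit.app K) := by
  exact Adjunction.isIso_mapDerivedCategory_unit_app (Scheme.Modules.extendByZeroAdjunction f) K

theorem vanishesAt_extendByZeroD (f : X ⟶ Y) [IsOpenImmersion f] (K : DMod X) (x : Y)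
    (hx : x ∉ f.opensRange) : VanishesAt ((extendByZeroD f).obj K) x := fun n ↦ by
  obtain ⟨e⟩ := DerivedCategory.nonempty_homology_mapDerivedCategory (Scheme.Modules.extendByZero f) K n
  exact (Scheme.Modules.vanishesAt_extendByZero f _ x hx).of_iso e.symm

instance (f : X ⟶ Y) [IsLocalIso f] : (pullbackD f).CommShift ℤ :=
  inferInstanceAs ((Scheme.Modules.pullback f).mapDerivedCategory.CommShift ℤ)
instance (f : X ⟶ Y) [IsLocalIso f] : (pullbackD f).IsTriangulated :=
  inferInstanceAs ((Scheme.Modules.pullback f).mapDerivedCategory.IsTriangulated)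
instance (f : X ⟶ Y) [IsLocalIso f] : (pullbackD f).Additive := inferInstance
instance (f : X ⟶ Y) [IsOpenImmersion f] : (extendByZeroD f).CommShift ℤ :=
  inferInstanceAs ((Scheme.Modules.extendByZero f).mapDerivedCategory.CommShift ℤ)
instance (f : X ⟶ Y) [IsOpenImmersion f] : (extendByZeroD f).IsTriangulated :=
  inferInstanceAs ((Scheme.Modules.extendByZero f).mapDerivedCategory.IsTriangulated)

/-- A morphism inverted by `Lf^*` is inverted by `Lg^*` if the cone vanishes at the other points. -/
theorem isIso_pullbackD_map_iff (f : X ⟶ Y) [IsOpenImmersion f] {T : Triangle (DMod Y)}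
    (hT : T ∈ distTriang _) :
    IsIso ((pullbackD f).map T.mor₁) ↔ ∀ x ∈ f.opensRange, VanishesAt T.obj₃ x := by
  rw [← isZero_pullbackD_iff]
  exact (Triangle.isZero₃_iff_isIso₁ _ ((pullbackD f).map_distinguished T hT)).symm

theorem isIso_iff_forall_vanishesAt {T : Triangle (DMod Y)} (hT : T ∈ distTriang _) :
    IsIso T.mor₁ ↔ ∀ x, VanishesAt T.obj₃ x := by
  rw [← isZero_iff_forall_vanishesAt]
  exact (Triangle.isZero₃_iff_isIso₁ _ hT).symm
end
end
end DerivedDescent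

/-! ### Mayer–Vietoris gluing in triangulated categories -/

namespace CategoryTheory.Pretriangulated
section
variable {C : Type*} [Category* C] [HasZeroObject C] [HasShift C ℤ] [Preadditive C]
  [∀ n : ℤ, (shiftFunctor C n).Additive] [Pretriangulated C]

/-- If in a distinguished triangle `X ⟶ A₁ ⊞ A₂ ⟶ Z ⟶ X⟦1⟧` the component `X ⟶ A₂` is an
isomorphism, then so is `A₁ ⟶ Z`. -/
theorem isIso_comp_mor₂_of_isIso {T : Triangle C} (hT : T ∈ distTriang C) {A₁ A₂ : C}
    (i₁ : A₁ ⟶ T.obj₂) (p₁ : T.obj₂ ⟶ A₁) (i₂ : A₂ ⟶ T.obj₂) (p₂ : T.obj₂ ⟶ A₂)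
    (h₁ : i₁ ≫ p₁ = 𝟙 _) (h₁₂ : i₁ ≫ p₂ = 0) (h : p₁ ≫ i₁ + p₂ ≫ i₂ = 𝟙 _)
    [IsIso (T.mor₁ ≫ p₂)] : IsIso (i₁ ≫ T.mor₂) := by
  have h₂ : p₂ ≫ i₂ ≫ p₂ = p₂ := by
    have := congrArg (· ≫ p₂) h
    simpa [h₁₂] using this
  -- `r` retracts `T.mor₁`, so the triangle splits: `T.mor₃ = 0` and `T.mor₂` is epi.
  let r := p₂ ≫ inv (T.mor₁ ≫ p₂)
  have hr : T.mor₁ ≫ r = 𝟙 _ := by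
    rw [← Category.assoc, IsIso.hom_inv_id]
  have hr' : r ≫ T.mor₁ ≫ p₂ = p₂ := by simp [r]
  have hi : i₁ ≫ r = 0 := by simp [r, reassoc_of% h₁₂]
  have h₃ : T.mor₃ = 0 := by
    have := congrArg (· ≫ (shiftFunctor C (1 : ℤ)).map r) (comp_distTriang_mor_zero₃₁ T hT)
    simpa [← Functor.map_comp, hr] using this
  have hg : Epi T.mor₂ := (Triangle.epi₂ T hT h₃)
  have hfg : T.mor₁ ≫ T.mor₂ = 0 := comp_distTriang_mor_zero₁₂ T hT
  -- The projector `𝟙 - r ≫ T.mor₁` has no `A₂` component, since `r ≫ T.mor₁ ≫ p₂ = p₂`; projecting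
  -- further to `A₁` loses nothing.
  have e : (𝟙 _ - r ≫ T.mor₁) ≫ p₁ ≫ i₁ = 𝟙 _ - r ≫ T.mor₁ := by
    have : p₁ ≫ i₁ = 𝟙 _ - p₂ ≫ i₂ := eq_sub_of_add_eq h
    have h' : (r ≫ T.mor₁) ≫ p₂ ≫ i₂ = p₂ ≫ i₂ := by
      rw [Category.assoc, ← Category.assoc T.mor₁, ← Category.assoc, hr']
    rw [this, Preadditive.comp_sub, Category.comp_id, Preadditive.sub_comp _ _ (p₂ ≫ i₂), h',
      Category.id_comp, sub_self, sub_zero]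
  -- The projector kills `T.mor₁`, so its `A₁` component descends along `T.mor₂` to `q`, which is
  -- the inverse sought.
  obtain ⟨q, hq⟩ := Triangle.yoneda_exact₂ T hT ((𝟙 _ - r ≫ T.mor₁) ≫ p₁) (by
    rw [← Category.assoc, Preadditive.comp_sub, Category.comp_id, ← Category.assoc, hr,
      Category.id_comp, sub_self, zero_comp])
  refine ⟨q, ?_, ?_⟩
  · rw [Category.assoc, ← hq, ← Category.assoc, Preadditive.comp_sub, Category.comp_id,
      ← Category.assoc, hi, zero_comp, sub_zero, h₁]
  · rw [← cancel_epi T.mor₂, ← Category.assoc, ← hq, Category.assoc, ← Category.assoc p₁,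
      ← Category.assoc, e, Preadditive.sub_comp, Category.assoc, hfg, comp_zero, sub_zero,
      Category.id_comp, Category.comp_id]
end

section
variable {D D₁ D₂ D₀ : Type*} [Category* D] [Category* D₁] [Category* D₂] [Category* D₀]
  [HasZeroObject D] [HasShift D ℤ] [Preadditive D] [∀ n : ℤ, (shiftFunctor D n).Additive] [Pretriangulated D]
  [HasZeroObject D₁] [HasShift D₁ ℤ] [Preadditive D₁] [∀ n : ℤ, (shiftFunctor D₁ n).Additive] [Pretriangulated D₁]
  [HasZeroObject D₂] [HasShift D₂ ℤ] [Preadditive D₂] [∀ n : ℤ, (shiftFunctor D₂ n).Additive] [Pretriangulated D₂]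
  {P₁ : D ⥤ D₁} {P₂ : D ⥤ D₂} {P₀ : D ⥤ D₀} {K₁ : D₁ ⥤ D₀} {K₂ : D₂ ⥤ D₀}
  [P₁.CommShift ℤ] [P₁.IsTriangulated] [P₂.CommShift ℤ] [P₂.IsTriangulated]
  {J₁ : D₁ ⥤ D} {J₂ : D₂ ⥤ D} {J₀ : D₀ ⥤ D}

/-- Mayer–Vietoris gluing of objects along restriction functors `P₁`, `P₂` to an open covering
with intersection `P₀`, when the restriction functors have left adjoints `J₁`, `J₂`, `J₀`. -/
theorem exists_gluing (κ₁ : P₁ ⋙ K₁ ≅ P₀) (κ₂ : P₂ ⋙ K₂ ≅ P₀)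
    (a₁ : J₁ ⊣ P₁) (a₂ : J₂ ⊣ P₂) (a₀ : J₀ ⊣ P₀)
    [∀ F, IsIso (a₁.unit.app F)] [∀ F, IsIso (a₂.unit.app F)] [∀ F, IsIso (a₀.unit.app F)]
    (h₁ : ∀ (A : D₀) (B : D₂) (v : J₀.obj A ⟶ J₂.obj B), IsIso (P₀.map v) → IsIso (P₁.map v))
    (h₂ : ∀ (A : D₀) (B : D₁) (v : J₀.obj A ⟶ J₁.obj B), IsIso (P₀.map v) → IsIso (P₂.map v))
    (F₁ : D₁) (F₂ : D₂) (θ : K₁.obj F₁ ≅ K₂.obj F₂) :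
    ∃ (H : D) (ρ₁ : F₁ ≅ P₁.obj H) (ρ₂ : F₂ ≅ P₂.obj H),
      K₁.map ρ₁.hom ≫ κ₁.hom.app H = θ.hom ≫ K₂.map ρ₂.hom ≫ κ₂.hom.app H ∧
      (∀ (L : D) (σ₁ : F₁ ⟶ P₁.obj L) (σ₂ : F₂ ⟶ P₂.obj L),
        K₁.map σ₁ ≫ κ₁.hom.app L = θ.hom ≫ K₂.map σ₂ ≫ κ₂.hom.app L →
        ∃ m : H ⟶ L, ρ₁.hom ≫ P₁.map m = σ₁ ∧ ρ₂.hom ≫ P₂.map m = σ₂) ∧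
      (IsZero (J₀.obj (K₁.obj F₁)) → ∀ (L : D) (m : H ⟶ L), P₁.map m = 0 → P₂.map m = 0 → m = 0) := by
  -- `u` and `v` are the maps `j₀_! F₀ ⟶ j_i_! F_i`, adjoint to the identification of `F₀ = K₁ F₁`
  -- with the restriction of `j_i_! F_i`; for `v` this identification passes through `θ`.
  let u := (a₀.homEquiv (K₁.obj F₁) (J₁.obj F₁)).symm
    (K₁.map (a₁.unit.app F₁) ≫ κ₁.hom.app (J₁.obj F₁))
  let v := (a₀.homEquiv (K₁.obj F₁) (J₂.obj F₂)).symm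
    (θ.hom ≫ K₂.map (a₂.unit.app F₂) ≫ κ₂.hom.app (J₂.obj F₂))
  have hu : a₀.unit.app _ ≫ P₀.map u = K₁.map (a₁.unit.app F₁) ≫ κ₁.hom.app (J₁.obj F₁) := by
    exact (a₀.homEquiv_unit _ _ _).symm.trans (Equiv.apply_symm_apply _ _)
  have hv : a₀.unit.app _ ≫ P₀.map v = θ.hom ≫ K₂.map (a₂.unit.app F₂) ≫ κ₂.hom.app (J₂.obj F₂) := by
    exact (a₀.homEquiv_unit _ _ _).symm.trans (Equiv.apply_symm_apply _ _)
  have hu' : IsIso (P₀.map u) := by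
    have : IsIso (a₀.unit.app (K₁.obj F₁) ≫ P₀.map u) := by rw [hu]; infer_instance
    exact IsIso.of_isIso_comp_left (a₀.unit.app (K₁.obj F₁)) _
  have hv' : IsIso (P₀.map v) := by
    have : IsIso (a₀.unit.app (K₁.obj F₁) ≫ P₀.map v) := by rw [hv]; infer_instance
    exact IsIso.of_isIso_comp_left (a₀.unit.app (K₁.obj F₁)) _
  have hu₂ := h₂ _ _ u hu'
  have hv₁ := h₁ _ _ v hv'
  -- The Mayer–Vietoris triangle, whose third object is the glued object `H`.
  obtain ⟨H, g, δ, hT⟩ := distinguished_cocone_triangle (biprod.lift u (-v))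
  let T := Triangle.mk (biprod.lift u (-v)) g δ
  have hug : u ≫ biprod.inl ≫ g = v ≫ biprod.inr ≫ g := by
    have : biprod.lift u (-v) ≫ g = 0 := comp_distTriang_mor_zero₁₂ T hT
    rw [biprod.lift_eq, Preadditive.add_comp, Preadditive.neg_comp, Preadditive.neg_comp,
      add_neg_eq_zero, Category.assoc, Category.assoc] at this
    exact this
  -- Over `U₁` the component `v` becomes invertible, so the other summand `j₁_! F₁` maps
  -- isomorphically to `H` there; over `U₂` the roles are exchanged.
  have hi₁ : IsIso (P₁.map (biprod.inl ≫ g)) := by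
    have : IsIso ((P₁.mapTriangle.obj T).mor₁ ≫ P₁.map biprod.snd) := by
      change IsIso (P₁.map (biprod.lift u (-v)) ≫ P₁.map biprod.snd)
      rw [← P₁.map_comp, biprod.lift_snd, P₁.map_neg]
      exact ⟨-inv (P₁.map v), by simp, by simp⟩
    rw [P₁.map_comp]
    have e₁ : P₁.map (biprod.inl : J₁.obj F₁ ⟶ J₁.obj F₁ ⊞ J₂.obj F₂) ≫ P₁.map biprod.fst = 𝟙 _ := by
      rw [← P₁.map_comp, biprod.inl_fst, P₁.map_id]
    have e₂ : P₁.map (biprod.inl : J₁.obj F₁ ⟶ J₁.obj F₁ ⊞ J₂.obj F₂) ≫ P₁.map biprod.snd = 0 := by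
      rw [← P₁.map_comp, biprod.inl_snd, P₁.map_zero]
    have e₃ : P₁.map (biprod.fst : J₁.obj F₁ ⊞ J₂.obj F₂ ⟶ _) ≫ P₁.map biprod.inl +
        P₁.map biprod.snd ≫ P₁.map biprod.inr = 𝟙 _ := by
      rw [← P₁.map_comp, ← P₁.map_comp, ← P₁.map_add, biprod.total, P₁.map_id]
    exact isIso_comp_mor₂_of_isIso (P₁.map_distinguished T hT) (P₁.map biprod.inl)
      (P₁.map biprod.fst) (P₁.map biprod.inr) (P₁.map biprod.snd)
      e₁ e₂ e₃
  have hi₂ : IsIso (P₂.map (biprod.inr ≫ g)) := by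
    have : IsIso ((P₂.mapTriangle.obj T).mor₁ ≫ P₂.map biprod.fst) := by
      change IsIso (P₂.map (biprod.lift u (-v)) ≫ P₂.map biprod.fst)
      rw [← P₂.map_comp, biprod.lift_fst]
      infer_instance
    rw [P₂.map_comp]
    have e₁ : P₂.map (biprod.inr : J₂.obj F₂ ⟶ J₁.obj F₁ ⊞ J₂.obj F₂) ≫ P₂.map biprod.snd = 𝟙 _ := by
      rw [← P₂.map_comp, biprod.inr_snd, P₂.map_id]
    have e₂ : P₂.map (biprod.inr : J₂.obj F₂ ⟶ J₁.obj F₁ ⊞ J₂.obj F₂) ≫ P₂.map biprod.fst = 0 := by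
      rw [← P₂.map_comp, biprod.inr_fst, P₂.map_zero]
    have e₃ : P₂.map (biprod.snd : J₁.obj F₁ ⊞ J₂.obj F₂ ⟶ _) ≫ P₂.map biprod.inr +
        P₂.map biprod.fst ≫ P₂.map biprod.inl = 𝟙 _ := by
      rw [← P₂.map_comp, ← P₂.map_comp, ← P₂.map_add, add_comm, biprod.total, P₂.map_id]
    exact isIso_comp_mor₂_of_isIso (P₂.map_distinguished T hT) (P₂.map biprod.inr)
      (P₂.map biprod.snd) (P₂.map biprod.inl) (P₂.map biprod.fst)
      e₁ e₂ e₃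
  have hκ₁ {B : D} (a : J₁.obj F₁ ⟶ B) : a₀.unit.app _ ≫ P₀.map (u ≫ a) =
      K₁.map (a₁.unit.app F₁ ≫ P₁.map a) ≫ κ₁.hom.app B := by
    rw [P₀.map_comp, reassoc_of% hu, K₁.map_comp, Category.assoc]
    exact congrArg (_ ≫ ·) (κ₁.hom.naturality a).symm
  have hκ₂ {B : D} (a : J₂.obj F₂ ⟶ B) : a₀.unit.app _ ≫ P₀.map (v ≫ a) =
      θ.hom ≫ K₂.map (a₂.unit.app F₂ ≫ P₂.map a) ≫ κ₂.hom.app B := by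
    rw [P₀.map_comp, reassoc_of% hv, K₂.map_comp, Category.assoc]
    exact congrArg (θ.hom ≫ _ ≫ ·) (κ₂.hom.naturality a).symm
  refine ⟨H, asIso (a₁.unit.app F₁) ≪≫ asIso (P₁.map (biprod.inl ≫ g)),
    asIso (a₂.unit.app F₂) ≪≫ asIso (P₂.map (biprod.inr ≫ g)), ?_, fun L σ₁ σ₂ hσ ↦ ?_,
    fun hA L m hm₁ hm₂ ↦ ?_⟩
  · exact (hκ₁ _).symm.trans ((congrArg (a₀.unit.app _ ≫ P₀.map ·) hug).trans (hκ₂ _))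
  · obtain ⟨b₁, rfl⟩ := (a₁.homEquiv _ _).surjective σ₁
    obtain ⟨b₂, rfl⟩ := (a₂.homEquiv _ _).surjective σ₂
    rw [a₁.homEquiv_unit, a₂.homEquiv_unit, ← hκ₁, ← hκ₂] at hσ
    -- By adjunction for `J₀`, agreement on the intersection says exactly that the pair `(b₁, b₂)`
    -- kills `(u, -v)`, hence factors through `H`.
    have hb : u ≫ b₁ = v ≫ b₂ := (a₀.homEquiv _ _).injective
      ((a₀.homEquiv_unit _ _ _).trans (hσ.trans (a₀.homEquiv_unit _ _ _).symm))
    obtain ⟨m, hm⟩ : ∃ m : H ⟶ L, biprod.desc b₁ b₂ = g ≫ m := Triangle.yoneda_exact₂ T hT _ (by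
      change biprod.lift u (-v) ≫ biprod.desc b₁ b₂ = 0
      rw [biprod.lift_desc, Preadditive.neg_comp, hb, add_neg_cancel])
    refine ⟨m, ?_, ?_⟩
    · dsimp
      rw [a₁.homEquiv_unit, Category.assoc, ← P₁.map_comp, Category.assoc, ← hm, biprod.inl_desc]
    · dsimp
      rw [a₂.homEquiv_unit, Category.assoc, ← P₂.map_comp, Category.assoc, ← hm, biprod.inr_desc]
  · have e₁ : (biprod.inl ≫ g) ≫ m = 0 := (a₁.homEquiv _ _).injective (by
      rw [a₁.homEquiv_unit, a₁.homEquiv_unit, P₁.map_comp, hm₁, comp_zero, P₁.map_zero])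
    have e₂ : (biprod.inr ≫ g) ≫ m = 0 := (a₂.homEquiv _ _).injective (by
      rw [a₂.homEquiv_unit, a₂.homEquiv_unit, P₂.map_comp, hm₂, comp_zero, P₂.map_zero])
    have e : T.mor₂ ≫ m = 0 := by
      change g ≫ m = 0
      apply biprod.hom_ext'
      · rw [← Category.assoc, e₁, comp_zero]
      · rw [← Category.assoc, e₂, comp_zero]
    -- A morphism vanishing on both pieces factors through `(j₀_! F₀)[1]`; this is the only
    -- obstruction to uniqueness, and it disappears when `j₀_! F₀` is zero.
    obtain ⟨w, hw⟩ := Triangle.yoneda_exact₃ T hT m e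
    have hz : IsZero (T.obj₁⟦(1 : ℤ)⟧) := (shiftFunctor D (1 : ℤ)).map_isZero hA
    rw [hw, hz.eq_of_src w 0]
    exact comp_zero
end
end CategoryTheory.Pretriangulated

/-! ### Gluing in the derived category of a scheme covered by two open subschemes -/

namespace DerivedDescent
section
open Pretriangulated
variable {Y U₁ U₂ U₀ : Scheme.{u}} {j₁ : U₁ ⟶ Y} {j₂ : U₂ ⟶ Y} {j₀ : U₀ ⟶ Y}
  [IsOpenImmersion j₁] [IsOpenImmersion j₂] [IsOpenImmersion j₀]

/-- The cone of `v` vanishes at each point of `U₁`: such a point lies either in `U₂`, hence in `U₀`,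
where `v` is invertible, or outside `U₂`, where source and target both vanish. -/
theorem isIso_pullbackD_map_of_extendByZeroD (h : j₁.opensRange ⊓ j₂.opensRange ≤ j₀.opensRange)
    (h₀ : j₀.opensRange ≤ j₂.opensRange) {A : DMod U₀} {B : DMod U₂}
    (v : (extendByZeroD j₀).obj A ⟶ (extendByZeroD j₂).obj B) (hv : IsIso ((pullbackD j₀).map v)) :
    IsIso ((pullbackD j₁).map v) := by
  obtain ⟨W, g, δ, hT⟩ := distinguished_cocone_triangle v
  refine (isIso_pullbackD_map_iff j₁ hT).2 fun x hx ↦ ?_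
  by_cases hx₂ : x ∈ j₂.opensRange
  · exact (isIso_pullbackD_map_iff j₀ hT).1 hv x (h ⟨hx, hx₂⟩)
  · exact VanishesAt.obj₃ hT (vanishesAt_extendByZeroD j₀ A x fun h' ↦ hx₂ (h₀ h'))
      (vanishesAt_extendByZeroD j₂ B x hx₂)

/-- Mayer–Vietoris gluing for an open covering by two open subschemes. -/
theorem exists_gluing {k₁ : U₀ ⟶ U₁} {k₂ : U₀ ⟶ U₂} [IsLocalIso k₁] [IsLocalIso k₂] (w₁ : k₁ ≫ j₁ = j₀)
    (w₂ : k₂ ≫ j₂ = j₀) (h : j₁.opensRange ⊓ j₂.opensRange ≤ j₀.opensRange)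
    (F₁ : DMod U₁) (F₂ : DMod U₂) (θ : (pullbackD k₁).obj F₁ ≅ (pullbackD k₂).obj F₂) :
    ∃ (H : DMod Y) (ρ₁ : F₁ ≅ (pullbackD j₁).obj H) (ρ₂ : F₂ ≅ (pullbackD j₂).obj H),
      (pullbackD k₁).map ρ₁.hom ≫ (pullbackDComp k₁ j₁ j₀ w₁).hom.app H =
        θ.hom ≫ (pullbackD k₂).map ρ₂.hom ≫ (pullbackDComp k₂ j₂ j₀ w₂).hom.app H ∧
      (∀ (L : DMod Y) (σ₁ : F₁ ⟶ (pullbackD j₁).obj L) (σ₂ : F₂ ⟶ (pullbackD j₂).obj L),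
        (pullbackD k₁).map σ₁ ≫ (pullbackDComp k₁ j₁ j₀ w₁).hom.app L =
          θ.hom ≫ (pullbackD k₂).map σ₂ ≫ (pullbackDComp k₂ j₂ j₀ w₂).hom.app L →
        ∃ m : H ⟶ L, ρ₁.hom ≫ (pullbackD j₁).map m = σ₁ ∧ ρ₂.hom ≫ (pullbackD j₂).map m = σ₂) ∧
      (IsZero ((pullbackD k₁).obj F₁) → ∀ (L : DMod Y) (m : H ⟶ L),
        (pullbackD j₁).map m = 0 → (pullbackD j₂).map m = 0 → m = 0) := by
  have h₁ : j₀.opensRange ≤ j₁.opensRange := by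
    rintro _ ⟨x, rfl⟩
    exact ⟨k₁ x, by rw [← w₁]; rfl⟩
  have h₂ : j₀.opensRange ≤ j₂.opensRange := by
    rintro _ ⟨x, rfl⟩
    exact ⟨k₂ x, by rw [← w₂]; rfl⟩
  obtain ⟨H, ρ₁, ρ₂, e, hu, hz⟩ := CategoryTheory.Pretriangulated.exists_gluing
    (pullbackDComp k₁ j₁ j₀ w₁) (pullbackDComp k₂ j₂ j₀ w₂) (extendByZeroDAdjunction j₁)
    (extendByZeroDAdjunction j₂) (extendByZeroDAdjunction j₀)
    (fun _ _ v ↦ isIso_pullbackD_map_of_extendByZeroD h h₂ v)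
    (fun _ _ v ↦ isIso_pullbackD_map_of_extendByZeroD (by rwa [inf_comm]) h₁ v) F₁ F₂ θ
  exact ⟨H, ρ₁, ρ₂, e, hu, fun hA ↦ hz ((extendByZeroD j₀).map_isZero hA)⟩

theorem isIso_of_isIso_pullbackD_map (h : j₁.opensRange ⊔ j₂.opensRange = ⊤) {K L : DMod Y} (φ : K ⟶ L)
    (h₁ : IsIso ((pullbackD j₁).map φ)) (h₂ : IsIso ((pullbackD j₂).map φ)) : IsIso φ := by
  obtain ⟨W, g, δ, hT⟩ := distinguished_cocone_triangle φ
  refine (isIso_iff_forall_vanishesAt hT).2 fun x ↦ ?_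
  obtain hx | hx : x ∈ j₁.opensRange ⊔ j₂.opensRange := h ▸ trivial
  · exact (isIso_pullbackD_map_iff j₁ hT).1 h₁ x hx
  · exact (isIso_pullbackD_map_iff j₂ hT).1 h₂ x hx

/-- Morphisms in the derived category glue along an open covering by two open subschemes. -/
theorem exists_pullbackD_map_eq {k₁ : U₀ ⟶ U₁} {k₂ : U₀ ⟶ U₂} [IsLocalIso k₁] [IsLocalIso k₂]
    (w₁ : k₁ ≫ j₁ = j₀) (w₂ : k₂ ≫ j₂ = j₀)
    (h : j₁.opensRange ⊓ j₂.opensRange ≤ j₀.opensRange) (h' : j₁.opensRange ⊔ j₂.opensRange = ⊤)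
    {K L : DMod Y} (φ₁ : (pullbackD j₁).obj K ⟶ (pullbackD j₁).obj L)
    (φ₂ : (pullbackD j₂).obj K ⟶ (pullbackD j₂).obj L)
    (e : (pullbackDComp k₁ j₁ j₀ w₁).inv.app K ≫ (pullbackD k₁).map φ₁ ≫
        (pullbackDComp k₁ j₁ j₀ w₁).hom.app L =
      (pullbackDComp k₂ j₂ j₀ w₂).inv.app K ≫ (pullbackD k₂).map φ₂ ≫
        (pullbackDComp k₂ j₂ j₀ w₂).hom.app L) :
    ∃ φ : K ⟶ L, (pullbackD j₁).map φ = φ₁ ∧ (pullbackD j₂).map φ = φ₂ := by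
  let θ := (pullbackDComp k₁ j₁ j₀ w₁).app K ≪≫ ((pullbackDComp k₂ j₂ j₀ w₂).app K).symm
  have hθ : θ.hom ≫ (pullbackDComp k₂ j₂ j₀ w₂).hom.app K = (pullbackDComp k₁ j₁ j₀ w₁).hom.app K := by
    simp [θ]
  -- Morphisms extend only from a glued object, so the restrictions of `K` are glued anew to `H`.
  -- The identities give `m : H ⟶ K`, an isomorphism because it is one locally, and the `φ_i` give
  -- `n : H ⟶ L`.
  obtain ⟨H, ρ₁, ρ₂, -, hu, -⟩ := exists_gluing w₁ w₂ h _ _ θ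
  obtain ⟨m, hm₁, hm₂⟩ := hu K (𝟙 _) (𝟙 _) (by
    rw [(pullbackD k₁).map_id, (pullbackD k₂).map_id, Category.id_comp, Category.id_comp, hθ])
  obtain ⟨n, hn₁, hn₂⟩ := hu L φ₁ φ₂ (by
    rw [← cancel_epi ((pullbackDComp k₁ j₁ j₀ w₁).inv.app K), e]
    simp [θ])
  have i₁ : IsIso ((pullbackD j₁).map m) := by
    rw [← Iso.eq_inv_comp, Category.comp_id] at hm₁
    rw [hm₁]
    infer_instance
  have i₂ : IsIso ((pullbackD j₂).map m) := by
    rw [← Iso.eq_inv_comp, Category.comp_id] at hm₂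
    rw [hm₂]
    infer_instance
  have := isIso_of_isIso_pullbackD_map h' m i₁ i₂
  refine ⟨inv m ≫ n, ?_, ?_⟩
  · rw [Functor.map_comp, Functor.map_inv, IsIso.inv_comp_eq, ← cancel_epi ρ₁.hom, hn₁, reassoc_of% hm₁]
  · rw [Functor.map_comp, Functor.map_inv, IsIso.inv_comp_eq, ← cancel_epi ρ₂.hom, hn₂, reassoc_of% hm₂]

/-- Morphisms in the derived category of a disjoint union of two open subschemes are determined by
their restrictions. -/
theorem eq_zero_of_pullbackD_map_eq_zero (h : j₁.opensRange ⊓ j₂.opensRange = ⊥)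
    (h' : j₁.opensRange ⊔ j₂.opensRange = ⊤) {K L : DMod Y} (φ : K ⟶ L)
    (h₁ : (pullbackD j₁).map φ = 0) (h₂ : (pullbackD j₂).map φ = 0) : φ = 0 := by
  have hZ (M : DMod (∅ : Scheme.{u})) : IsZero M :=
    isZero_iff_forall_vanishesAt.2 fun x ↦ (IsEmpty.false x).elim
  -- The intersection is the empty scheme, whose derived category is zero; the uniqueness clause of
  -- the gluing therefore applies.
  let θ : (pullbackD (Scheme.emptyTo U₁)).obj ((pullbackD j₁).obj K) ≅
    (pullbackD (Scheme.emptyTo U₂)).obj ((pullbackD j₂).obj K) := (hZ _).iso (hZ _)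
  obtain ⟨H, ρ₁, ρ₂, -, hu, hz⟩ := exists_gluing (j₁ := j₁) (j₂ := j₂) (j₀ := Scheme.emptyTo Y)
    (k₁ := Scheme.emptyTo U₁) (k₂ := Scheme.emptyTo U₂) (Scheme.empty_ext _ _) (Scheme.empty_ext _ _)
    (h ▸ bot_le) _ _ θ
  obtain ⟨m, hm₁, hm₂⟩ := hu K (𝟙 _) (𝟙 _) ((hZ _).eq_of_src _ _)
  have i₁ : IsIso ((pullbackD j₁).map m) := by
    rw [← Iso.eq_inv_comp, Category.comp_id] at hm₁
    rw [hm₁]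
    infer_instance
  have i₂ : IsIso ((pullbackD j₂).map m) := by
    rw [← Iso.eq_inv_comp, Category.comp_id] at hm₂
    rw [hm₂]
    infer_instance
  have := isIso_of_isIso_pullbackD_map h' m i₁ i₂
  rw [← cancel_epi m, comp_zero]
  exact hz (hZ _) _ _ (by rw [Functor.map_comp, h₁, comp_zero]) (by rw [Functor.map_comp, h₂, comp_zero])
end
end DerivedDescent

/-! ### Descent data for a disjoint union of two open subschemes -/

namespace DerivedDescent
noncomputable section
section
variable {A B C V W T : Scheme.{u}} {f : V ⟶ A} {g : V ⟶ B} {e : V ⟶ C}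
  [IsLocalIso f] [IsLocalIso g] [IsLocalIso e] {F : DMod A} {G : DMod B} {E : DMod C}

/-- The pullback of `φ : Lf^* F ⟶ Lg^* G` along `h`, regarded as a morphism `La^* F ⟶ Lb^* G`
through the canonical isomorphisms, where `a = f ∘ h` and `b = g ∘ h`. -/
def pull (φ : (pullbackD f).obj F ⟶ (pullbackD g).obj G) (h : W ⟶ V) (a : W ⟶ A) (b : W ⟶ B)
    [IsLocalIso h] [IsLocalIso a] [IsLocalIso b] (ha : h ≫ f = a) (hb : h ≫ g = b) :
    (pullbackD a).obj F ⟶ (pullbackD b).obj G :=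
  (pullbackDComp h f a ha).inv.app F ≫ (pullbackD h).map φ ≫ (pullbackDComp h g b hb).hom.app G

section
variable (h : W ⟶ V) (a : W ⟶ A) (b : W ⟶ B) (c : W ⟶ C) [IsLocalIso h] [IsLocalIso a] [IsLocalIso b]
  [IsLocalIso c] (ha : h ≫ f = a) (hb : h ≫ g = b) (hc : h ≫ e = c)

theorem pull_comp (φ : (pullbackD f).obj F ⟶ (pullbackD g).obj G)
    (ψ : (pullbackD g).obj G ⟶ (pullbackD e).obj E) :
    pull (φ ≫ ψ) h a c ha hc = pull φ h a b ha hb ≫ pull ψ h b c hb hc := by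
  simp [pull]

theorem pullbackD_map_eq (φ : (pullbackD f).obj F ⟶ (pullbackD g).obj G) :
    (pullbackD h).map φ = (pullbackDComp h f a ha).hom.app F ≫ pull φ h a b ha hb ≫
      (pullbackDComp h g b hb).inv.app G := by
  simp [pull]

theorem pull_injective {φ ψ : (pullbackD f).obj F ⟶ (pullbackD g).obj G}
    (e : pull φ h a b ha hb = pull ψ h a b ha hb) : (pullbackD h).map φ = (pullbackD h).map ψ := by
  rw [pullbackD_map_eq h a b ha hb, pullbackD_map_eq h a b ha hb, e]

theorem pull_pullbackD_map {F' : DMod A} (m : F ⟶ F') :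
    pull ((pullbackD f).map m) h a a ha ha = (pullbackD a).map m := by
  have := (pullbackDComp h f a ha).hom.naturality m
  rw [pull, ← Functor.comp_map, this, Iso.inv_hom_id_app_assoc]

theorem pull_pullbackDComp_hom {q : A ⟶ B} [IsLocalIso q] {r : V ⟶ B} {s : W ⟶ B} [IsLocalIso r]
    [IsLocalIso s] (hr : f ≫ q = r) (hs : a ≫ q = s) (hrs : h ≫ r = s) :
    pull ((pullbackDComp f q r hr).hom.app G) h a s ha hrs = (pullbackDComp a q s hs).hom.app G := by
  rw [pull, pullbackDComp_assoc h f q a r s ha hr hs hrs, Iso.inv_hom_id_app_assoc]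

theorem pull_pullbackDComp_inv {q : A ⟶ B} [IsLocalIso q] {r : V ⟶ B} {s : W ⟶ B} [IsLocalIso r]
    [IsLocalIso s] (hr : f ≫ q = r) (hs : a ≫ q = s) (hrs : h ≫ r = s) :
    pull ((pullbackDComp f q r hr).inv.app G) h s a hrs ha = (pullbackDComp a q s hs).inv.app G := by
  rw [← cancel_mono ((pullbackDComp a q s hs).hom.app G), Iso.inv_hom_id_app,
    ← pull_pullbackDComp_hom h a ha hr hs hrs, ← pull_comp, Iso.inv_hom_id_app]
  simp [pull]

theorem pull_pull (φ : (pullbackD f).obj F ⟶ (pullbackD g).obj G) (h' : T ⟶ W) (k : T ⟶ V) (a' : T ⟶ A)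
    (b' : T ⟶ B) [IsLocalIso h'] [IsLocalIso k] [IsLocalIso a'] [IsLocalIso b'] (hk : h' ≫ h = k)
    (ha' : h' ≫ a = a') (hb' : h' ≫ b = b') (hka : k ≫ f = a') (hkb : k ≫ g = b') :
    pull (pull φ h a b ha hb) h' a' b' ha' hb' = pull φ k a' b' hka hkb := by
  have e₁ := pullbackDComp_assoc h' h f k a a' hk ha hka ha' F
  have e₂ := pullbackDComp_assoc h' h g k b b' hk hb hkb hb' G
  have n := (pullbackDComp h' h k hk).hom.naturality φ
  rw [← cancel_epi ((pullbackDComp h' a a' ha').hom.app F),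
    ← cancel_epi ((pullbackD h').map ((pullbackDComp h f a ha).hom.app F))]
  simp only [pull, Functor.map_comp, Category.assoc, e₂, Iso.hom_inv_id_app_assoc]
  rw [← Functor.map_comp_assoc, Iso.hom_inv_id_app, (pullbackD h').map_id, Category.id_comp,
    reassoc_of% e₁, Iso.hom_inv_id_app_assoc]
  exact ((pullbackDComp h' h k hk).hom.naturality_assoc φ _)

end
end

section
variable {X S U₁ U₂ : Scheme.{u}}

theorem isLocalIso_lift {p : X ⟶ S} [IsLocalIso p] {T : Scheme.{u}} (x y : T ⟶ X) [IsLocalIso x]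
    (h : x ≫ p = y ≫ p) : IsLocalIso (pullback.lift x y h) :=
  have : IsLocalIso (pullback.lift x y h ≫ pullback.fst p p) := by
    rwa [pullback.lift_fst]
  isLocalIso_of_comp _ (pullback.fst p p)

namespace DescentDatum
variable {p : X ⟶ S} [IsLocalIso p] (D : DescentDatum p) {T W : Scheme.{u}}

/-- The isomorphism `Lx^* F ⟶ Ly^* F` given by a descent datum, for two points `x`, `y` of `X` with
the same image in `S`. -/
def isoAt (x y : T ⟶ X) [IsLocalIso x] [IsLocalIso y] (h : x ≫ p = y ≫ p) :
    (pullbackD x).obj D.obj ⟶ (pullbackD y).obj D.obj :=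
  have := isLocalIso_lift x y h
  pull D.iso.hom (pullback.lift x y h) x y (pullback.lift_fst _ _ _) (pullback.lift_snd _ _ _)

theorem pull_iso_hom (c : T ⟶ X₂ p) [IsLocalIso c] (x y : T ⟶ X) [IsLocalIso x] [IsLocalIso y]
    (hx : c ≫ p₁ p = x) (hy : c ≫ p₂ p = y) (h : x ≫ p = y ≫ p) :
    pull D.iso.hom c x y hx hy = D.isoAt x y h := by
  obtain rfl : c = pullback.lift x y h := by
    apply pullback.hom_ext
    · rw [pullback.lift_fst, hx]
    · rw [pullback.lift_snd, hy]
  rfl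

theorem pull_isoAt (x y : T ⟶ X) [IsLocalIso x] [IsLocalIso y] (h : x ≫ p = y ≫ p) (c : W ⟶ T)
    [IsLocalIso c] (x' y' : W ⟶ X) [IsLocalIso x'] [IsLocalIso y'] (hx : c ≫ x = x') (hy : c ≫ y = y')
    (h' : x' ≫ p = y' ≫ p) : pull (D.isoAt x y h) c x' y' hx hy = D.isoAt x' y' h' := by
  have := isLocalIso_lift x y h
  have h₁ : (c ≫ pullback.lift x y h) ≫ p₁ p = x' := by rw [Category.assoc, pullback.lift_fst, hx]
  have h₂ : (c ≫ pullback.lift x y h) ≫ p₂ p = y' := by rw [Category.assoc, pullback.lift_snd, hy]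
  rw [← D.pull_iso_hom (c ≫ pullback.lift x y h) x' y' h₁ h₂, isoAt]
  exact pull_pull _ _ _ _ _ _ _ _ _ _ rfl _ _ _ _

/-- This is the cocycle condition pulled back along `(x, y, z) : T ⟶ X ×_S X ×_S X`. -/
theorem isoAt_comp (x y z : T ⟶ X) [IsLocalIso x] [IsLocalIso y] [IsLocalIso z] (h : x ≫ p = y ≫ p)
    (h' : y ≫ p = z ≫ p) : D.isoAt x y h ≫ D.isoAt y z h' = D.isoAt x z (h.trans h') := by
  have := isLocalIso_lift x y h
  have := isLocalIso_lift y z h'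
  let c : T ⟶ X₃ p := pullback.lift (pullback.lift x y h) (pullback.lift y z h')
    ((pullback.lift_snd _ _ _).trans (pullback.lift_fst _ _ _).symm)
  have hc : IsLocalIso (c ≫ p₁₂ p) := by rwa [pullback.lift_fst]
  have : IsLocalIso c := isLocalIso_of_comp c (p₁₂ p)
  have h₁ : c ≫ q₁ p = x := by
    rw [q₁, ← Category.assoc, pullback.lift_fst]
    exact pullback.lift_fst _ _ _
  have h₂ : c ≫ q₂ p = y := by
    rw [q₂, ← Category.assoc, pullback.lift_fst]
    exact pullback.lift_snd _ _ _
  have h₃ : c ≫ q₃ p = z := by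
    rw [q₃, ← Category.assoc, pullback.lift_snd]
    exact pullback.lift_snd _ _ _
  have co : pull D.iso.hom (p₁₂ p) (q₁ p) (q₂ p) rfl rfl ≫
      pull D.iso.hom (p₂₃ p) (q₂ p) (q₃ p) (q₂_eq p) rfl =
        pull D.iso.hom (p₁₃ p) (q₁ p) (q₃ p) (p₁₃_p₁ p) (p₁₃_p₂ p) := D.cocycle
  have e₂ : q₁ p ≫ p = q₂ p ≫ p := by
    rw [q₁, q₂, Category.assoc, Category.assoc, pullback.condition]
  have e₃ : q₂ p ≫ p = q₃ p ≫ p := e₂.symm.trans (q₁_q₃ p)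
  rw [D.pull_iso_hom _ _ _ _ _ e₂, D.pull_iso_hom _ _ _ _ _ e₃, D.pull_iso_hom _ _ _ _ _ (q₁_q₃ p)] at co
  have := congrArg (fun φ ↦ pull φ c x z h₁ h₃) co
  rwa [pull_comp c x y z h₁ h₂ h₃, pull_isoAt, pull_isoAt, pull_isoAt] at this

instance isIso_isoAt (x y : T ⟶ X) [IsLocalIso x] [IsLocalIso y] (h : x ≫ p = y ≫ p) :
    IsIso (D.isoAt x y h) := by
  unfold isoAt pull
  infer_instance

/-- By the cocycle condition it is an idempotent, and it is invertible. -/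
theorem isoAt_self (x : T ⟶ X) [IsLocalIso x] : D.isoAt x x rfl = 𝟙 _ := by
  rw [← cancel_epi (D.isoAt x x rfl), isoAt_comp, Category.comp_id]

end DescentDatum

/-- A morphism on the source of `q : Z ⟶ X` is zero if its restrictions to the open subschemes over
the two parts `U₁`, `U₂` of `X` are zero. -/
theorem eq_zero_of_forall_pullbackD_map_eq_zero {i₁ : U₁ ⟶ X} {i₂ : U₂ ⟶ X} [IsOpenImmersion i₁]
    [IsOpenImmersion i₂] (h : i₁.opensRange ⊓ i₂.opensRange = ⊥) (h' : i₁.opensRange ⊔ i₂.opensRange = ⊤)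
    {Z : Scheme.{u}} (q : Z ⟶ X) {K L : DMod Z} (φ : K ⟶ L)
    (h₁ : ∀ (W : Scheme.{u}) (c : W ⟶ Z) (x : W ⟶ U₁) [IsOpenImmersion c], c ≫ q = x ≫ i₁ → (pullbackD c).map φ = 0)
    (h₂ : ∀ (W : Scheme.{u}) (c : W ⟶ Z) (x : W ⟶ U₂) [IsOpenImmersion c], c ≫ q = x ≫ i₂ → (pullbackD c).map φ = 0) :
    φ = 0 := by
  refine eq_zero_of_pullbackD_map_eq_zero (j₁ := pullback.fst q i₁) (j₂ := pullback.fst q i₂) ?_ ?_ φ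
    (h₁ _ _ _ pullback.condition) (h₂ _ _ _ pullback.condition)
  · rw [Scheme.Hom.opensRange_pullbackFst, Scheme.Hom.opensRange_pullbackFst]
    change q ⁻¹ᵁ (i₁.opensRange ⊓ i₂.opensRange) = ⊥
    rw [h]
    rfl
  · rw [Scheme.Hom.opensRange_pullbackFst, Scheme.Hom.opensRange_pullbackFst]
    change q ⁻¹ᵁ (i₁.opensRange ⊔ i₂.opensRange) = ⊤
    rw [h']
    rfl

theorem pullbackD_map_map_eq_zero {V W : Scheme.{u}} (c' : W ⟶ V) (c : V ⟶ X) [IsLocalIso c'] [IsLocalIso c] {K L : DMod X}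
    (φ : K ⟶ L) (h : (pullbackD (c' ≫ c)).map φ = 0) : (pullbackD c').map ((pullbackD c).map φ) = 0 := by
  rw [pullbackD_map_eq c' (c' ≫ c) (c' ≫ c) rfl rfl, pull_pullbackD_map, h, zero_comp, comp_zero]

variable (p : X ⟶ S) [IsLocalIso p]

theorem pullbackD_map_eq_pull {F : DMod X} {H : DMod S} (Φ : F ⟶ (pullbackD p).obj H) (i : U₁ ⟶ X)
    [IsLocalIso i] (j : U₁ ⟶ S) [IsLocalIso j] (w : i ≫ p = j)
    (ρ : (pullbackD i).obj F ⟶ (pullbackD j).obj H)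
    (hΦ : (pullbackD i).map Φ = ρ ≫ (pullbackDComp i p j w).inv.app H) {W : Scheme.{u}} (x : W ⟶ U₁)
    [IsLocalIso x] (a : W ⟶ X) [IsLocalIso a] (r : W ⟶ S) [IsLocalIso r] (ha : x ≫ i = a)
    (hr : x ≫ j = r) (hr' : a ≫ p = r) :
    (pullbackD a).map Φ = pull ρ x a r ha hr ≫ (pullbackDComp a p r hr').inv.app H := by
  rw [← pull_pullbackD_map x a ha, hΦ, pull_comp x a r a ha hr ha, pull_pullbackDComp_inv x a ha w hr' hr]

/-- Checks compatibility of `Φ` with the descent data on a piece `W` of `X ×_S X` lying over a given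
pair of parts of `X`. The canonical isomorphisms cancel, leaving the hypothesis on `ρ₁` and `ρ₂`. -/
theorem pull_comm_of_eq (D : DescentDatum p) {H : DMod S} (Φ : D.obj ⟶ (pullbackD p).obj H)
    {i₁ : U₁ ⟶ X} {i₂ : U₂ ⟶ X} [IsLocalIso i₁] [IsLocalIso i₂] {j₁ : U₁ ⟶ S} {j₂ : U₂ ⟶ S}
    [IsLocalIso j₁] [IsLocalIso j₂] (w₁ : i₁ ≫ p = j₁) (w₂ : i₂ ≫ p = j₂)
    (ρ₁ : (pullbackD i₁).obj D.obj ⟶ (pullbackD j₁).obj H)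
    (ρ₂ : (pullbackD i₂).obj D.obj ⟶ (pullbackD j₂).obj H)
    (h₁ : (pullbackD i₁).map Φ = ρ₁ ≫ (pullbackDComp i₁ p j₁ w₁).inv.app H)
    (h₂ : (pullbackD i₂).map Φ = ρ₂ ≫ (pullbackDComp i₂ p j₂ w₂).inv.app H)
    (hρ : ∀ (W : Scheme.{u}) (x : W ⟶ U₁) (y : W ⟶ U₂) (a b : W ⟶ X) (r : W ⟶ S) [IsLocalIso x]
      [IsLocalIso y] [IsLocalIso a] [IsLocalIso b] [IsLocalIso r] (ha : x ≫ i₁ = a) (hb : y ≫ i₂ = b)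
      (hx : x ≫ j₁ = r) (hy : y ≫ j₂ = r) (hab : a ≫ p = b ≫ p),
      pull ρ₁ x a r ha hx = D.isoAt a b hab ≫ pull ρ₂ y b r hb hy)
    {W : Scheme.{u}} (c : W ⟶ X₂ p) [IsLocalIso c] (x : W ⟶ U₁) (y : W ⟶ U₂)
    (hx : c ≫ p₁ p = x ≫ i₁) (hy : c ≫ p₂ p = y ≫ i₂) :
    (pullbackD c).map ((pullbackD (p₁ p)).map Φ ≫ (DescentDatum.canonicalIso p H).hom) =
      (pullbackD c).map (D.iso.hom ≫ (pullbackD (p₂ p)).map Φ) := by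
  have hc : (c ≫ p₁ p) ≫ p = (c ≫ p₂ p) ≫ p := by
    rw [Category.assoc, Category.assoc, pullback.condition]
  have : IsLocalIso (x ≫ i₁) := by rw [← hx]; infer_instance
  have : IsLocalIso x := isLocalIso_of_comp x i₁
  have : IsLocalIso (y ≫ i₂) := by rw [← hy]; infer_instance
  have : IsLocalIso y := isLocalIso_of_comp y i₂
  have e₁ : x ≫ j₁ = (c ≫ p₁ p) ≫ p := by rw [hx, Category.assoc, w₁]
  have e₂ : y ≫ j₂ = (c ≫ p₁ p) ≫ p := by rw [hc, hy, Category.assoc, w₂]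
  refine pull_injective c (c ≫ p₁ p) (c ≫ p₂ p) rfl rfl ?_
  rw [pull_comp c _ (c ≫ p₁ p) _ rfl rfl rfl, pull_comp c _ (c ≫ p₂ p) _ rfl rfl rfl,
    pull_pullbackD_map, pull_pullbackD_map,
    pullbackD_map_eq_pull p Φ i₁ j₁ w₁ ρ₁ h₁ x (c ≫ p₁ p) ((c ≫ p₁ p) ≫ p) hx.symm e₁ rfl,
    pullbackD_map_eq_pull p Φ i₂ j₂ w₂ ρ₂ h₂ y (c ≫ p₂ p) ((c ≫ p₁ p) ≫ p) hy.symm e₂ hc.symm,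
    D.pull_iso_hom c _ _ rfl rfl hc]
  have := DescentDatum.transport_canonicalIso c (c ≫ p₁ p) (c ≫ p₂ p) ((c ≫ p₁ p) ≫ p) rfl rfl rfl hc.symm H
  have e : pull (DescentDatum.canonicalIso p H).hom c (c ≫ p₁ p) (c ≫ p₂ p) rfl rfl = _ := this
  rw [e, Category.assoc, Iso.inv_hom_id_app_assoc, hρ W x y _ _ _ hx.symm hy.symm e₁ e₂ hc, Category.assoc]

variable {i₁ : U₁ ⟶ X} {i₂ : U₂ ⟶ X} [IsOpenImmersion i₁]
    [IsOpenImmersion i₂] {j₁ : U₁ ⟶ S} {j₂ : U₂ ⟶ S} [IsOpenImmersion j₁] [IsOpenImmersion j₂]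

/-- For a covering by two open subschemes, each descent datum comes from an object of the derived
category of the base. -/
theorem exists_comparison_obj_iso (w₁ : i₁ ≫ p = j₁) (w₂ : i₂ ≫ p = j₂)
    (h : i₁.opensRange ⊓ i₂.opensRange = ⊥) (h' : i₁.opensRange ⊔ i₂.opensRange = ⊤)
    (D : DescentDatum p) : ∃ (H : DMod S) (Φ : D ⟶ (DescentDatum.comparison p).obj H), IsIso Φ.hom := by
  let U₀ := pullback j₁ j₂
  let k₁ : U₀ ⟶ U₁ := pullback.fst j₁ j₂
  let k₂ : U₀ ⟶ U₂ := pullback.snd j₁ j₂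
  let j₀ : U₀ ⟶ S := k₁ ≫ j₁
  have wk : k₂ ≫ j₂ = j₀ := pullback.condition.symm
  have hk : (k₁ ≫ i₁) ≫ p = (k₂ ≫ i₂) ≫ p := by rw [Category.assoc, Category.assoc, w₁, w₂, wk]
  -- The transition isomorphism on `U₁ ×_S U₂` is the value of the descent datum at the pair of
  -- points `k₁ ≫ i₁`, `k₂ ≫ i₂` of `X`.
  let θ : (pullbackD k₁).obj ((pullbackD i₁).obj D.obj) ≅ (pullbackD k₂).obj ((pullbackD i₂).obj D.obj) :=
    (pullbackDComp k₁ i₁ _ rfl).app _ ≪≫ asIso (D.isoAt (k₁ ≫ i₁) (k₂ ≫ i₂) hk) ≪≫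
      ((pullbackDComp k₂ i₂ _ rfl).app _).symm
  have hr : j₁.opensRange ⊓ j₂.opensRange ≤ j₀.opensRange := fun x hx ↦ by
    have e := IsOpenImmersion.range_pullback_to_base_of_left j₁ j₂
    exact (Set.ext_iff.1 e x).2 hx
  obtain ⟨H, ρ₁, ρ₂, e, -, -⟩ := exists_gluing (j₀ := j₀) (k₁ := k₁) (k₂ := k₂) rfl wk hr _ _ θ
  have hρ : pull ρ₁.hom k₁ (k₁ ≫ i₁) j₀ rfl rfl =
      D.isoAt (k₁ ≫ i₁) (k₂ ≫ i₂) hk ≫ pull ρ₂.hom k₂ (k₂ ≫ i₂) j₀ rfl wk := by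
    simp only [pull, e]
    simp [θ]
  have hZ (M : DMod (∅ : Scheme.{u})) : IsZero M :=
    isZero_iff_forall_vanishesAt.2 fun x ↦ (IsEmpty.false x).elim
  -- On `X` the two parts are disjoint, so `ρ₁` and `ρ₂` glue to `Φ` without any condition.
  obtain ⟨Φ, hΦ₁, hΦ₂⟩ := exists_pullbackD_map_eq (j₁ := i₁) (j₂ := i₂) (j₀ := Scheme.emptyTo X)
    (k₁ := Scheme.emptyTo U₁) (k₂ := Scheme.emptyTo U₂) (Scheme.empty_ext _ _) (Scheme.empty_ext _ _)
    (h ▸ bot_le) h' (ρ₁.hom ≫ (pullbackDComp i₁ p j₁ w₁).inv.app H)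
    (ρ₂.hom ≫ (pullbackDComp i₂ p j₂ w₂).inv.app H) ((hZ _).eq_of_src _ _)
  have hΦ : IsIso Φ := by
    refine isIso_of_isIso_pullbackD_map h' Φ ?_ ?_
    · rw [hΦ₁]
      infer_instance
    · rw [hΦ₂]
      infer_instance
  -- Any `W` over both parts factors through `U₁ ×_S U₂`, so the identity `hρ` there pulls back to
  -- `W`.
  have hk₀ (W : Scheme.{u}) (x : W ⟶ U₁) (y : W ⟶ U₂) (a b : W ⟶ X) (r : W ⟶ S) [IsLocalIso x]
      [IsLocalIso y] [IsLocalIso a] [IsLocalIso b] [IsLocalIso r] (ha : x ≫ i₁ = a) (hb : y ≫ i₂ = b)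
      (hx : x ≫ j₁ = r) (hy : y ≫ j₂ = r) (hab : a ≫ p = b ≫ p) :
      pull ρ₁.hom x a r ha hx = D.isoAt a b hab ≫ pull ρ₂.hom y b r hb hy := by
    let l : W ⟶ U₀ := pullback.lift x y (hx.trans hy.symm)
    have hl₁ : l ≫ k₁ = x := pullback.lift_fst _ _ _
    have hl₂ : l ≫ k₂ = y := pullback.lift_snd _ _ _
    have : IsLocalIso (l ≫ k₁) := by rwa [hl₁]
    have : IsLocalIso l := isLocalIso_of_comp l k₁
    have := congrArg (fun φ ↦ pull φ l a r (by rw [← ha, ← hl₁, Category.assoc]) (by rw [← hx, ← hl₁, Category.assoc])) hρ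
    rw [pull_comp l a b r _ (by rw [← hb, ← hl₂, Category.assoc]) _, pull_pull k₁ _ _ _ _ _ _ x a r hl₁ _ _ ha hx, D.pull_isoAt _ _ _ _ _ _ _ _ hab,
      pull_pull k₂ _ _ _ _ _ _ y b r hl₂ _ _ hb hy] at this
    exact this
  -- Over a single part the two points coincide because `j₁` is mono, and the descent isomorphism is
  -- the identity.
  have hk₁ (W : Scheme.{u}) (x : W ⟶ U₁) (y : W ⟶ U₁) (a b : W ⟶ X) (r : W ⟶ S) [IsLocalIso x]
      [IsLocalIso y] [IsLocalIso a] [IsLocalIso b] [IsLocalIso r] (ha : x ≫ i₁ = a) (hb : y ≫ i₁ = b)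
      (hx : x ≫ j₁ = r) (hy : y ≫ j₁ = r) (hab : a ≫ p = b ≫ p) :
      pull ρ₁.hom x a r ha hx = D.isoAt a b hab ≫ pull ρ₁.hom y b r hb hy := by
    obtain rfl : x = y := by rw [← cancel_mono j₁, hx, hy]
    obtain rfl : a = b := ha.symm.trans hb
    rw [D.isoAt_self, Category.id_comp]
  have hk₂ (W : Scheme.{u}) (x : W ⟶ U₂) (y : W ⟶ U₂) (a b : W ⟶ X) (r : W ⟶ S) [IsLocalIso x]
      [IsLocalIso y] [IsLocalIso a] [IsLocalIso b] [IsLocalIso r] (ha : x ≫ i₂ = a) (hb : y ≫ i₂ = b)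
      (hx : x ≫ j₂ = r) (hy : y ≫ j₂ = r) (hab : a ≫ p = b ≫ p) :
      pull ρ₂.hom x a r ha hx = D.isoAt a b hab ≫ pull ρ₂.hom y b r hb hy := by
    obtain rfl : x = y := by rw [← cancel_mono j₂, hx, hy]
    obtain rfl : a = b := ha.symm.trans hb
    rw [D.isoAt_self, Category.id_comp]
  have hk₀' (W : Scheme.{u}) (x : W ⟶ U₂) (y : W ⟶ U₁) (a b : W ⟶ X) (r : W ⟶ S) [IsLocalIso x]
      [IsLocalIso y] [IsLocalIso a] [IsLocalIso b] [IsLocalIso r] (ha : x ≫ i₂ = a) (hb : y ≫ i₁ = b)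
      (hx : x ≫ j₂ = r) (hy : y ≫ j₁ = r) (hab : a ≫ p = b ≫ p) :
      pull ρ₂.hom x a r ha hx = D.isoAt a b hab ≫ pull ρ₁.hom y b r hb hy := by
    rw [hk₀ W y x b a r hb ha hy hx hab.symm, ← Category.assoc, D.isoAt_comp, D.isoAt_self,
      Category.id_comp]
  refine ⟨H, ⟨Φ, ?_⟩, hΦ⟩
  rw [← sub_eq_zero]
  -- `X ×_S X` is the disjoint union of four pieces, according to the parts containing the two
  -- coordinates; the compatibility is tested on each.
  refine eq_zero_of_forall_pullbackD_map_eq_zero h h' (p₁ p) _ (fun W c x _ hx ↦ ?_) (fun W c x _ hx ↦ ?_)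
  · refine eq_zero_of_forall_pullbackD_map_eq_zero h h' (c ≫ p₂ p) _ (fun W c' y _ hy ↦ ?_) (fun W c' y _ hy ↦ ?_)
    · refine pullbackD_map_map_eq_zero c' c _ ?_
      rw [Functor.map_sub, sub_eq_zero]
      exact pull_comm_of_eq p D Φ w₁ w₁ ρ₁.hom ρ₁.hom hΦ₁ hΦ₁ hk₁ (c' ≫ c) (c' ≫ x) y
        (by rw [Category.assoc, hx, Category.assoc]) (by rw [Category.assoc, hy])
    · refine pullbackD_map_map_eq_zero c' c _ ?_
      rw [Functor.map_sub, sub_eq_zero]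
      exact pull_comm_of_eq p D Φ w₁ w₂ ρ₁.hom ρ₂.hom hΦ₁ hΦ₂ hk₀ (c' ≫ c) (c' ≫ x) y
        (by rw [Category.assoc, hx, Category.assoc]) (by rw [Category.assoc, hy])
  · refine eq_zero_of_forall_pullbackD_map_eq_zero h h' (c ≫ p₂ p) _ (fun W c' y _ hy ↦ ?_) (fun W c' y _ hy ↦ ?_)
    · refine pullbackD_map_map_eq_zero c' c _ ?_
      rw [Functor.map_sub, sub_eq_zero]
      exact pull_comm_of_eq p D Φ w₂ w₁ ρ₂.hom ρ₁.hom hΦ₂ hΦ₁ hk₀' (c' ≫ c) (c' ≫ x) y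
        (by rw [Category.assoc, hx, Category.assoc]) (by rw [Category.assoc, hy])
    · refine pullbackD_map_map_eq_zero c' c _ ?_
      rw [Functor.map_sub, sub_eq_zero]
      exact pull_comm_of_eq p D Φ w₂ w₂ ρ₂.hom ρ₂.hom hΦ₂ hΦ₂ hk₂ (c' ≫ c) (c' ≫ x) y
        (by rw [Category.assoc, hx, Category.assoc]) (by rw [Category.assoc, hy])

/-- A morphism of `D(𝒪_S)` is zero on the open subscheme `U₁` if its pullback to `X` is zero. -/
theorem pullbackD_map_eq_zero_of_comp {i : U₁ ⟶ X} [IsLocalIso i] {j : U₁ ⟶ S} [IsLocalIso j]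
    (w : i ≫ p = j) {K L : DMod S} (φ : K ⟶ L) (h : (pullbackD p).map φ = 0) :
    (pullbackD j).map φ = 0 := by
  rw [← pull_pullbackD_map i j w φ, h, pull, Functor.map_zero, zero_comp, comp_zero]

/-- Pulling the compatibility back along `(x, y) : T ⟶ X ×_S X` turns both canonical descent
isomorphisms into the identifications over `r`, which cancel. This is the overlap condition needed
to glue `g`. -/
theorem pull_eq_pull_of_comm {H L : DMod S} (g : (pullbackD p).obj H ⟶ (pullbackD p).obj L)
    (hg : (pullbackD (p₁ p)).map g ≫ (DescentDatum.canonicalIso p L).hom =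
      (DescentDatum.canonicalIso p H).hom ≫ (pullbackD (p₂ p)).map g) {T : Scheme.{u}} (x y : T ⟶ X)
    [IsLocalIso x] [IsLocalIso y] (r : T ⟶ S) [IsLocalIso r] (hx : x ≫ p = r) (hy : y ≫ p = r) :
    pull g x r r hx hx = pull g y r r hy hy := by
  have := isLocalIso_lift x y (hx.trans hy.symm)
  let l := pullback.lift x y (hx.trans hy.symm)
  have hl₁ : l ≫ p₁ p = x := pullback.lift_fst _ _ _
  have hl₂ : l ≫ p₂ p = y := pullback.lift_snd _ _ _
  have e (M : DMod S) : pull (DescentDatum.canonicalIso p M).hom l x y hl₁ hl₂ = _ :=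
    DescentDatum.transport_canonicalIso l x y r hl₁ hl₂ hx hy M
  have := congrArg (fun φ ↦ pull φ l x y hl₁ hl₂) hg
  rw [pull_comp l x x y hl₁ hl₁ hl₂, pull_comp l x y y hl₁ hl₂ hl₂, pull_pullbackD_map,
    pull_pullbackD_map, e, e] at this
  rw [pull, pull, ← cancel_epi ((pullbackDComp x p r hx).hom.app H),
    ← cancel_mono ((pullbackDComp y p r hy).inv.app L)]
  simpa using this

/-- For a covering by two open subschemes, the comparison functor is full. -/
theorem comparison_full (w₁ : i₁ ≫ p = j₁) (w₂ : i₂ ≫ p = j₂)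
    (h : i₁.opensRange ⊓ i₂.opensRange = ⊥) (h' : i₁.opensRange ⊔ i₂.opensRange = ⊤)
    (hj : j₁.opensRange ⊔ j₂.opensRange = ⊤) : (DescentDatum.comparison p).Full where
  map_surjective {H L} f := by
    let U₀ := pullback j₁ j₂
    let k₁ : U₀ ⟶ U₁ := pullback.fst j₁ j₂
    let k₂ : U₀ ⟶ U₂ := pullback.snd j₁ j₂
    let j₀ : U₀ ⟶ S := k₁ ≫ j₁
    have wk : k₂ ≫ j₂ = j₀ := pullback.condition.symm
    have e₁ : (k₁ ≫ i₁) ≫ p = j₀ := by rw [Category.assoc, w₁]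
    have e₂ : (k₂ ≫ i₂) ≫ p = j₀ := by rw [Category.assoc, w₂, wk]
    have hr : j₁.opensRange ⊓ j₂.opensRange ≤ j₀.opensRange := fun x hx ↦ by
      have e := IsOpenImmersion.range_pullback_to_base_of_left j₁ j₂
      exact (Set.ext_iff.1 e x).2 hx
    let g : (pullbackD p).obj H ⟶ (pullbackD p).obj L := f.hom
    have hg : (pullbackD (p₁ p)).map g ≫ (DescentDatum.canonicalIso p L).hom =
      (DescentDatum.canonicalIso p H).hom ≫ (pullbackD (p₂ p)).map g := f.comm
    have hg' := pull_eq_pull_of_comm p g hg (k₁ ≫ i₁) (k₂ ≫ i₂) j₀ e₁ e₂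
    obtain ⟨m, hm₁, hm₂⟩ := exists_pullbackD_map_eq (j₁ := j₁) (j₂ := j₂) (k₁ := k₁) (k₂ := k₂)
      (j₀ := j₀) rfl wk hr hj (pull g i₁ j₁ j₁ w₁ w₁) (pull g i₂ j₂ j₂ w₂ w₂)
      ((pull_pull i₁ j₁ j₁ w₁ w₁ g k₁ (k₁ ≫ i₁) j₀ j₀ rfl rfl rfl e₁ e₁).trans (hg'.trans
        (pull_pull i₂ j₂ j₂ w₂ w₂ g k₂ (k₂ ≫ i₂) j₀ j₀ rfl wk wk e₂ e₂).symm))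
    refine ⟨m, DescentDatum.Hom.ext ?_⟩
    change (pullbackD p).map m = g
    rw [← sub_eq_zero]
    refine eq_zero_of_pullbackD_map_eq_zero h h' _ ?_ ?_
    · rw [Functor.map_sub, sub_eq_zero]
      refine pull_injective i₁ j₁ j₁ w₁ w₁ ?_
      rw [pull_pullbackD_map, hm₁]
    · rw [Functor.map_sub, sub_eq_zero]
      refine pull_injective i₂ j₂ j₂ w₂ w₂ ?_
      rw [pull_pullbackD_map, hm₂]

end
end
end DerivedDescent

/-! ### The linear structure on sheaves of modules over an affine scheme -/

namespace AlgebraicGeometry.Scheme.Modules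
section
variable {R : CommRingCat.{u}}

/-- Multiplication by a scalar on a sheaf of modules on `Spec R`. -/
noncomputable def scalarEnd (r : R) (M : (Spec R).Modules) : M ⟶ M :=
  ⟨PresheafOfModules.homMk
    { app U := AddCommGrpCat.ofHom (DistribSMul.toAddMonoidHom Γ(M, U.unop) r)
      naturality U V f := by
        ext s
        exact (map_smul_Spec f r s).symm }
    (fun U a s ↦ smul_comm (M := R) (N := Γ(Spec R, U.unop)) (α := Γ(M, U.unop)) r a s)⟩

theorem app_smul_Spec {M N : (Spec R).Modules} (φ : M ⟶ N) (U : (Spec R).Opens) (r : R) (s : Γ(M, U)) :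
    φ.app U (r • s) = r • φ.app U s := by
  rw [smul_Spec_def, smul_Spec_def, Hom.app_smul]

/-- The action of `R` on the category of sheaves of modules on `Spec R`. -/
noncomputable def toCatCenter : R →+* CatCenter (Spec R).Modules where
  toFun r :=
    { app := scalarEnd r
      naturality M N φ := by
        ext U s
        exact (app_smul_Spec φ U r s).symm }
  map_one' := by
    ext M U s
    exact one_smul R s
  map_mul' a b := by
    ext M U s
    exact mul_smul a b s
  map_zero' := by
    ext M U s
    exact zero_smul R s
  map_add' a b := by
    ext M U s
    exact add_smul a b s

noncomputable instance : Linear R (Spec R).Modules := Linear.ofRingMorphism toCatCenter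

theorem smul_hom_app {M N : (Spec R).Modules} (r : R) (φ : M ⟶ N) (U : (Spec R).Opens) (s : Γ(M, U)) :
    (r • φ).app U s = r • φ.app U s := app_smul_Spec φ U r s

noncomputable instance : Linear R (DerivedDescent.DMod (Spec R)) :=
  inferInstanceAs (Linear R (DerivedCategory (Spec R).Modules))
end
end AlgebraicGeometry.Scheme.Modules

/-! ### Localization of morphism groups and its stability under triangles -/

namespace CategoryTheory.Pretriangulated
section
variable {C : Type*} [Category* C] [HasZeroObject C] [HasShift C ℤ] [Preadditive C]
  [∀ n : ℤ, (shiftFunctor C n).Additive] [Pretriangulated C]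
  {R : Type*} [CommRing R] [Linear R C] [∀ n : ℤ, (shiftFunctor C n).Linear R]

/-- `Hom(K, M) ⟶ Hom(E K, M)`, the composition with `ε`, has `f`-power torsion kernel and
cokernel. -/
def IsLocalizationHom {E : C ⥤ C} (ε : ∀ K, E.obj K ⟶ K) (f : R) (K M : C) : Prop :=
  (∀ β : K ⟶ M, ε K ≫ β = 0 → ∃ k : ℕ, f ^ k • β = 0) ∧
    ∀ ψ : E.obj K ⟶ M, ∃ (k : ℕ) (β : K ⟶ M), f ^ k • ψ = ε K ≫ β

set_option linter.unusedSectionVars false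

variable {E : C ⥤ C} {ε : ∀ K, E.obj K ⟶ K} {f : R}

theorem IsLocalizationHom.of_iso (n : ∀ {K L : C} (φ : K ⟶ L), E.map φ ≫ ε L = ε K ≫ φ)
    {K K' M : C} (h : IsLocalizationHom ε f K M) (e : K ≅ K') :
    IsLocalizationHom ε f K' M := by
  refine ⟨fun β hβ ↦ ?_, fun ψ ↦ ?_⟩
  · obtain ⟨k, hk⟩ := h.1 (e.hom ≫ β) (by rw [← Category.assoc, ← n, Category.assoc, hβ, comp_zero])
    refine ⟨k, ?_⟩
    rw [← cancel_epi e.hom, Linear.comp_smul, hk, comp_zero]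
  · obtain ⟨k, β, hk⟩ := h.2 (E.map e.hom ≫ ψ)
    refine ⟨k, e.inv ≫ β, ?_⟩
    rw [← cancel_epi (E.map e.hom), Linear.comp_smul, hk, ← Category.assoc (E.map _), n, Category.assoc, Iso.hom_inv_id_assoc]

variable [E.CommShift ℤ] [E.IsTriangulated]

/-- A five lemma up to powers of `f`. The kernel at `T.obj₂` requires the cokernel at `T.obj₁⟦1⟧`,
and the cokernel at `T.obj₂` requires the kernel at `T.obj₃⟦-1⟧`; hence kernel and cokernel are
treated together, and later for all shifts. -/
theorem IsLocalizationHom.obj₂ (n : ∀ {K L : C} (φ : K ⟶ L), E.map φ ≫ ε L = ε K ≫ φ)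
    {T : Triangle C} (hT : T ∈ distTriang C) {M : C}
    (h₁ : IsLocalizationHom ε f T.obj₁ M) (h₁' : IsLocalizationHom ε f (T.obj₁⟦(1 : ℤ)⟧) M)
    (h₃ : IsLocalizationHom ε f T.obj₃ M) (h₃' : IsLocalizationHom ε f (T.obj₃⟦(-1 : ℤ)⟧) M) :
    IsLocalizationHom ε f T.obj₂ M := by
  have hE := E.map_distinguished T hT
  refine ⟨fun β hβ ↦ ?_, fun ψ ↦ ?_⟩
  · obtain ⟨k₁, hk₁⟩ := h₁.1 (T.mor₁ ≫ β) (by rw [← Category.assoc, ← n, Category.assoc, hβ, comp_zero])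
    obtain ⟨γ, hγ⟩ := Triangle.yoneda_exact₂ T hT (f ^ k₁ • β) (by rw [Linear.comp_smul, hk₁])
    obtain ⟨ψ, hψ⟩ : ∃ ψ : E.obj (T.obj₁⟦(1 : ℤ)⟧) ⟶ M, ε T.obj₃ ≫ γ = E.map T.mor₃ ≫ ψ := by
      have hz : E.map T.mor₂ ≫ ε T.obj₃ ≫ γ = 0 := by
        rw [← Category.assoc, n, Category.assoc, ← hγ, Linear.comp_smul, hβ, smul_zero]
      obtain ⟨w, hw⟩ := Triangle.yoneda_exact₃ _ hE (ε T.obj₃ ≫ γ) hz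
      exact ⟨(E.commShiftIso (1 : ℤ)).hom.app _ ≫ w, hw.trans (Category.assoc _ _ _)⟩
    obtain ⟨k₂, χ, hχ⟩ := h₁'.2 ψ
    obtain ⟨k₃, hk₃⟩ := h₃.1 (f ^ k₂ • γ - T.mor₃ ≫ χ) (by
      rw [Preadditive.comp_sub, Linear.comp_smul, hψ, ← Linear.comp_smul, hχ, ← Category.assoc, n,
        Category.assoc, sub_self])
    refine ⟨k₃ + k₂ + k₁, ?_⟩
    have hz : T.mor₂ ≫ (f ^ k₃ • (f ^ k₂ • γ - T.mor₃ ≫ χ)) = 0 := by rw [hk₃, comp_zero]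
    rw [Linear.comp_smul, Preadditive.comp_sub, Linear.comp_smul, ← hγ, ← Category.assoc,
      comp_distTriang_mor_zero₂₃ T hT, zero_comp, sub_zero, smul_smul, smul_smul, ← pow_add,
      ← pow_add] at hz
    exact hz
  · obtain ⟨k₁, χ, hχ⟩ := h₁.2 (E.map T.mor₁ ≫ ψ)
    have hT' := inv_rot_of_distTriang T hT
    -- The obstruction to extending `χ` over `T.obj₂` is `d ≫ χ`. It dies after composition with
    -- `ε`, since `d ≫ T.mor₁ = 0`, hence is torsion.
    obtain ⟨d, hd, hd'⟩ : ∃ d : T.obj₃⟦(-1 : ℤ)⟧ ⟶ T.obj₁, d ≫ T.mor₁ = 0 ∧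
        ∀ χ : T.obj₁ ⟶ M, d ≫ χ = 0 → ∃ ζ : T.obj₂ ⟶ M, χ = T.mor₁ ≫ ζ :=
      ⟨T.invRotate.mor₁, comp_distTriang_mor_zero₁₂ _ hT', fun χ h ↦ Triangle.yoneda_exact₂ _ hT' χ h⟩
    obtain ⟨k₂, hk₂⟩ := h₃'.1 (d ≫ χ) (by
      rw [← Category.assoc, ← n, Category.assoc, ← hχ, Linear.comp_smul, ← Category.assoc,
        ← E.map_comp, hd, E.map_zero, zero_comp, smul_zero])
    obtain ⟨ζ, hζ⟩ := hd' (f ^ k₂ • χ) (by rw [Linear.comp_smul, hk₂])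
    have hz : E.map T.mor₁ ≫ (f ^ (k₂ + k₁) • ψ - ε _ ≫ ζ) = 0 := by
      rw [Preadditive.comp_sub, Linear.comp_smul, ← Category.assoc (E.map _), n, Category.assoc, ← hζ,
        Linear.comp_smul, ← hχ, smul_smul, ← pow_add, sub_self]
    obtain ⟨ω, hω⟩ : ∃ ω : E.obj T.obj₃ ⟶ M, f ^ (k₂ + k₁) • ψ - ε _ ≫ ζ = E.map T.mor₂ ≫ ω :=
      Triangle.yoneda_exact₂ _ hE (f ^ (k₂ + k₁) • ψ - ε _ ≫ ζ) hz
    obtain ⟨k₃, τ, hτ⟩ := h₃.2 ω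
    refine ⟨k₃ + (k₂ + k₁), f ^ k₃ • ζ + T.mor₂ ≫ τ, ?_⟩
    rw [pow_add, mul_smul, sub_eq_iff_eq_add.1 hω, smul_add, ← Linear.comp_smul, hτ,
      Preadditive.comp_add, ← Category.assoc, n, Category.assoc, Linear.comp_smul, add_comm]

variable (ε f) in
/-- `IsLocalizationHom` for all the shifts of `K`. -/
def IsLocalizationHomShift (M : C) : ObjectProperty C :=
  fun K ↦ ∀ a : ℤ, IsLocalizationHom ε f (K⟦a⟧) M

theorem IsLocalizationHomShift.of_iso (n : ∀ {K L : C} (φ : K ⟶ L), E.map φ ≫ ε L = ε K ≫ φ)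
    {K K' M : C} (h : IsLocalizationHomShift ε f M K) (e : K ≅ K') :
    IsLocalizationHomShift ε f M K' := fun a ↦ (h a).of_iso n ((shiftFunctor C a).mapIso e)

theorem IsLocalizationHomShift.shift (n : ∀ {K L : C} (φ : K ⟶ L), E.map φ ≫ ε L = ε K ≫ φ)
    {K M : C} (h : IsLocalizationHomShift ε f M K) (b : ℤ) :
    IsLocalizationHomShift ε f M (K⟦b⟧) :=
  fun a ↦ (h (b + a)).of_iso n ((shiftFunctorAdd C b a).app K)

theorem IsLocalizationHomShift.obj₂ (n : ∀ {K L : C} (φ : K ⟶ L), E.map φ ≫ ε L = ε K ≫ φ)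
    {T : Triangle C} (hT : T ∈ distTriang C) {M : C}
    (h₁ : IsLocalizationHomShift ε f M T.obj₁) (h₃ : IsLocalizationHomShift ε f M T.obj₃) :
    IsLocalizationHomShift ε f M T.obj₂ := fun a ↦
  IsLocalizationHom.obj₂ n (Triangle.shift_distinguished T hT a) (h₁ a) (h₁.shift n a 1) (h₃ a)
    (h₃.shift n a (-1))

theorem IsLocalizationHomShift.obj₃ (n : ∀ {K L : C} (φ : K ⟶ L), E.map φ ≫ ε L = ε K ≫ φ)
    {T : Triangle C} (hT : T ∈ distTriang C) {M : C}
    (h₁ : IsLocalizationHomShift ε f M T.obj₁) (h₂ : IsLocalizationHomShift ε f M T.obj₂) :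
    IsLocalizationHomShift ε f M T.obj₃ :=
  obj₂ n (rot_of_distTriang T hT) h₂ (h₁.shift n 1)

/-- All morphisms from `A` to `M` are `f`-power torsion. -/
def IsTorsionHom (f : R) (A : C) : ObjectProperty C :=
  fun M ↦ ∀ γ : A ⟶ M, ∃ k : ℕ, f ^ k • γ = 0

theorem IsTorsionHom.of_iso {A M M' : C} (h : IsTorsionHom f A M) (e : M ≅ M') : IsTorsionHom f A M' := by
  intro γ
  obtain ⟨k, hk⟩ := h (γ ≫ e.inv)
  exact ⟨k, by rw [← cancel_mono e.inv, Linear.smul_comp, hk, zero_comp]⟩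

theorem IsTorsionHom.obj₂ {T : Triangle C} (hT : T ∈ distTriang C) {A : C}
    (h₁ : IsTorsionHom f A T.obj₁) (h₃ : IsTorsionHom f A T.obj₃) : IsTorsionHom f A T.obj₂ := by
  intro γ
  obtain ⟨k, hk⟩ := h₃ (γ ≫ T.mor₂)
  obtain ⟨δ, hδ⟩ := Triangle.coyoneda_exact₂ T hT (f ^ k • γ) (by rw [Linear.smul_comp, hk])
  obtain ⟨l, hl⟩ := h₁ δ
  exact ⟨l + k, by rw [pow_add, mul_smul, hδ, ← Linear.smul_comp, hl, zero_comp]⟩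

/-- `A` is the cone of `ε K`, so the long exact sequence of `Hom(-, M)` bounds the kernel by `Hom(A,
M)` and the cokernel by `Hom(A, M⟦1⟧)`. -/
theorem isLocalizationHom_of_isTorsionHom {K A M : C} {q : K ⟶ A} {δ : A ⟶ (E.obj K)⟦(1 : ℤ)⟧}
    (hT : Triangle.mk (ε K) q δ ∈ distTriang C) (h : IsTorsionHom f A M)
    (h' : IsTorsionHom f A (M⟦(1 : ℤ)⟧)) : IsLocalizationHom ε f K M := by
  refine ⟨fun β hβ ↦ ?_, fun ψ ↦ ?_⟩
  · obtain ⟨γ, hγ⟩ : ∃ γ : A ⟶ M, β = q ≫ γ := Triangle.yoneda_exact₂ _ hT β hβ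
    obtain ⟨k, hk⟩ := h γ
    exact ⟨k, by rw [hγ, ← Linear.comp_smul, hk, comp_zero]⟩
  · obtain ⟨k, hk⟩ := h' (δ ≫ (shiftFunctor C (1 : ℤ)).map ψ)
    obtain ⟨w, hw⟩ : ∃ w : K⟦(1 : ℤ)⟧ ⟶ M⟦(1 : ℤ)⟧, f ^ k • (shiftFunctor C (1 : ℤ)).map ψ =
        (-(shiftFunctor C (1 : ℤ)).map (ε K)) ≫ w :=
      Triangle.yoneda_exact₃ _ (rot_of_distTriang _ hT) (f ^ k • (shiftFunctor C (1 : ℤ)).map ψ) (by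
        change δ ≫ _ = 0
        rw [Linear.comp_smul, hk])
    obtain ⟨v, rfl⟩ := (shiftFunctor C (1 : ℤ)).map_surjective w
    -- The sign compensates the one in the rotated triangle.
    refine ⟨k, -v, (shiftFunctor C (1 : ℤ)).map_injective ?_⟩
    rw [Functor.map_smul, hw, Preadditive.neg_comp, Preadditive.comp_neg, Functor.map_neg]
    exact congrArg (- ·) ((shiftFunctor C (1 : ℤ)).map_comp _ _).symm
end
end CategoryTheory.Pretriangulated

/-! ### Dévissage of bounded complexes to their cohomology -/

namespace DerivedCategory
open Pretriangulated
section
variable {C : Type*} [Category* C] [Abelian C] [HasDerivedCategory C]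

theorem isIso_homologyMap_of_isLE_of_isGE {T : Triangle (DerivedCategory C)} (hT : T ∈ distTriang _) {n : ℤ}
    (h₁ : T.obj₁.IsLE n) (h₃ : T.obj₃.IsGE (n + 1)) :
    (∀ m ≤ n, IsIso ((homologyFunctor C m).map T.mor₁)) ∧
      ∀ m > n, IsIso ((homologyFunctor C m).map T.mor₂) := by
  refine ⟨fun m hm ↦ ?_, fun m hm ↦ ?_⟩
  · have := (HomologySequence.mono_homologyMap_mor₁_iff T hT (m - 1) m (by lia)).2
      ((isZero_of_isGE T.obj₃ (n + 1) (m - 1) (by lia)).eq_of_src _ _)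
    have := (HomologySequence.epi_homologyMap_mor₁_iff T hT m).2
      ((isZero_of_isGE T.obj₃ (n + 1) m (by lia)).eq_of_tgt _ _)
    exact isIso_of_mono_of_epi _
  · have := (HomologySequence.mono_homologyMap_mor₂_iff T hT m).2
      ((isZero_of_isLE T.obj₁ n m hm).eq_of_src _ _)
    have := (HomologySequence.epi_homologyMap_mor₂_iff T hT m (m + 1)).2
      ((isZero_of_isLE T.obj₁ n (m + 1) (by lia)).eq_of_tgt _ _)
    exact isIso_of_mono_of_epi _

variable {P : ObjectProperty (DerivedCategory C)}

/-- Induction on the length of the interval of nonzero cohomology; the truncation triangle splits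
off the top cohomology object. -/
theorem prop_of_isGE_of_isLE (hP : ∀ {K L}, (K ≅ L) → P K → P L)
    (hP' : ∀ T ∈ distTriang (DerivedCategory C), P T.obj₁ → P T.obj₃ → P T.obj₂) (a : ℤ) (d : ℕ)
    (K : DerivedCategory C) [K.IsGE a] [K.IsLE (a + d)]
    (h : ∀ n, P ((singleFunctor C n).obj ((homologyFunctor C n).obj K))) : P K := by
  have base (n : ℤ) (K : DerivedCategory C) [K.IsGE n] [K.IsLE n]
      (h : P ((singleFunctor C n).obj ((homologyFunctor C n).obj K))) : P K := by
    obtain ⟨Y, ⟨e⟩⟩ := exists_iso_singleFunctor_obj_of_isGE_of_isLE K n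
    exact hP ((singleFunctor C n).mapIso ((homologyFunctor C n).mapIso e ≪≫
      (singleFunctorCompHomologyFunctorIso C n).app Y) ≪≫ e.symm) h
  induction d generalizing K with
  | zero =>
    have : K.IsLE a := by simpa using (inferInstance : K.IsLE (a + (0 : ℕ)))
    exact base a K (h a)
  | succ d ih =>
    obtain ⟨X, Z, hX, hZ, f, g, δ, hT⟩ := TStructure.t.exists_triangle K (a + d) (a + d + 1) rfl
    have hX : X.IsLE (a + d) := ⟨hX⟩
    have hZ : Z.IsGE (a + d + 1) := ⟨hZ⟩
    obtain ⟨h₁, h₃⟩ := isIso_homologyMap_of_isLE_of_isGE hT hX hZ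
    have : X.IsGE a := (isGE_iff _ _).2 fun i hi ↦ by
      have : IsIso ((homologyFunctor C i).map f) := h₁ i (by lia)
      exact (isZero_of_isGE K a i hi).of_iso (asIso ((homologyFunctor C i).map f))
    have : Z.IsLE (a + d + 1) := (isLE_iff _ _).2 fun i hi ↦ by
      have : IsIso ((homologyFunctor C i).map g) := h₃ i (by lia)
      exact (isZero_of_isLE K (a + (d + 1 : ℕ)) i (by push_cast; lia)).of_iso
        (asIso ((homologyFunctor C i).map g)).symm
    refine hP' _ hT (ih X fun n ↦ ?_) (base (a + d + 1) Z ?_)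
    · by_cases hn : n ≤ a + d
      · have : IsIso ((homologyFunctor C n).map f) := h₁ n hn
        exact hP ((singleFunctor C n).mapIso (asIso ((homologyFunctor C n).map f)).symm) (h n)
      -- Here the cohomology of `X` is zero. That `P` holds for zero objects is read off from `h` in
      -- degree `a + d + 2`, where the cohomology of `K` vanishes.
      · have z := (singleFunctor C n).map_isZero (isZero_of_isLE X (a + d) n (by lia))
        have z' := (singleFunctor C (a + d + 2)).map_isZero
          (isZero_of_isLE K (a + (d + 1 : ℕ)) (a + d + 2) (by push_cast; lia))
        exact hP (z'.iso z) (h _)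
    · have : IsIso ((homologyFunctor C (a + d + 1)).map g) := h₃ _ (by lia)
      exact hP ((singleFunctor C _).mapIso (asIso ((homologyFunctor C _).map g))) (h _)

/-- A property of objects of the derived category which is stable under extensions holds for a
complex with bounded cohomology if it holds for its cohomology objects. -/
theorem prop_of_homology (hP : ∀ {K L}, (K ≅ L) → P K → P L)
    (hP' : ∀ T ∈ distTriang (DerivedCategory C), P T.obj₁ → P T.obj₃ → P T.obj₂)
    {K : DerivedCategory C} (hK : {n : ℤ | ¬ IsZero ((homologyFunctor C n).obj K)}.Finite)
    (h : ∀ n, P ((singleFunctor C n).obj ((homologyFunctor C n).obj K))) : P K := by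
  obtain ⟨a, ha⟩ := hK.bddBelow
  obtain ⟨b, hb⟩ := hK.bddAbove
  have : K.IsGE a := (isGE_iff _ _).2 fun i hi ↦ by
    by_contra hz
    exact absurd (ha hz) (by lia)
  -- If `b < a`, all cohomology vanishes, and replacing `b - a` by `0` does no harm.
  have : K.IsLE (a + (b - a).toNat) := (isLE_iff _ _).2 fun i hi ↦ by
    by_contra hz
    have := hb hz
    lia
  exact prop_of_isGE_of_isLE hP hP' a (b - a).toNat K h
end
end DerivedCategory

/-! ### Flasque sheaves of modules -/

namespace AlgebraicGeometry.Scheme.Modules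
section
variable {X Y : Scheme.{u}} {M N : X.Modules}

open DerivedDescent (structureSheaf)

/-- The morphism `𝒪_X ⟶ M` given by a global section of `M`. -/
noncomputable def unitTo (M : X.Modules) (s : Γ(M, ⊤)) : structureSheaf X ⟶ M :=
  (SheafOfModules.unitHomEquiv (R := X.ringCatSheaf) M).symm
    (PresheafOfModules.sectionsMk (fun _ ↦ M.res le_top s) fun _ _ _ ↦ M.res_res _ _ s)

/-- The section `1` of the structure sheaf. -/
def one (U : X.Opens) : Γ(structureSheaf X, U) := (1 : Γ(X, U))

theorem smul_one (U : X.Opens) (a : Γ(X, U)) : a • one U = (show Γ(structureSheaf X, U) from a) :=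
  mul_one (M := Γ(X, U)) a

theorem res_one {U V : X.Opens} (h : V ≤ U) : (structureSheaf X).res h (one U) = one V :=
  map_one (X.presheaf.map (homOfLE h).op).hom

theorem app_one (φ : structureSheaf X ⟶ M) (U : X.Opens) :
    φ.app U (one U) = M.res le_top (φ.app ⊤ (one ⊤)) := by
  rw [← app_res, res_one]

theorem unitTo_app_one (s : Γ(M, ⊤)) : (unitTo M s).app ⊤ (one ⊤) = s := by
  have h := congr_arg (fun t ↦ t.val (.op ⊤)) ((SheafOfModules.unitHomEquiv (R := X.ringCatSheaf) M).apply_symm_apply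
    (PresheafOfModules.sectionsMk (fun _ ↦ M.res le_top s) fun _ _ _ ↦ M.res_res _ _ s))
  exact h.trans (M.res_self _ s)

theorem unit_hom_ext {φ ψ : structureSheaf X ⟶ M} (h : φ.app ⊤ (one ⊤) = ψ.app ⊤ (one ⊤)) :
    φ = ψ := by
  ext U (a : Γ(X, U))
  have e := smul_one U a
  change φ.app U (show Γ(structureSheaf X, U) from a) = ψ.app U (show Γ(structureSheaf X, U) from a)
  rw [← e, Hom.app_smul, Hom.app_smul, app_one φ, app_one ψ, h]

/-- All restriction maps of `M` are surjective. -/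
def IsFlasque (M : X.Modules) : Prop :=
  ∀ (U : X.Opens) (s : Γ(M, U)), ∃ t : Γ(M, ⊤), M.res le_top t = s

theorem IsFlasque.of_iso (h : M.IsFlasque) (e : M ≅ N) : N.IsFlasque := by
  intro U s
  obtain ⟨t, ht⟩ := h U (e.inv.app U s)
  refine ⟨e.hom.app ⊤ t, ?_⟩
  rw [← app_res, ht, ← comp_app_apply, e.inv_hom_id]
  rfl

section
variable (j : X ⟶ Y) [IsOpenImmersion j]

/-- `restrictUnitIso`, as an isomorphism of sheaves of modules. -/
noncomputable def restrictUnit : (restrictFunctor j).obj (structureSheaf Y) ≅ structureSheaf X :=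
  restrictUnitIso j

theorem restrictUnit_inv_app_one :
    (restrictUnit j).inv.app ⊤ (one ⊤) = one (j ''ᵁ ⊤) :=
  map_one (j.appIso ⊤).inv.hom

theorem restrictFunctor_map_app {M N : Y.Modules} (φ : M ⟶ N) (U : X.Opens) :
    ((restrictFunctor j).map φ).app U = φ.app (j ''ᵁ U) := rfl

theorem restrict_hom_ext {M : Y.Modules} {φ ψ : (restrictFunctor j).obj (structureSheaf Y) ⟶ (restrictFunctor j).obj M}
    (h : φ.app ⊤ (one (j ''ᵁ ⊤) : Γ(structureSheaf Y, j ''ᵁ ⊤)) = ψ.app ⊤ (one (j ''ᵁ ⊤) : Γ(structureSheaf Y, j ''ᵁ ⊤))) : φ = ψ := by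
  refine (cancel_epi (restrictUnit j).inv).1 (unit_hom_ext ?_)
  rw [comp_app_apply, comp_app_apply]
  exact (congrArg (φ.app ⊤) (restrictUnit_inv_app_one j)).trans
    (h.trans (congrArg (ψ.app ⊤) (restrictUnit_inv_app_one j)).symm)

/-- A morphism from the structure sheaf is a section; the section over the image of `j` extends
globally. -/
theorem IsFlasque.exists_restrictFunctor_map_eq {M : Y.Modules} (h : M.IsFlasque)
    (ψ : (restrictFunctor j).obj (structureSheaf Y) ⟶ (restrictFunctor j).obj M) :
    ∃ φ : structureSheaf Y ⟶ M, (restrictFunctor j).map φ = ψ := by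
  obtain ⟨s, hs⟩ := h (j ''ᵁ ⊤) (ψ.app ⊤ (one (j ''ᵁ ⊤) : Γ(structureSheaf Y, j ''ᵁ ⊤)))
  refine ⟨unitTo M s, restrict_hom_ext j ?_⟩
  refine Eq.trans ?_ hs
  exact (app_one (unitTo M s) (j ''ᵁ ⊤)).trans (by rw [unitTo_app_one])

theorem IsFlasque.exists_pullback_map_eq {M : Y.Modules} (h : M.IsFlasque)
    (ψ : (pullback j).obj (structureSheaf Y) ⟶ (pullback j).obj M) :
    ∃ φ : structureSheaf Y ⟶ M, (pullback j).map φ = ψ := by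
  obtain ⟨φ, hφ⟩ := h.exists_restrictFunctor_map_eq j ((restrictFunctorIsoPullback j).hom.app _ ≫ ψ ≫
    (restrictFunctorIsoPullback j).inv.app _)
  refine ⟨φ, ?_⟩
  rw [← NatIso.naturality_1 (restrictFunctorIsoPullback j), hφ]
  simp

theorem IsFlasque.restrictFunctor {M : Y.Modules} (h : M.IsFlasque) :
    ((restrictFunctor j).obj M).IsFlasque := by
  intro U (s : Γ(M, j ''ᵁ U))
  obtain ⟨t, ht⟩ := h _ s
  refine ⟨M.res (le_top : j ''ᵁ ⊤ ≤ ⊤) t, ?_⟩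
  exact (M.res_res _ (j.image_mono le_top) t).trans ht

theorem IsFlasque.pullback {M : Y.Modules} (h : M.IsFlasque) : ((pullback j).obj M).IsFlasque :=
  (h.restrictFunctor j).of_iso ((restrictFunctorIsoPullback j).app M)
end

/-- A section over `U` is a morphism `j_! 𝒪_U ⟶ M`. As `j_! 𝒪_U ⟶ 𝒪_X` is mono, it extends to `𝒪_X ⟶
M`, that is, to a global section. -/
theorem isFlasque_of_injective (M : X.Modules) [Injective M] : M.IsFlasque := by
  intro U s
  let j := U.ι
  have hU : j ''ᵁ ⊤ = U := by simp [j]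
  let ψ : (restrictFunctor j).obj (structureSheaf X) ⟶ (restrictFunctor j).obj M :=
    (restrictUnit j).hom ≫ unitTo ((restrictFunctor j).obj M) (M.res hU.le s)
  let adj := extendByZeroRestrictAdjunction j
  have hm : Mono (adj.counit.app (structureSheaf X)) := by
    exact (inferInstance : Mono (inv ((supportFunctor j.opensRange).map
      ((restrictAdjunction j).unit.app (structureSheaf X))) ≫ supportIncl (structureSheaf X) j.opensRange))
  obtain ⟨φ, hφ⟩ := Injective.factors ((adj.homEquiv _ _).symm ψ) (adj.counit.app (structureSheaf X))
  have h : (restrictFunctor j).map φ = ψ := by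
    apply (adj.homEquiv _ _).symm.injective
    refine Eq.trans ?_ hφ
    rw [Adjunction.homEquiv_counit]
    exact adj.counit.naturality φ
  refine ⟨φ.app ⊤ (one ⊤), ?_⟩
  have h₁ := app_one φ (j ''ᵁ ⊤)
  have h₂ : φ.app (j ''ᵁ ⊤) (one (j ''ᵁ ⊤)) = M.res hU.le s := by
    have e : ((restrictFunctor j).map φ).app ⊤ ((restrictUnit j).inv.app ⊤ (one ⊤)) = M.res hU.le s := by
      rw [h, ← comp_app_apply, Iso.inv_hom_id_assoc]
      exact unitTo_app_one (M := (restrictFunctor j).obj M) (M.res hU.le s)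
    exact (congrArg (((restrictFunctor j).map φ).app ⊤) (restrictUnit_inv_app_one j)).symm.trans e
  rw [← M.res_self le_rfl s, ← M.res_res hU.le hU.ge, ← h₂, h₁, res_res]

/-- The sheaf of abelian groups underlying a sheaf of modules. -/
noncomputable def sheaf (M : X.Modules) : TopCat.Sheaf Ab.{u} X := ⟨M.presheaf, M.isSheaf⟩

theorem IsFlasque.sheaf (h : M.IsFlasque) : TopCat.Sheaf.IsFlasque M.sheaf where
  epi {U V} i := by
    refine (AddCommGrpCat.epi_iff_surjective _).2 fun s ↦ ?_
    obtain ⟨t, ht⟩ := h V.unop s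
    exact ⟨M.res le_top t, (M.res_res le_top (leOfHom i.unop) t).trans ht⟩

/-- Passes to sheaves of abelian groups, to use there that sections lift along a quotient by a
flasque sheaf. -/
theorem shortExact_sheaf {S : ShortComplex X.Modules} (hS : S.ShortExact) :
    ∃ (f : S.X₁.sheaf ⟶ S.X₂.sheaf) (g : S.X₂.sheaf ⟶ S.X₃.sheaf) (w : f ≫ g = 0),
      f.hom = S.f.mapPresheaf ∧ g.hom = S.g.mapPresheaf ∧
        (ShortComplex.mk f g w).ShortExact := by
  have hm := hS.mono_f
  have he := hS.epi_g
  let f : S.X₁.sheaf ⟶ S.X₂.sheaf := ⟨S.f.mapPresheaf⟩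
  let g : S.X₂.sheaf ⟶ S.X₃.sheaf := ⟨S.g.mapPresheaf⟩
  let F : X.Modules ⥤ TopCat.Sheaf Ab.{u} X := SheafOfModules.toSheaf X.ringCatSheaf
  have : PreservesFiniteLimits F :=
    inferInstanceAs (PreservesFiniteLimits (SheafOfModules.toSheaf X.ringCatSheaf))
  have : F.Additive := inferInstanceAs (SheafOfModules.toSheaf X.ringCatSheaf).Additive
  have w : f ≫ g = 0 := by
    have : F.map S.f ≫ F.map S.g = 0 := by rw [← F.map_comp, S.zero, F.map_zero]
    exact this
  have hf : Mono f := inferInstanceAs (Mono (F.map S.f))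
  have hg : Epi g := by
    rw [← TopCat.Sheaf.isLocallySurjective_iff_epi]
    exact (TopCat.Presheaf.isLocallySurjective_iff _).2 fun U s x hx ↦ by
      obtain ⟨V, hV, hxV, t, ht⟩ := locallySurjective_of_epi S.g U s x hx
      exact ⟨V, hV, ⟨t, ht⟩, hxV⟩
  refine ⟨f, g, w, rfl, rfl, ShortComplex.ShortExact.mk' ?_ hf hg⟩
  refine ShortComplex.exact_of_f_is_kernel _ ?_
  exact KernelFork.mapIsLimit _ hS.fIsKernel F

theorem IsFlasque.surjective_of_shortExact {S : ShortComplex X.Modules} (hS : S.ShortExact)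
    (h : S.X₁.IsFlasque) (U : X.Opens) : Function.Surjective (S.g.app U) := by
  obtain ⟨f, g, w, hf, hg, hS'⟩ := shortExact_sheaf hS
  have : TopCat.Sheaf.IsFlasque (ShortComplex.mk f g w).X₁ := h.sheaf
  have e := TopCat.Sheaf.IsFlasque.epi_of_shortExact (U := U) hS'
  have e' := (AddCommGrpCat.epi_iff_surjective _).1 e
  intro s
  obtain ⟨t, ht⟩ := e' s
  exact ⟨t, ht.symm ▸ congr(($(hg.symm).app (.op U)).hom t)⟩

theorem IsFlasque.of_shortExact {S : ShortComplex X.Modules} (hS : S.ShortExact)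
    (h₁ : S.X₁.IsFlasque) (h₂ : S.X₂.IsFlasque) : S.X₃.IsFlasque := by
  intro U s
  obtain ⟨t, rfl⟩ := h₁.surjective_of_shortExact hS U s
  obtain ⟨t', rfl⟩ := h₂ U t
  exact ⟨S.g.app ⊤ t', (app_res _ _ _).symm⟩
end
end AlgebraicGeometry.Scheme.Modules

/-! ### Vanishing of the cohomology of flasque sheaves -/

namespace DerivedCategory
open Pretriangulated
variable {C : Type*} [Category* C] [Abelian C] [HasDerivedCategory C]

theorem exists_singleTriangle {S : ShortComplex C} (hS : S.ShortExact) (n : ℤ) :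
    ∃ δ, Triangle.mk ((singleFunctor C n).map S.f) ((singleFunctor C n).map S.g) δ ∈
      distTriang (DerivedCategory C) :=
  ⟨_, triangleOfSES_distinguished (hS.map_of_exact (HomologicalComplex.single C (ComplexShape.up ℤ) n))⟩

theorem eq_zero_of_isLE_of_isGE {K L : DerivedCategory C} (φ : K ⟶ L) (a b : ℤ) (h : a < b) [K.IsLE a] [L.IsGE b] :
    φ = 0 := TStructure.t.zero_of_isLE_of_isGE φ a b h inferInstance inferInstance
end DerivedCategory

namespace DerivedDescent
open Pretriangulated Scheme.Modules DerivedCategory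
variable {X Y : Scheme.{u}}

/-- This is `Ext^(d+1)(𝒪_X, F) = 0`, by dimension shifting along `0 ⟶ F ⟶ I ⟶ G ⟶ 0` with `I`
injective: `φ` dies in `I`, hence comes from a class with values in `G`, one degree lower, and `G`
is flasque as well. -/
theorem eq_zero_of_isFlasque_of_lt (d : ℕ) {F : X.Modules} (hF : F.IsFlasque) (a b : ℤ) (hab : b + 1 + d = a)
    (φ : (singleFunctor X.Modules a).obj (structureSheaf X) ⟶ (singleFunctor X.Modules b).obj F) : φ = 0 := by
  induction d using Nat.strong_induction_on generalizing F a b with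
  | _ d ih =>
  let S := ShortComplex.mk _ _ (cokernel.condition (Injective.ι F))
  have hS : S.ShortExact :=
    { exact := ShortComplex.exact_of_g_is_cokernel _ (cokernelIsCokernel S.f) }
  have hJ : S.X₂.IsFlasque := isFlasque_of_injective (Injective.under F)
  have hG : S.X₃.IsFlasque := IsFlasque.of_shortExact hS hF hJ
  obtain ⟨δ, hT⟩ := exists_singleTriangle hS b
  have hφ : φ ≫ (singleFunctor X.Modules b).map S.f = 0 :=
    have : Injective S.X₂ := inferInstanceAs (Injective (Injective.under F))
    to_singleFunctor_obj_eq_zero_of_injective (K := (CochainComplex.singleFunctor X.Modules a).obj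
      (structureSheaf X)) _ a (by lia)
  obtain ⟨g, hg⟩ : ∃ g : ((singleFunctor X.Modules a).obj (structureSheaf X))⟦(1 : ℤ)⟧ ⟶
      (singleFunctor X.Modules b).obj S.X₃, φ⟦(1 : ℤ)⟧' = g ≫ δ :=
    Triangle.coyoneda_exact₁ _ hT (φ⟦(1 : ℤ)⟧') (by
      have := congrArg (fun ψ ↦ ψ⟦(1 : ℤ)⟧') hφ
      rwa [Functor.map_comp, Functor.map_zero] at this)
  have hz : (singleFunctor X.Modules b).map S.g ≫ δ = 0 := comp_distTriang_mor_zero₂₃ _ hT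
  apply (shiftFunctor (DerivedCategory X.Modules) (1 : ℤ)).map_injective
  rw [hg, Functor.map_zero]
  obtain rfl | d := d
  -- For `d = 0` the class is a global section of `G`, which lifts to `I` because `F` is flasque;
  -- its image under the connecting morphism is then zero.
  · let e := ((singleFunctors X.Modules).shiftIso 1 b a (by lia)).app (structureSheaf X)
    obtain ⟨h, hh⟩ := (singleFunctor X.Modules b).map_surjective (e.inv ≫ g)
    obtain ⟨t, ht⟩ := hF.surjective_of_shortExact hS ⊤ (h.app ⊤ (one ⊤))
    have hh' : unitTo S.X₂ t ≫ S.g = h := unit_hom_ext (by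
      rw [comp_app_apply, unitTo_app_one, ht])
    rw [← cancel_epi e.inv, comp_zero, ← Category.assoc, ← hh, ← hh', Functor.map_comp, Category.assoc, hz,
      comp_zero]
  · let e := ((singleFunctors X.Modules).shiftIso 1 (a - 1) a (by lia)).app (structureSheaf X)
    have h := ih d (by lia) hG (a - 1) b (by push_cast at hab; lia) (e.inv ≫ g)
    rw [← cancel_epi e.inv, ← Category.assoc, h, zero_comp, comp_zero]

/-- Flasque sheaves have no cohomology. -/
theorem eq_zero_of_isFlasque {F : X.Modules} (hF : F.IsFlasque) {a b : ℤ} (hab : a ≠ b)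
    (φ : (singleFunctor X.Modules a).obj (structureSheaf X) ⟶ (singleFunctor X.Modules b).obj F) : φ = 0 := by
  rcases hab.lt_or_gt with h | h
  · exact eq_zero_of_isLE_of_isGE φ a b h
  · exact eq_zero_of_isFlasque_of_lt (a - b - 1).toNat hF a b (by lia) φ

/-- The inverse image of the structure sheaf is the structure sheaf. -/
noncomputable def pullbackUnit (j : X ⟶ Y) [IsOpenImmersion j] :
    (Scheme.Modules.pullback j).obj (structureSheaf Y) ≅ structureSheaf X :=
  ((restrictFunctorIsoPullback j).app _).symm ≪≫ restrictUnit j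

/-- The inverse image of a sheaf in degree `n`. -/
noncomputable def pullbackDSingle (f : X ⟶ Y) [IsLocalIso f] (n : ℤ) :
    singleFunctor Y.Modules n ⋙ pullbackD f ≅
      Scheme.Modules.pullback f ⋙ singleFunctor X.Modules n :=
  (Scheme.Modules.pullback f).mapDerivedCategorySingleFunctor n

/-- In equal degrees this is extension of sections; in different degrees `ψ` itself is zero, since
the restriction of a flasque sheaf is flasque. -/
theorem exists_pullbackD_map_eq_of_isFlasque (j : X ⟶ Y) [IsOpenImmersion j] {F : Y.Modules} (hF : F.IsFlasque) (a b : ℤ)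
    (ψ : (pullbackD j).obj ((singleFunctor Y.Modules a).obj (structureSheaf Y)) ⟶
      (pullbackD j).obj ((singleFunctor Y.Modules b).obj F)) :
    ∃ φ, (pullbackD j).map φ = ψ := by
  by_cases hab : a = b
  · subst hab
    obtain ⟨χ, hχ⟩ := (singleFunctor X.Modules a).map_surjective
      ((pullbackDSingle j a).inv.app _ ≫ ψ ≫ (pullbackDSingle j a).hom.app _)
    obtain ⟨φ, rfl⟩ := hF.exists_pullback_map_eq j χ
    refine ⟨(singleFunctor Y.Modules a).map φ, ?_⟩
    refine (NatIso.naturality_1 (pullbackDSingle j a).symm φ).symm.trans ?_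
    change (pullbackDSingle j a).hom.app _ ≫ (singleFunctor X.Modules a).map ((Scheme.Modules.pullback j).map φ) ≫
      (pullbackDSingle j a).inv.app _ = ψ
    rw [hχ]
    simp
  · refine ⟨0, ?_⟩
    have h := eq_zero_of_isFlasque (hF.pullback j) hab ((singleFunctor X.Modules a).map (pullbackUnit j).inv ≫
      (pullbackDSingle j a).inv.app _ ≫ ψ ≫ (pullbackDSingle j b).hom.app _)
    rw [Functor.map_zero, ← cancel_mono ((pullbackDSingle j b).hom.app _),
      ← cancel_epi ((pullbackDSingle j a).inv.app _),
      ← cancel_epi ((singleFunctor X.Modules a).map (pullbackUnit j).inv), h]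
    simp
end DerivedDescent

/-! ### Quasi-coherent sheaves and flasque resolutions over a principal ideal domain -/

namespace AlgebraicGeometry.Scheme.Modules
section
variable {R : CommRingCat.{u}} {M N : (Spec R).Modules}

open DerivedDescent (structureSheaf quasiCoherent)
/-- The standard open subset `D(f)` of `Spec R`. -/
abbrev specBasicOpen (f : R) : (Spec R).Opens := _root_.PrimeSpectrum.basicOpen f

theorem res_smul_Spec {U V : (Spec R).Opens} (h : V ≤ U) (r : R) (s : Γ(M, U)) :
    M.res h (r • s) = r • M.res h s := map_smul_Spec (homOfLE h).op r s

theorem isLocalizedModule_res (hM : quasiCoherent _ M) (f : R) :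
    IsLocalizedModule (.powers f) ((modulesSpecToSheaf.obj M).obj.map
      (homOfLE (le_top : specBasicOpen f ≤ ⊤)).op).hom :=
  (isIso_fromTildeΓ_iff_isLocalizing M).1 ((isQuasicoherent_iff_isIso_fromTildeΓ M).1 hM) f

theorem exists_pow_smul_eq_zero (hM : quasiCoherent _ M) (f : R) (s : Γ(M, ⊤))
    (hs : M.res (le_top : specBasicOpen f ≤ ⊤) s = 0) : ∃ k : ℕ, f ^ k • s = 0 := by
  have := isLocalizedModule_res hM f
  obtain ⟨⟨_, k, rfl⟩, hk⟩ := (IsLocalizedModule.eq_zero_iff (.powers f) ((modulesSpecToSheaf.obj M).obj.map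
      (homOfLE (le_top : specBasicOpen f ≤ ⊤)).op).hom).1 hs
  exact ⟨k, hk⟩

theorem exists_res_eq_pow_smul (hM : quasiCoherent _ M) (f : R) (s : Γ(M, specBasicOpen f)) :
    ∃ (k : ℕ) (t : Γ(M, ⊤)), M.res (le_top : specBasicOpen f ≤ ⊤) t = f ^ k • s := by
  have := isLocalizedModule_res hM f
  obtain ⟨⟨t, ⟨_, k, rfl⟩⟩, hk⟩ := IsLocalizedModule.surj (.powers f) ((modulesSpecToSheaf.obj M).obj.map
      (homOfLE (le_top : specBasicOpen f ≤ ⊤)).op).hom s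
  exact ⟨k, t, hk.symm⟩

theorem eq_zero_of_pow_smul_eq_zero (f : R) (k : ℕ) {s : Γ(M, specBasicOpen f)}
    (h : f ^ k • s = 0) : s = 0 :=
  (isSMulRegular_of_le_basicOpen (M := M) (U := specBasicOpen f) le_rfl).pow k (h.trans (smul_zero _).symm)

theorem eq_of_forall_basicOpen {U : (Spec R).Opens} {s t : Γ(M, U)}
    (h : ∀ (f : R) (hf : specBasicOpen f ≤ U), M.res hf s = M.res hf t) : s = t :=
  eq_of_forall_exists_res_eq fun x hx ↦ by
    obtain ⟨_, ⟨_, ⟨f, rfl⟩, rfl⟩, hxf, hf⟩ := _root_.PrimeSpectrum.isBasis_basic_opens.exists_subset_of_mem_open hx U.isOpen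
    exact ⟨specBasicOpen f, hf, hxf, h f hf⟩

/-- Up to a power of `f`, which acts injectively on sections over `D(f)`, each section there is the
restriction of a global one. -/
theorem mono_of_injective_app_top (hM : quasiCoherent _ M) (hN : quasiCoherent _ N) (φ : M ⟶ N)
    (h : Function.Injective (φ.app ⊤)) : Mono φ := by
  refine mono_of_injective φ fun U ↦ (injective_iff_map_eq_zero _).2 fun s hs ↦
    eq_of_forall_basicOpen fun f hf ↦ ?_
  have hs' : φ.app _ (M.res hf s) = 0 := by rw [app_res, hs, map_zero]
  rw [map_zero]
  obtain ⟨k, t, ht⟩ := exists_res_eq_pow_smul hM f (M.res hf s)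
  obtain ⟨l, hl⟩ := exists_pow_smul_eq_zero hN f (φ.app ⊤ t) (by
    rw [← app_res, ht, app_smul_Spec, hs', smul_zero])
  have hl' : f ^ l • t = 0 := h (by rw [app_smul_Spec, hl, map_zero])
  refine eq_zero_of_pow_smul_eq_zero f (l + k) ?_
  rw [pow_add, mul_smul, ← ht, ← res_smul_Spec, hl', map_zero]

theorem quasiCoherent_tilde (N : ModuleCat.{u} R) : quasiCoherent _ (tilde N) := by
  change (tilde N).IsQuasicoherent
  infer_instance

/-- The section of `N^~` given by an element of `N`. -/
noncomputable def toSection {N : ModuleCat.{u} R} (n : N) : Γ(tilde N, ⊤) := tilde.toOpen N ⊤ n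

theorem toSection_bijective {N : ModuleCat.{u} R} : Function.Bijective (toSection (N := N)) :=
  (ConcreteCategory.isIso_iff_bijective (tilde.toOpen N ⊤)).1 inferInstance

theorem toSection_smul {N : ModuleCat.{u} R} (r : R) (n : N) : toSection (r • n) = r • toSection n :=
  (tilde.toOpen N ⊤).hom.map_smul r n

theorem tilde_map_app_toSection {N N' : ModuleCat.{u} R} (g : N ⟶ N') (n : N) :
    (tilde.map g).app ⊤ (toSection n) = toSection (g n) :=
  congr($(tilde.toOpen_map_app g ⊤) n)

instance {N N' : ModuleCat.{u} R} (g : N ⟶ N') [Mono g] : Mono (tilde.map g) := by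
  refine mono_of_injective_app_top (quasiCoherent_tilde _) (quasiCoherent_tilde _) _ fun s t h ↦ ?_
  obtain ⟨n, rfl⟩ := toSection_bijective.2 s
  obtain ⟨n', rfl⟩ := toSection_bijective.2 t
  rw [tilde_map_app_toSection, tilde_map_app_toSection] at h
  exact congrArg _ ((ModuleCat.mono_iff_injective g).1 inferInstance (toSection_bijective.1 h))

theorem shortExact_tilde {S : ShortComplex (ModuleCat.{u} R)} (hS : S.ShortExact) :
    (S.map (tilde.functor R)).ShortExact := by
  have := hS.mono_f
  have := hS.epi_g
  exact ShortComplex.ShortExact.mk' (hS.exact.map_of_epi_of_preservesCokernel (tilde.functor R) inferInstance inferInstance)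
    (inferInstanceAs (Mono (tilde.map S.f))) (inferInstanceAs (Epi ((tilde.functor R).map S.g)))

theorem exists_iso_tilde (hM : quasiCoherent _ M) : ∃ N : ModuleCat.{u} R, Nonempty (tilde N ≅ M) :=
  have := (isQuasicoherent_iff_isIso_fromTildeΓ M).1 hM
  ⟨_, ⟨asIso M.fromTildeΓ⟩⟩

/-- Over a principal ideal domain, divisible modules correspond to flasque sheaves. -/
theorem isFlasque_tilde [IsDomain R] [IsPrincipalIdealRing R] (I : ModuleCat.{u} R)
    (hI : ∀ (r : R), r ≠ 0 → ∀ x : I, ∃ y : I, r • y = x) : (tilde I).IsFlasque := by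
  intro U s
  -- Every open subset is basic, because the ideal of its complement is principal.
  obtain ⟨f, rfl⟩ : ∃ f : R, U = specBasicOpen f := by
    obtain ⟨J, hJ⟩ := (_root_.PrimeSpectrum.isClosed_iff_zeroLocus_ideal _).1 U.isOpen.isClosed_compl
    obtain ⟨f, rfl⟩ := (IsPrincipalIdealRing.principal J).principal
    refine ⟨f, Opens.ext ?_⟩
    refine (compl_compl _).symm.trans ((congrArg _ hJ).trans ?_)
    exact ((congrArg _ (_root_.PrimeSpectrum.zeroLocus_span {f})).trans
      (_root_.PrimeSpectrum.basicOpen_eq_zeroLocus_compl f).symm)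
  obtain ⟨k, t, ht⟩ := exists_res_eq_pow_smul (quasiCoherent_tilde I) f s
  by_cases hf : f = 0
  · refine ⟨0, ?_⟩
    rw [map_zero]
    refine (eq_zero_of_pow_smul_eq_zero f 1 ?_).symm
    rw [pow_one]
    exact (congrArg (· • s) hf).trans (zero_smul R s)
  -- The global section extending `f ^ k • s` can be divided by `f ^ k` in `I`, and the quotient
  -- restricts to `s`.
  · obtain ⟨n, rfl⟩ := toSection_bijective.2 t
    obtain ⟨m, rfl⟩ := hI (f ^ k) (pow_ne_zero _ hf) n
    refine ⟨toSection m, sub_eq_zero.1 (eq_zero_of_pow_smul_eq_zero f k ?_)⟩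
    rw [smul_sub, ← ht, toSection_smul, res_smul_Spec, sub_self]

/-- Extend `1 ↦ x` along multiplication by `r`, a monomorphism of `R`; the image of `1` is the
quotient. -/
theorem exists_smul_eq_of_injective [IsDomain R] (I : ModuleCat.{u} R) [Injective I] (r : R) (hr : r ≠ 0) (x : I) :
    ∃ y : I, r • y = x := by
  let m : ModuleCat.of R R ⟶ ModuleCat.of R R := ModuleCat.ofHom (LinearMap.mulLeft R r)
  have : Mono m := (ModuleCat.mono_iff_injective m).2 (mul_right_injective₀ hr)
  let g : ModuleCat.of R R ⟶ I := ModuleCat.ofHom (LinearMap.toSpanSingleton R I x)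
  refine ⟨Injective.factorThru g m (1 : R), ?_⟩
  have h : m ≫ Injective.factorThru g m = g := Injective.comp_factorThru g m
  have h₁ := congr($h (1 : R))
  have h₂ : (Injective.factorThru g m).hom (r • (1 : R)) = r • (Injective.factorThru g m).hom (1 : R) := _root_.map_smul _ _ _
  refine h₂.symm.trans (Eq.trans ?_ (h₁.trans (one_smul R x)))
  rfl

/-- Embed `N` in an injective module, which is divisible; quotients of divisible modules are
divisible. -/
theorem exists_isFlasque_resolution [IsDomain R] [IsPrincipalIdealRing R] (N : ModuleCat.{u} R) :
    ∃ S : ShortComplex (ModuleCat.{u} R), S.ShortExact ∧ S.X₁ = N ∧ (tilde S.X₂).IsFlasque ∧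
      (tilde S.X₃).IsFlasque := by
  let S := ShortComplex.mk _ _ (cokernel.condition (Injective.ι N))
  have hS : S.ShortExact :=
    { exact := ShortComplex.exact_of_g_is_cokernel _ (cokernelIsCokernel S.f) }
  have h (r : R) (hr : r ≠ 0) (x : S.X₂) := exists_smul_eq_of_injective (Injective.under N) r hr x
  refine ⟨S, hS, rfl, isFlasque_tilde _ h, isFlasque_tilde _ fun r hr x ↦ ?_⟩
  have := hS.epi_g
  obtain ⟨x, rfl⟩ := (ModuleCat.epi_iff_surjective S.g).1 inferInstance x
  obtain ⟨y, rfl⟩ := h r hr x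
  exact ⟨S.g y, (_root_.map_smul S.g.hom r y).symm⟩
end
end AlgebraicGeometry.Scheme.Modules

/-! ### Passage between localization and torsion of morphism groups -/

namespace CategoryTheory.Pretriangulated
section
variable {C : Type*} [Category* C] [HasZeroObject C] [HasShift C ℤ] [Preadditive C]
  [∀ n : ℤ, (shiftFunctor C n).Additive] [Pretriangulated C]
  {R : Type*} [CommRing R] [Linear R C] [∀ n : ℤ, (shiftFunctor C n).Linear R]
  {E : C ⥤ C} {ε : ∀ K, E.obj K ⟶ K} {f : R}

set_option linter.unusedSectionVars false

theorem IsLocalizationHom.of_iso_right {K M M' : C} (h : IsLocalizationHom ε f K M) (e : M ≅ M') :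
    IsLocalizationHom ε f K M' := by
  refine ⟨fun β hβ ↦ ?_, fun ψ ↦ ?_⟩
  · obtain ⟨k, hk⟩ := h.1 (β ≫ e.inv) (by rw [← Category.assoc, hβ, zero_comp])
    exact ⟨k, by rw [← cancel_mono e.inv, Linear.smul_comp, hk, zero_comp]⟩
  · obtain ⟨k, β, hk⟩ := h.2 (ψ ≫ e.inv)
    exact ⟨k, β ≫ e.hom, by
      rw [← cancel_mono e.inv, Linear.smul_comp, hk, Category.assoc, Category.assoc, e.hom_inv_id,
        Category.comp_id]⟩

/-- A converse to `isLocalizationHom_of_isTorsionHom`. Torsion of `Hom(A, M)` is closed under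
extensions in `M`, so it serves for dévissage in the target, while `IsLocalizationHom` serves for
dévissage in the source. -/
theorem isTorsionHom_of_isLocalizationHom {K A M : C} {q : K ⟶ A} {δ : A ⟶ (E.obj K)⟦(1 : ℤ)⟧}
    (hT : Triangle.mk (ε K) q δ ∈ distTriang C) (h : IsLocalizationHom ε f K M)
    (h' : IsLocalizationHom ε f K (M⟦(-1 : ℤ)⟧)) : IsTorsionHom f A M := by
  intro γ
  have z₁ : ε K ≫ q = 0 := comp_distTriang_mor_zero₁₂ _ hT
  have z₃ : δ ≫ (ε K)⟦(1 : ℤ)⟧' = 0 := comp_distTriang_mor_zero₃₁ _ hT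
  obtain ⟨k, hk⟩ := h.1 (q ≫ γ) (by rw [← Category.assoc, z₁, zero_comp])
  obtain ⟨w, hw⟩ : ∃ w : (E.obj K)⟦(1 : ℤ)⟧ ⟶ M, f ^ k • γ = δ ≫ w :=
    Triangle.yoneda_exact₃ _ hT (f ^ k • γ) ((Linear.comp_smul ..).trans hk)
  let e : (M⟦(-1 : ℤ)⟧)⟦(1 : ℤ)⟧ ≅ M := (shiftFunctorCompIsoId C (-1 : ℤ) 1 (by simp)).app M
  obtain ⟨ψ, hψ⟩ := (shiftFunctor C (1 : ℤ)).map_surjective (w ≫ e.inv)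
  obtain ⟨l, β, hl⟩ := h'.2 ψ
  refine ⟨l + k, ?_⟩
  rw [pow_add, mul_smul, hw, ← cancel_mono e.inv, Linear.smul_comp, Category.assoc, ← hψ,
    ← Linear.comp_smul, ← Functor.map_smul, hl, Functor.map_comp, ← Category.assoc, z₃, zero_comp, zero_comp]
end
end CategoryTheory.Pretriangulated

/-! ### Restriction to a basic open set: dévissage in the target -/

namespace DerivedDescent
open Pretriangulated Scheme.Modules DerivedCategory
section
variable {R : CommRingCat.{u}} {V : Scheme.{u}} (j : V ⟶ Spec R) [IsOpenImmersion j]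

/-- The functor `j_! j^*`. -/
noncomputable abbrev restrictSupport : DMod (Spec R) ⥤ DMod (Spec R) := pullbackD j ⋙ extendByZeroD j

/-- The canonical morphism `j_! j^* K ⟶ K`. -/
noncomputable def restrictSupportε (K : DMod (Spec R)) : (restrictSupport j).obj K ⟶ K :=
  (extendByZeroDAdjunction j).counit.app K

theorem restrictSupportε_naturality {K L : DMod (Spec R)} (φ : K ⟶ L) :
    (restrictSupport j).map φ ≫ restrictSupportε j L = restrictSupportε j K ≫ φ :=
  (extendByZeroDAdjunction j).counit.naturality φ

/-- By adjunction, the kernel in `IsLocalizationHom` consists of the morphisms that vanish on the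
image of `j`; this is the form needed for faithfulness. -/
theorem restrictSupportε_comp_eq_zero_iff {K L : DMod (Spec R)} (φ : K ⟶ L) :
    restrictSupportε j K ≫ φ = 0 ↔ (pullbackD j).map φ = 0 := by
  rw [← restrictSupportε_naturality]
  have e : (restrictSupport j).map φ ≫ restrictSupportε j L =
      ((extendByZeroDAdjunction j).homEquiv _ _).symm ((pullbackD j).map φ) :=
    (Adjunction.homEquiv_counit _ _ _ _).symm
  refine ⟨fun h ↦ ?_, fun h ↦ ?_⟩
  · apply ((extendByZeroDAdjunction j).homEquiv _ _).symm.injective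
    rw [← e, h, Adjunction.homEquiv_counit, Functor.map_zero, zero_comp]
  · change (extendByZeroD j).map ((pullbackD j).map φ) ≫ _ = 0
    rw [h, Functor.map_zero, zero_comp]

theorem exists_restrictSupportε_comp_eq {K L : DMod (Spec R)} (ψ : (restrictSupport j).obj K ⟶ L)
    (h : ∀ χ : (pullbackD j).obj K ⟶ (pullbackD j).obj L, ∃ φ, (pullbackD j).map φ = χ) :
    ∃ φ, ψ = restrictSupportε j K ≫ φ := by
  obtain ⟨φ, hφ⟩ := h ((extendByZeroDAdjunction j).homEquiv _ _ ψ)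
  refine ⟨φ, ?_⟩
  rw [← restrictSupportε_naturality]
  refine Eq.trans ?_ (Adjunction.homEquiv_counit (adj := extendByZeroDAdjunction j) ..)
  rw [hφ]
  exact (Equiv.symm_apply_apply _ _).symm

variable {j} {f : R} (hj : j.opensRange = specBasicOpen f)
include hj

/-- In different degrees `Hom(𝒪, F)` vanishes. In equal degrees a kernel element is a global section
vanishing on `D(f)`, which is torsion by quasi-coherence. Every morphism out of `j_! j^* 𝒪` extends
because `F` is flasque, so no power of `f` is needed for the cokernel. -/
theorem isLocalizationHom_of_isFlasque {F : (Spec R).Modules} (hF : quasiCoherent _ F) (hF' : F.IsFlasque) (a b : ℤ) :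
    IsLocalizationHom (restrictSupportε j) f ((singleFunctor _ a).obj (structureSheaf (Spec R)))
      ((singleFunctor _ b).obj F) := by
  refine ⟨fun β hβ ↦ ?_, fun ψ ↦ ?_⟩
  · by_cases hab : a = b
    · subst hab
      obtain ⟨g, rfl⟩ := (singleFunctor _ a).map_surjective β
      rw [restrictSupportε_comp_eq_zero_iff] at hβ
      have h : (Scheme.Modules.pullback j).map g = 0 := by
        apply (singleFunctor V.Modules a).map_injective
        rw [Functor.map_zero]
        refine (NatIso.naturality_1 (pullbackDSingle j a) g).symm.trans ?_
        change _ ≫ (pullbackD j).map ((singleFunctor _ a).map g) ≫ _ = _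
        rw [hβ, zero_comp, comp_zero]
      have h' : (restrictFunctor j).map g = 0 := by
        rw [← NatIso.naturality_2 (restrictFunctorIsoPullback j) g, h, zero_comp, comp_zero]
      have h'' : g.app (j ''ᵁ ⊤) (one _) = 0 := by
        rw [← restrictFunctor_map_app, h']
        rfl
      have e : j ''ᵁ ⊤ = specBasicOpen f := by rw [← hj]; simp
      rw [e, app_one] at h''
      obtain ⟨k, hk⟩ := exists_pow_smul_eq_zero hF f _ h''
      refine ⟨k, ?_⟩
      rw [← Functor.map_smul, unit_hom_ext (φ := f ^ k • g) (ψ := 0) (by rw [smul_hom_app, hk]; rfl), Functor.map_zero]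
    · exact ⟨0, by rw [eq_zero_of_isFlasque hF' hab β, smul_zero]⟩
  · obtain ⟨φ, hφ⟩ := exists_restrictSupportε_comp_eq j ψ (exists_pullbackD_map_eq_of_isFlasque j hF' a b)
    exact ⟨0, φ, by rw [pow_zero, one_smul, hφ]⟩

variable {n : ℤ} {A : DMod (Spec R)} {q : (singleFunctor _ n).obj (structureSheaf (Spec R)) ⟶ A}
  {δ : A ⟶ ((restrictSupport j).obj ((singleFunctor _ n).obj (structureSheaf (Spec R))))⟦(1 : ℤ)⟧}
  (hT : Triangle.mk (restrictSupportε j ((singleFunctor _ n).obj (structureSheaf (Spec R)))) q δ ∈ distTriang _)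
include hT

theorem isTorsionHom_of_isFlasque {F : (Spec R).Modules} (hF : quasiCoherent _ F) (hF' : F.IsFlasque) (m : ℤ) :
    IsTorsionHom f A ((singleFunctor _ m).obj F) :=
  isTorsionHom_of_isLocalizationHom hT (isLocalizationHom_of_isFlasque hj hF hF' n m)
    ((isLocalizationHom_of_isFlasque hj hF hF' n (m + 1)).of_iso_right
      (((singleFunctors _).shiftIso (-1) (m + 1) m (by lia)).app F).symm)

variable [IsDomain R] [IsPrincipalIdealRing R]

/-- A two-term flasque resolution `F ⟶ I ⟶ I'` exhibits `F` as an extension of `I` by `I'⟦-1⟧`. -/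
theorem isTorsionHom_of_quasiCoherent {F : (Spec R).Modules} (hF : quasiCoherent _ F) (m : ℤ) :
    IsTorsionHom f A ((singleFunctor _ m).obj F) := by
  obtain ⟨N, ⟨e⟩⟩ := exists_iso_tilde hF
  obtain ⟨S, hS, rfl, h₂, h₃⟩ := exists_isFlasque_resolution N
  obtain ⟨δ, hT'⟩ := exists_singleTriangle (shortExact_tilde hS) m
  refine IsTorsionHom.of_iso ?_ ((singleFunctor _ m).mapIso e)
  have h₃' := isTorsionHom_of_isFlasque hj hT (quasiCoherent_tilde S.X₃) h₃ (m + 1)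
  exact IsTorsionHom.obj₂ (inv_rot_of_distTriang _ hT')
    (h₃'.of_iso (((singleFunctors _).shiftIso (-1) (m + 1) m (by lia)).app _).symm)
    (isTorsionHom_of_isFlasque hj hT (quasiCoherent_tilde S.X₂) h₂ m)

theorem isTorsionHom_of_homology {M : DMod (Spec R)} (hM : Dqcoh _ M)
    (hM' : {n : ℤ | ¬ IsZero ((cohomology _ n).obj M)}.Finite) : IsTorsionHom f A M :=
  prop_of_homology (P := IsTorsionHom f A) (fun e h ↦ h.of_iso e)
    (fun _ hT ↦ IsTorsionHom.obj₂ hT) hM' fun m ↦ isTorsionHom_of_quasiCoherent hj hT (hM m) m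
end
end DerivedDescent

theorem ModuleCat.shortExact_of_exact {R : Type*} [Ring R] {N₁ N₂ N₃ : Type u} [AddCommGroup N₁] [AddCommGroup N₂]
    [AddCommGroup N₃] [Module R N₁] [Module R N₂] [Module R N₃] (g : N₁ →ₗ[R] N₂) (g' : N₂ →ₗ[R] N₃)
    (hg : Function.Injective g) (hg' : Function.Surjective g') (h : Function.Exact g g') :
    (ShortComplex.mk (ModuleCat.ofHom g) (ModuleCat.ofHom g') (by
      ext x
      exact h.apply_apply_eq_zero x)).ShortExact :=
  ShortComplex.ShortExact.mk' ((ShortComplex.moduleCat_exact_iff _).2 fun y hy ↦ (h y).1 hy)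
    ((ModuleCat.mono_iff_injective _).2 hg) ((ModuleCat.epi_iff_surjective _).2 hg')

/-! ### Restriction to a basic open set: dévissage in the source -/

namespace DerivedDescent
open Pretriangulated Scheme.Modules DerivedCategory
section
/-- The sheaf `R^~` is the structure sheaf. -/
noncomputable def tildeUnit {R : CommRingCat.{u}} : tilde (ModuleCat.of R R) ≅ structureSheaf (Spec R) := tildeSelf

variable {R : CommRingCat.{u}} [IsDomain R] [IsPrincipalIdealRing R] {V : Scheme.{u}} {j : V ⟶ Spec R} [IsOpenImmersion j]
  {f : R} (hj : j.opensRange = specBasicOpen f) {M : DMod (Spec R)} (hM : Dqcoh _ M)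
  (hM' : {n : ℤ | ¬ IsZero ((cohomology _ n).obj M)}.Finite)
include hj hM hM'

theorem isLocalizationHomShift_structureSheaf (n : ℤ) :
    IsLocalizationHomShift (restrictSupportε j) f M ((singleFunctor _ n).obj (structureSheaf (Spec R))) := by
  intro a
  refine IsLocalizationHom.of_iso (restrictSupportε_naturality j) (K := (singleFunctor _ (n - a)).obj (structureSheaf (Spec R))) ?_
    (((singleFunctors _).shiftIso a (n - a) n (by lia)).app _).symm
  obtain ⟨A, q, δ, hT⟩ := distinguished_cocone_triangle (restrictSupportε j ((singleFunctor _ (n - a)).obj (structureSheaf (Spec R))))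
  refine isLocalizationHom_of_isTorsionHom hT (isTorsionHom_of_homology hj hT hM hM')
    (isTorsionHom_of_homology hj hT (fun m ↦ ?_) ?_)
  · obtain ⟨e⟩ := nonempty_homology_shift M m 1
    exact (quasiCoherent _).prop_of_iso e.symm (hM _)
  · refine (hM'.image (fun m ↦ m - 1)).subset fun m hm ↦ ⟨1 + m, fun h ↦ hm ?_, by lia⟩
    obtain ⟨e⟩ := nonempty_homology_shift M m 1
    exact h.of_iso e

/-- For `x ≠ 0` use the triangle of `0 ⟶ R ⟶ R ⟶ R/x ⟶ 0`; for `x = 0` the quotient is `R` itself.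
-/
theorem isLocalizationHomShift_quotient (n : ℤ) (x : R) :
    IsLocalizationHomShift (restrictSupportε j) f M ((singleFunctor _ n).obj (tilde (ModuleCat.of R (R ⧸ Ideal.span {x})))) := by
  have h₀ : IsLocalizationHomShift (restrictSupportε j) f M ((singleFunctor _ n).obj (tilde (ModuleCat.of R R))) :=
    (isLocalizationHomShift_structureSheaf hj hM hM' n).of_iso (restrictSupportε_naturality j)
      ((singleFunctor _ n).mapIso tildeUnit.symm)
  by_cases hx : x = 0
  · let e : ModuleCat.of R R ≅ ModuleCat.of R (R ⧸ Ideal.span {x}) :=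
      ((Submodule.quotEquivOfEqBot _ (by rw [hx]; simp)).symm).toModuleIso
    exact IsLocalizationHomShift.of_iso (restrictSupportε_naturality j) h₀
      ((singleFunctor _ n).mapIso ((tilde.functor R).mapIso e))
  · have he : Function.Exact (LinearMap.mulLeft R x) (Submodule.mkQ (Ideal.span {x})) := by
      intro y
      rw [← LinearMap.mem_ker, Submodule.ker_mkQ, Ideal.mem_span_singleton]
      exact ⟨fun ⟨c, hc⟩ ↦ ⟨c, hc.symm⟩, fun ⟨c, hc⟩ ↦ ⟨c, hc.symm⟩⟩
    obtain ⟨δ, hT⟩ := exists_singleTriangle (shortExact_tilde (ModuleCat.shortExact_of_exact _ _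
      (mul_right_injective₀ hx) (Submodule.mkQ_surjective _) he)) n
    exact IsLocalizationHomShift.obj₃ (restrictSupportε_naturality j) hT h₀ h₀

/-- A finite module over a Noetherian ring is an iterated extension of modules `R/𝔭`, and here each
`𝔭` is principal. -/
theorem isLocalizationHomShift_tilde (n : ℤ) (N : Type u) [AddCommGroup N] [Module R N] (hN : Module.Finite R N) :
    IsLocalizationHomShift (restrictSupportε j) f M ((singleFunctor _ n).obj (tilde (ModuleCat.of R N))) := by
  induction hN using IsNoetherianRing.induction_on_isQuotientEquivQuotientPrime R with
  | subsingleton N =>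
    have z : IsZero ((singleFunctor _ n).obj (tilde (ModuleCat.of R N))) :=
      (singleFunctor _ n).map_isZero ((tilde.functor R).map_isZero (ModuleCat.isZero_of_subsingleton (ModuleCat.of R N)))
    exact fun a ↦ ⟨fun β _ ↦ ⟨0, by rw [((shiftFunctor _ a).map_isZero z).eq_of_src β 0, smul_zero]⟩, fun ψ ↦ ⟨0, 0, by
      rw [((restrictSupport j).map_isZero ((shiftFunctor _ a).map_isZero z)).eq_of_src ψ 0, smul_zero, comp_zero]⟩⟩
  | quotient N p e =>
    obtain ⟨x, hx⟩ := (IsPrincipalIdealRing.principal p.1).principal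
    exact IsLocalizationHomShift.of_iso (restrictSupportε_naturality j) (isLocalizationHomShift_quotient hj hM hM' n x)
      ((singleFunctor _ n).mapIso ((tilde.functor R).mapIso (e.trans (Submodule.quotEquivOfEq _ _ hx)).symm.toModuleIso))
  | exact N₁ N₂ N₃ g g' hg hg' he h₁ h₃ =>
    obtain ⟨δ, hT⟩ := exists_singleTriangle (shortExact_tilde (ModuleCat.shortExact_of_exact g g' hg hg' he)) n
    exact IsLocalizationHomShift.obj₂ (restrictSupportε_naturality j) hT h₁ h₃

/-- A morphism between complexes with bounded cohomology which vanishes on `D(f)` is killed by a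
power of `f`, if the source is coherent. -/
theorem exists_pow_smul_eq_zero_of_pullbackD_map_eq_zero {K : DMod (Spec R)}
    (hK : ∀ n, ∃ N : ModuleCat.{u} R, Module.Finite R N ∧ Nonempty (tilde N ≅ (cohomology _ n).obj K))
    (hK' : {n : ℤ | ¬ IsZero ((cohomology _ n).obj K)}.Finite) (φ : K ⟶ M) (hφ : (pullbackD j).map φ = 0) :
    ∃ k : ℕ, f ^ k • φ = 0 := by
  have h : IsLocalizationHomShift (restrictSupportε j) f M K :=
    prop_of_homology (P := IsLocalizationHomShift (restrictSupportε j) f M)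
      (fun e h ↦ h.of_iso (restrictSupportε_naturality j) e)
      (fun _ hT ↦ IsLocalizationHomShift.obj₂ (restrictSupportε_naturality j) hT) hK' fun n ↦ by
        obtain ⟨N, hN, ⟨e⟩⟩ := hK n
        exact (isLocalizationHomShift_tilde hj hM hM' n N hN).of_iso (restrictSupportε_naturality j)
          ((singleFunctor _ n).mapIso e)
  exact ((h 0).of_iso (restrictSupportε_naturality j) ((shiftFunctorZero _ ℤ).app K)).1 φ
    ((restrictSupportε_comp_eq_zero_iff j φ).2 hφ)

end
end DerivedDescent

/-! ### Coherent sheaves on an affine scheme and finitely generated modules -/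

namespace AlgebraicGeometry.Scheme.Modules
open DerivedDescent (structureSheaf quasiCoherent coherent)
section
variable {X Y : Scheme.{u}}

theorem res_mem_span {M : X.Modules} {T : Set Γ(M, ⊤)} {U V : X.Opens} (h : V ≤ U) {s : Γ(M, U)}
    (hs : s ∈ Submodule.span Γ(X, U) (M.res le_top '' T)) :
    M.res h s ∈ Submodule.span Γ(X, V) (M.res le_top '' T) := by
  induction hs using Submodule.span_induction with
  | mem s hs =>
    obtain ⟨t, ht, rfl⟩ := hs
    rw [res_res]
    exact Submodule.subset_span ⟨t, ht, rfl⟩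
  | zero => rw [map_zero]; exact zero_mem _
  | add s t _ _ hs ht => rw [map_add]; exact add_mem hs ht
  | smul a s _ hs => rw [res_smul]; exact Submodule.smul_mem _ _ hs

/-- The subsheaf of sections which locally are linear combinations of elements of `T`. -/
def localSpan (M : X.Modules) (T : Set Γ(M, ⊤)) : M.LocalSubmodule where
  carrier U :=
    { carrier := {s | ∀ x ∈ U, ∃ (V : X.Opens) (hV : V ≤ U), x ∈ V ∧
        M.res hV s ∈ Submodule.span Γ(X, V) (M.res le_top '' T)}
      add_mem' {a b} ha hb x hx := by
        obtain ⟨V, hV, hxV, h⟩ := ha x hx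
        obtain ⟨V', hV', hxV', h'⟩ := hb x hx
        refine ⟨V ⊓ V', inf_le_left.trans hV, ⟨hxV, hxV'⟩, ?_⟩
        rw [map_add, ← M.res_res hV inf_le_left a, ← M.res_res hV' inf_le_right b]
        exact add_mem (res_mem_span _ h) (res_mem_span _ h')
      zero_mem' x hx := ⟨U, le_rfl, hx, by rw [map_zero]; exact zero_mem _⟩
      smul_mem' a b hb x hx := by
        obtain ⟨V, hV, hxV, h⟩ := hb x hx
        exact ⟨V, hV, hxV, by rw [res_smul]; exact Submodule.smul_mem _ _ h⟩ }
  res_mem {U V} h s hs x hx := by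
    obtain ⟨W, hW, hxW, h'⟩ := hs x (h hx)
    refine ⟨V ⊓ W, inf_le_left, ⟨hx, hxW⟩, ?_⟩
    rw [res_res, ← M.res_res hW inf_le_right]
    exact res_mem_span _ h'
  mem_of_local {U s} h x hx := by
    obtain ⟨V, hV, hxV, hs⟩ := h x hx
    obtain ⟨W, hW, hxW, h'⟩ := hs x hxV
    exact ⟨W, hW.trans hV, hxW, by rwa [res_res] at h'⟩

/-- `M` is generated by the global sections in `T`. -/
def IsGeneratedBy (M : X.Modules) (T : Set Γ(M, ⊤)) : Prop :=
  ∀ (U : X.Opens) (s : Γ(M, U)), s ∈ (M.localSpan T).carrier U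

theorem LocalSubmodule.app_mem {M : X.Modules} (P : M.LocalSubmodule) (φ : structureSheaf X ⟶ M)
    (h : φ.app ⊤ (one ⊤) ∈ P.carrier ⊤) (U : X.Opens) (a : Γ(structureSheaf X, U)) :
    φ.app U a ∈ P.carrier U := by
  have e := smul_one U (show Γ(X, U) from a)
  change φ.app U (show Γ(structureSheaf X, U) from (show Γ(X, U) from a)) ∈ _
  rw [← e, Hom.app_smul, app_one]
  exact Submodule.smul_mem _ _ (P.res_mem _ h)

/-- The morphism `𝒪_X ⟶ M` given by a generating section. -/
noncomputable def generatorHom {M : X.Modules} (σ : SheafOfModules.GeneratingSections.{u} (R := X.ringCatSheaf) M)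
    (i : σ.I) : structureSheaf X ⟶ M :=
  (SheafOfModules.unitHomEquiv (R := X.ringCatSheaf) M).symm (σ.s i)

/-- The epimorphism from the free sheaf factors through the subsheaf locally spanned by the
generators, whose inclusion is therefore an isomorphism. -/
theorem isGeneratedBy_generatingSections (M : X.Modules) (σ : SheafOfModules.GeneratingSections.{u} (R := X.ringCatSheaf) M) :
    M.IsGeneratedBy (Set.range fun i ↦ (generatorHom σ i).app ⊤ (one ⊤)) := by
  let P := M.localSpan (Set.range fun i ↦ (generatorHom σ i).app ⊤ (one ⊤))
  let l (i : σ.I) : structureSheaf X ⟶ P.toModules :=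
    P.lift (generatorHom σ i) (P.app_mem _ fun x hx ↦ ⟨⊤, le_rfl, hx, Submodule.subset_span ⟨_, ⟨i, rfl⟩, rfl⟩⟩)
  let Λ : SheafOfModules.free (R := X.ringCatSheaf) σ.I ⟶ P.toModules :=
    Cofan.IsColimit.desc (SheafOfModules.isColimitFreeCofan σ.I) l
  have hΛ : Λ ≫ P.ι = σ.π := by
    refine Cofan.IsColimit.hom_ext (SheafOfModules.isColimitFreeCofan σ.I) _ _ fun i ↦ ?_
    have h₁ : (SheafOfModules.freeCofan σ.I).inj i ≫ Λ = l i :=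
      Cofan.IsColimit.fac (SheafOfModules.isColimitFreeCofan σ.I) l i
    have h₂ : (SheafOfModules.freeCofan σ.I).inj i ≫ σ.π = generatorHom σ i :=
      Cofan.IsColimit.fac (SheafOfModules.isColimitFreeCofan σ.I)
        (fun i ↦ (SheafOfModules.unitHomEquiv (R := X.ringCatSheaf) M).symm (σ.s i)) i
    rw [h₂]
    exact (Category.assoc _ _ _).symm.trans (congrArg (· ≫ P.ι) h₁)
  have : Epi (Λ ≫ P.ι) := by
    rw [hΛ]
    exact σ.epi
  have : Epi P.ι := epi_of_epi Λ P.ι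
  have : IsIso P.ι := isIso_of_mono_of_epi _
  intro U s
  obtain ⟨t, rfl⟩ : ∃ t, P.ι.app U t = s :=
    ⟨(inv P.ι).app U s, by rw [← comp_app_apply, IsIso.inv_hom_id]; rfl⟩
  exact P.ι_app_mem t

theorem exists_generatingSections (M : X.Modules) (hM : M.IsFiniteType) (x : X) :
    ∃ (W : X.Opens) (σ : SheafOfModules.GeneratingSections.{u} (R := (W : Scheme.{u}).ringCatSheaf) ((restrictFunctor W.ι).obj M)),
      x ∈ W ∧ Finite σ.I := by
  obtain ⟨⟨I, V, cov, pres⟩, hfin⟩ := SheafOfModules.IsFiniteType.exists_localGeneratorsData M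
  rw [Opens.coversTop_iff, IsOpenCover] at cov
  obtain ⟨i, hi⟩ : ∃ i, x ∈ V i := by
    have : x ∈ ⨆ i, V i := cov ▸ trivial
    simpa using this
  let F : SheafOfModules.{u} (X.ringCatSheaf.over (V i)) ⥤ SheafOfModules.{u} (V i : Scheme.{u}).ringCatSheaf :=
    (overEquiv (V i)).functor
  have : PreservesColimitsOfSize.{u, u} F := (overEquiv (V i)).toAdjunction.leftAdjoint_preservesColimits
  have e : IsIso (C := SheafOfModules.{u} (V i : Scheme.{u}).ringCatSheaf) ((overFunctorEquiv (V i)).hom.app M) :=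
    ((overFunctorEquiv (V i)).app M).isIso_hom
  have e' : Epi (C := SheafOfModules.{u} (V i : Scheme.{u}).ringCatSheaf) ((overFunctorEquiv (V i)).hom.app M) :=
    IsIso.epi_of_iso _
  refine ⟨V i, SheafOfModules.GeneratingSections.ofEpi
      ((pres i).map F (Iso.refl _))
      ((overFunctorEquiv (V i)).hom.app M), hi, ?_⟩
  have : (pres i).IsFiniteType := hfin.isFiniteType i
  exact (inferInstanceAs (Finite (pres i).I))

/-- The section `s` is, near `y`, in the image of `φ`. -/
def InImageAt {N M : X.Modules} (φ : N ⟶ M) {U : X.Opens} (s : Γ(M, U)) (y : X) : Prop :=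
  ∃ (V : X.Opens) (hV : V ≤ U), y ∈ V ∧ ∃ n : Γ(N, V), φ.app V n = M.res hV s

theorem InImageAt.of_res {N M : X.Modules} {φ : N ⟶ M} {U V : X.Opens} {hV : V ≤ U} {s : Γ(M, U)} {y : X}
    (h : InImageAt φ (M.res hV s) y) : InImageAt φ s y := by
  obtain ⟨W, hW, hy, n, hn⟩ := h
  exact ⟨W, hW.trans hV, hy, n, by rw [hn, res_res]⟩

theorem InImageAt.res {N M : X.Modules} {φ : N ⟶ M} {U V : X.Opens} (hV : V ≤ U) {s : Γ(M, U)} {y : X}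
    (h : InImageAt φ s y) (hy : y ∈ V) : InImageAt φ (M.res hV s) y := by
  obtain ⟨W, hW, hyW, n, hn⟩ := h
  exact ⟨V ⊓ W, inf_le_left, ⟨hy, hyW⟩, N.res inf_le_right n, by rw [app_res, hn, res_res, res_res]⟩

theorem IsGeneratedBy.inImageAt {M N : X.Modules} {T : Set Γ(M, ⊤)} (h : M.IsGeneratedBy T) (φ : N ⟶ M) (y : X)
    (hT : ∀ t ∈ T, InImageAt φ t y) {U : X.Opens} (s : Γ(M, U)) (hy : y ∈ U) : InImageAt φ s y := by
  obtain ⟨V, hV, hyV, hs⟩ := h U s y hy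
  refine InImageAt.of_res (hV := hV) ?_
  generalize M.res hV s = s' at hs
  induction hs using Submodule.span_induction with
  | mem s hs =>
    obtain ⟨t, ht, rfl⟩ := hs
    exact (hT t ht).res _ hyV
  | zero => exact ⟨V, le_rfl, hyV, 0, by rw [map_zero, map_zero]⟩
  | add s t _ _ hs ht =>
    obtain ⟨W, hW, hyW, n, hn⟩ := hs
    obtain ⟨W', hW', hyW', n', hn'⟩ := ht
    refine ⟨W ⊓ W', inf_le_left.trans hW, ⟨hyW, hyW'⟩, N.res inf_le_left n + N.res inf_le_right n', ?_⟩
    rw [map_add, map_add, app_res, app_res, hn, hn', res_res, res_res]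
  | smul a s _ hs =>
    obtain ⟨W, hW, hyW, n, hn⟩ := hs
    exact ⟨W, hW, hyW, X.presheaf.map (homOfLE hW).op a • n, by rw [Hom.app_smul, hn, res_smul]⟩

theorem InImageAt.restrict {V X : Scheme.{u}} (j : V ⟶ X) [IsOpenImmersion j] {M N : X.Modules} {φ : N ⟶ M}
    {U : X.Opens} {s : Γ(M, U)} {y : V} (h : InImageAt φ s (j y)) {W : V.Opens} (hW : j ''ᵁ W ≤ U) (hy : y ∈ W) :
    InImageAt (M := (restrictFunctor j).obj M) ((restrictFunctor j).map φ) (U := W) (M.res hW s) y := by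
  obtain ⟨V, hV, hyV, n, hn⟩ := h
  have hV' : j ''ᵁ (W ⊓ j ⁻¹ᵁ V) ≤ V := (j.image_mono inf_le_right).trans (j.image_preimage_le V)
  have e : φ.app _ (N.res hV' n) = M.res (j.image_mono (inf_le_left : W ⊓ j ⁻¹ᵁ V ≤ W)) (M.res hW s) := by
    rw [app_res, hn, res_res, res_res]
  exact ⟨W ⊓ j ⁻¹ᵁ V, inf_le_left, ⟨hy, hyV⟩, N.res hV' n, e⟩

theorem InImageAt.of_restrict {V X : Scheme.{u}} (j : V ⟶ X) [IsOpenImmersion j] {M N : X.Modules} {φ : N ⟶ M}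
    {W : V.Opens} {s : Γ(M, j ''ᵁ W)} {y : V}
    (h : InImageAt (M := (restrictFunctor j).obj M) ((restrictFunctor j).map φ) (U := W) s y) :
    InImageAt φ s (j y) := by
  obtain ⟨V, hV, hyV, n, hn⟩ := h
  exact ⟨j ''ᵁ V, j.image_mono hV, ⟨y, hyV, rfl⟩, n, hn⟩

/-- Restates finite type as a test for morphisms of sheaves on the whole of `X`: near points of `W`,
surjectivity needs checking only on the finitely many sections in `T`. -/
theorem exists_finite_inImageAt (M : X.Modules) (hM : M.IsFiniteType) (x : X) :
    ∃ (W : X.Opens) (T : Set Γ(M, W)), x ∈ W ∧ T.Finite ∧ ∀ {N : X.Modules} (φ : N ⟶ M), ∀ y ∈ W,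
      (∀ t ∈ T, InImageAt φ t y) → ∀ {U : X.Opens} (s : Γ(M, U)), y ∈ U → InImageAt φ s y := by
  obtain ⟨W, σ, hx, hσ⟩ := exists_generatingSections M hM x
  have hW : W.ι ''ᵁ ⊤ = W := by simp
  have hgen := isGeneratedBy_generatingSections _ σ
  have hfin : (Set.range fun i ↦ (generatorHom (M := (restrictFunctor W.ι).obj M) σ i).app ⊤ (one ⊤)).Finite :=
    Set.finite_range _
  generalize (Set.range fun i ↦ (generatorHom (M := (restrictFunctor W.ι).obj M) σ i).app ⊤ (one ⊤)) = T at hgen hfin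
  refine ⟨W.ι ''ᵁ ⊤, T, hW.ge hx, hfin, ?_⟩
  intro N φ y hy hT U s hyU
  obtain ⟨y, -, rfl⟩ := hy
  have h := hgen.inImageAt ((restrictFunctor W.ι).map φ) y (fun t ht ↦ by
    have h' := (hT t ht).restrict W.ι (W := ⊤) le_rfl trivial
    have e : M.res (le_refl (W.ι ''ᵁ ⊤)) t = t := M.res_self _ t
    exact e ▸ h') (U := W.ι ⁻¹ᵁ U) (M.res (W.ι.image_preimage_le U) s) hyU
  exact InImageAt.of_res (h.of_restrict W.ι)
end

section
variable {R : CommRingCat.{u}}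

/-- Coherent sheaves on `Spec R` correspond to finitely generated modules. -/
theorem exists_finite_iso_tilde {M : (Spec R).Modules} (hM : coherent _ M) :
    ∃ N : ModuleCat.{u} R, Module.Finite R N ∧ Nonempty (tilde N ≅ M) := by
  obtain ⟨N, ⟨e⟩⟩ := exists_iso_tilde hM.1
  refine ⟨N, ?_, ⟨e⟩⟩
  choose W T hxW hT h using exists_finite_inImageAt M hM.2
  have hf (x : Spec R) : ∃ f : R, x ∈ specBasicOpen f ∧ specBasicOpen f ≤ W x := by
    obtain ⟨_, ⟨_, ⟨f, rfl⟩, rfl⟩, hxf, hf⟩ := _root_.PrimeSpectrum.isBasis_basic_opens.exists_subset_of_mem_open (hxW x) (W x).isOpen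
    exact ⟨f, hxf, hf⟩
  choose f hxf hfW using hf
  -- On `D(f x)`, a power of `f x` times each local generator comes from an element of `N`.
  have hn (x : Spec R) (t : Γ(M, W x)) : ∃ (k : ℕ) (n : N),
      M.res le_top (e.hom.app ⊤ (toSection n)) = (f x) ^ k • M.res (hfW x) t := by
    obtain ⟨k, s, hs⟩ := exists_res_eq_pow_smul hM.1 (f x) (M.res (hfW x) t)
    obtain ⟨n, hn⟩ := toSection_bijective.2 (e.inv.app ⊤ s)
    refine ⟨k, n, ?_⟩
    rw [hn, ← comp_app_apply, e.inv_hom_id, ← hs]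
    rfl
  choose k n hn using hn
  -- By compactness finitely many such elements suffice; the submodule `N'` that they span is shown
  -- to be all of `N`.
  obtain ⟨A, hA⟩ := isCompact_univ.elim_finite_subcover (fun x : Spec R ↦ (specBasicOpen (f x) : Set (Spec R)))
    (fun x ↦ (specBasicOpen (f x)).isOpen) (fun x _ ↦ Set.mem_iUnion.2 ⟨x, hxf x⟩)
  let G : Set N := ⋃ x ∈ A, n x '' T x
  have hG : G.Finite := A.finite_toSet.biUnion fun x _ ↦ (hT x).image _
  let N' := Submodule.span R G
  let g : ModuleCat.of R N' ⟶ N := ModuleCat.ofHom N'.subtype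
  have hs : LocallySurjective (tilde.map g ≫ e.hom) := by
    intro U s y hy
    obtain ⟨x, hxA, hyx⟩ : ∃ x ∈ A, y ∈ specBasicOpen (f x) := by simpa using hA (Set.mem_univ y)
    refine h x _ y (hfW x hyx) (fun t ht ↦ ?_) s hy
    refine InImageAt.of_res (hV := hfW x) ⟨specBasicOpen (f x), le_rfl, hyx, ?_⟩
    let n' : N' := ⟨n x t, Submodule.subset_span (Set.mem_biUnion hxA ⟨t, ht, rfl⟩)⟩
    -- `f x` acts invertibly on sections over `D(f x)`, so the section given by `n'` can be divided
    -- by the power of `f x`, which produces a preimage of `t`.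
    have hu := ((tilde (ModuleCat.of R N')).isUnit_algebraMap_end_of_le_basicOpen (U := specBasicOpen (f x)) (f x) le_rfl).pow (k x t)
    obtain ⟨m, hm⟩ := ((Module.End.isUnit_iff _).1 hu).2 ((tilde (ModuleCat.of R N')).res le_top (toSection (N := ModuleCat.of R N') n'))
    rw [← map_pow, Module.algebraMap_end_apply] at hm
    refine ⟨m, ?_⟩
    rw [res_self]
    refine sub_eq_zero.1 (eq_zero_of_pow_smul_eq_zero (f x) (k x t) ?_)
    rw [smul_sub, ← hn, ← app_smul_Spec, hm, app_res, sub_eq_zero]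
    congr 1
    rw [comp_app_apply, tilde_map_app_toSection]
    rfl
  have hep := hs.epi
  have : Epi (tilde.map g) := by
    have e' : tilde.map g = (tilde.map g ≫ e.hom) ≫ e.inv := by simp
    rw [e']
    infer_instance
  have : Epi g := (tilde.functor R).epi_of_epi_map (f := g) this
  have : Module.Finite R N' := Module.Finite.iff_fg.2 ⟨hG.toFinset, by simp [N']⟩
  exact Module.Finite.of_surjective g.hom ((ModuleCat.epi_iff_surjective g).1 inferInstance)
end
end AlgebraicGeometry.Scheme.Modules

/-! ### Faithfulness for bounded coherent complexes -/

namespace DerivedDescent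
open Scheme.Modules
section
variable {R : CommRingCat.{u}} [IsDomain R] [IsPrincipalIdealRing R]

/-- `φ` is killed by a power of `f₁` and by a power of `f₂`, and these powers generate the unit
ideal. -/
theorem eq_zero_of_isCoprime {V₁ V₂ : Scheme.{u}} {j₁ : V₁ ⟶ Spec R} {j₂ : V₂ ⟶ Spec R} [IsOpenImmersion j₁]
    [IsOpenImmersion j₂] {f₁ f₂ : R} (hj₁ : j₁.opensRange = specBasicOpen f₁) (hj₂ : j₂.opensRange = specBasicOpen f₂)
    (hf : IsCoprime f₁ f₂) {K M : DMod (Spec R)} (hK : Dbcoh _ K) (hM : Dbcoh _ M) (φ : K ⟶ M)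
    (h₁ : (pullbackD j₁).map φ = 0) (h₂ : (pullbackD j₂).map φ = 0) : φ = 0 := by
  obtain ⟨n₁, h₁⟩ := exists_pow_smul_eq_zero_of_pullbackD_map_eq_zero hj₁ (fun n ↦ (hM.1 n).1) hM.2
    (fun n ↦ exists_finite_iso_tilde (hK.1 n)) hK.2 φ h₁
  obtain ⟨n₂, h₂⟩ := exists_pow_smul_eq_zero_of_pullbackD_map_eq_zero hj₂ (fun n ↦ (hM.1 n).1) hM.2
    (fun n ↦ exists_finite_iso_tilde (hK.1 n)) hK.2 φ h₂
  obtain ⟨a, b, hab⟩ := hf.pow (m := n₁) (n := n₂)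
  rw [← one_smul R φ, ← hab, add_smul, mul_smul, mul_smul, h₁, h₂, smul_zero, smul_zero, add_zero]
end
end DerivedDescent

/-! ### Coherence is local -/

namespace AlgebraicGeometry.Scheme.Modules
open DerivedDescent (structureSheaf quasiCoherent coherent)
noncomputable section
variable {X V : Scheme.{u}}

/-- Sheaves of modules on an open subscheme, as sheaves on the site over its image. -/
def overRange (j : V ⟶ X) [IsOpenImmersion j] : SheafOfModules.{u} V.ringCatSheaf ⥤
    SheafOfModules.{u} (X.ringCatSheaf.over j.opensRange) :=
  restrictFunctor j.isoOpensRange.inv ⋙ (overEquiv j.opensRange).inverse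

theorem preservesColimits_overRange (j : V ⟶ X) [IsOpenImmersion j] :
    PreservesColimitsOfSize.{u, u} (overRange j) := by
  have h {W : Scheme.{u}} (i : (W : Scheme.{u}) ⟶ V) [IsOpenImmersion i] : PreservesColimitsOfSize.{u, u} (restrictFunctor i) :=
    inferInstance
  have : PreservesColimitsOfSize.{u, u} (restrictFunctor j.isoOpensRange.inv ⋙ (overEquiv j.opensRange).inverse) := by
    have := h j.isoOpensRange.inv
    exact comp_preservesColimits _ _
  exact this

def overRangeUnit (j : V ⟶ X) [IsOpenImmersion j] :
    SheafOfModules.unit (X.ringCatSheaf.over j.opensRange) ≅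
      (overRange j).obj (SheafOfModules.unit V.ringCatSheaf) :=
  (overEquiv j.opensRange).unitIso.app _ ≪≫
    (overEquiv j.opensRange).inverse.mapIso (restrictUnitIso j.isoOpensRange.inv).symm

def restrictOverRange (j : V ⟶ X) [IsOpenImmersion j] :
    restrictFunctor j ⋙ overRange j ≅ SheafOfModules.overFunctor X.ringCatSheaf j.opensRange :=
  (Functor.associator _ _ _).symm ≪≫
  Functor.isoWhiskerRight ((restrictFunctorComp j.isoOpensRange.inv j).symm ≪≫
    restrictFunctorCongr (Scheme.Hom.isoOpensRange_inv_comp j) ≪≫ (overFunctorEquiv j.opensRange).symm)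
    (overEquiv j.opensRange).inverse ≪≫
  Functor.associator _ _ _ ≪≫
    Functor.isoWhiskerLeft (SheafOfModules.overFunctor X.ringCatSheaf j.opensRange) (overEquiv j.opensRange).unitIso.symm ≪≫
    Functor.rightUnitor _

theorem isIso_restrictOverRange (j : V ⟶ X) [IsOpenImmersion j] (M : X.Modules) :
    IsIso (C := SheafOfModules.{u} (X.ringCatSheaf.over j.opensRange)) ((restrictOverRange j).hom.app M) :=
  ((restrictOverRange j).app M).isIso_hom

theorem coversTop_opensRange {V : X → Scheme.{u}} (j : ∀ x, V x ⟶ X) [∀ x, IsOpenImmersion (j x)]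
    (hx : ∀ x, x ∈ (j x).opensRange) : (Opens.grothendieckTopology X).CoversTop fun x ↦ (j x).opensRange := by
  rw [Opens.coversTop_iff, IsOpenCover, eq_top_iff]
  exact fun x _ ↦ Opens.mem_iSup.2 ⟨x, hx x⟩

theorem isQuasicoherent_of_presentation (M : X.Modules) {V : X → Scheme.{u}} (j : ∀ x, V x ⟶ X) [∀ x, IsOpenImmersion (j x)]
    (hx : ∀ x, x ∈ (j x).opensRange) (P : ∀ x, SheafOfModules.Presentation.{u} (R := (V x).ringCatSheaf) ((restrictFunctor (j x)).obj M)) :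
    M.IsQuasicoherent := by
  have := fun x ↦ preservesColimits_overRange (j x)
  have := fun x ↦ isIso_restrictOverRange (j x) M
  suffices q : SheafOfModules.QuasicoherentData.{u, u, u, u} (R := X.ringCatSheaf) M from q.isQuasicoherent
  refine { I := X, X := fun x ↦ (j x).opensRange, coversTop := coversTop_opensRange j hx, presentation := fun x ↦ ?_ }
  exact SheafOfModules.Presentation.ofIsIso ((restrictOverRange (j x)).hom.app M)
    ((P x).map (overRange (j x)) (overRangeUnit _))

theorem isFiniteType_of_generatingSections (M : X.Modules) {V : X → Scheme.{u}} (j : ∀ x, V x ⟶ X) [∀ x, IsOpenImmersion (j x)]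
    (hx : ∀ x, x ∈ (j x).opensRange) (σ : ∀ x, SheafOfModules.GeneratingSections.{u} (R := (V x).ringCatSheaf) ((restrictFunctor (j x)).obj M))
    (hσ : ∀ x, Finite (σ x).I) : M.IsFiniteType := by
  have := fun x ↦ preservesColimits_overRange (j x)
  have := fun x ↦ isIso_restrictOverRange (j x) M
  let q : SheafOfModules.LocalGeneratorsData.{u, u, u, u} (R := X.ringCatSheaf) M :=
    { I := X
      X := fun x ↦ (j x).opensRange
      coversTop := coversTop_opensRange j hx
      generators := fun x ↦ SheafOfModules.GeneratingSections.ofEpi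
        ((σ x).map (overRange (j x)) (overRangeUnit _)) ((restrictOverRange (j x)).hom.app M) }
  exact SheafOfModules.IsFiniteType.mk (R := X.ringCatSheaf)
    ⟨q, SheafOfModules.LocalGeneratorsData.IsFiniteType.mk (p := q) fun x ↦
      SheafOfModules.GeneratingSections.IsFiniteType.mk (hσ x)⟩

/-- Coherence is a local property. -/
theorem coherent_of_pullback (M : X.Modules)
    (h : ∀ x : X, ∃ (V : Scheme.{u}) (j : V ⟶ X) (_ : IsOpenImmersion j), x ∈ j.opensRange ∧
      coherent V ((pullback j).obj M)) : coherent X M := by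
  choose V j hj hx h using h
  have hr (x : X) : coherent (V x) ((restrictFunctor (j x)).obj M) :=
    DerivedDescent.coherent_of_iso ((restrictFunctorIsoPullback (j x)).symm.app M) (h x)
  choose y hy using hx
  constructor
  · have hP (x : X) : ∃ (W : (V x).Opens), y x ∈ W ∧
        Nonempty (SheafOfModules.Presentation.{u} (R := (W : Scheme.{u}).ringCatSheaf)
          ((restrictFunctor (W.ι ≫ j x)).obj M)) := by
      have := (hr x).1
      obtain ⟨ι, U, P, hU, -⟩ := ((restrictFunctor (j x)).obj M).exists_isOpenCover_presentation
      obtain ⟨i, hi⟩ : ∃ i, y x ∈ U i := by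
        have : y x ∈ ⨆ i, U i := by rw [hU]; trivial
        simpa using this
      have e : IsIso (C := SheafOfModules.{u} ((U i : Scheme.{u})).ringCatSheaf)
          ((restrictFunctorComp (U i).ι (j x)).inv.app M) :=
        ((restrictFunctorComp (U i).ι (j x)).symm.app M).isIso_hom
      exact ⟨U i, hi, ⟨SheafOfModules.Presentation.ofIsIso ((restrictFunctorComp (U i).ι (j x)).inv.app M) (P i)⟩⟩
    choose W hW P using hP
    exact isQuasicoherent_of_presentation M (fun x ↦ (W x).ι ≫ j x) (fun x ↦ ⟨⟨y x, hW x⟩, hy x⟩) (fun x ↦ (P x).some)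
  · have hP (x : X) : ∃ (W : (V x).Opens) (σ : SheafOfModules.GeneratingSections.{u} (R := (W : Scheme.{u}).ringCatSheaf)
          ((restrictFunctor (W.ι ≫ j x)).obj M)), y x ∈ W ∧ Finite σ.I := by
      obtain ⟨W, σ, hW, hσ⟩ := exists_generatingSections _ (hr x).2 (y x)
      have e : IsIso (C := SheafOfModules.{u} ((W : Scheme.{u})).ringCatSheaf)
          ((restrictFunctorComp W.ι (j x)).inv.app M) :=
        ((restrictFunctorComp W.ι (j x)).symm.app M).isIso_hom
      have e' : Epi (C := SheafOfModules.{u} ((W : Scheme.{u})).ringCatSheaf)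
          ((restrictFunctorComp W.ι (j x)).inv.app M) := IsIso.epi_of_iso _
      exact ⟨W, σ.ofEpi ((restrictFunctorComp W.ι (j x)).inv.app M), hW, hσ⟩
    choose W σ hW hσ using hP
    exact isFiniteType_of_generatingSections M (fun x ↦ (W x).ι ≫ j x) (fun x ↦ ⟨⟨y x, hW x⟩, hy x⟩) σ hσ
end
end AlgebraicGeometry.Scheme.Modules

/-! ### The equivalence on bounded coherent complexes -/

namespace DerivedDescent
open Scheme.Modules
section
variable {X S : Scheme.{u}} {p : X ⟶ S} [IsLocalIso p]

theorem Dbcoh_of_iso {K L : DMod X} (e : K ≅ L) (h : Dbcoh X K) : Dbcoh X L :=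
  ⟨fun n ↦ coherent_of_iso ((cohomology X n).mapIso e) (h.1 n),
    h.2.subset fun n hn hz ↦ hn (hz.of_iso ((cohomology X n).mapIso e).symm)⟩

theorem DescentDatum.isIso_of_isIso_hom {A B : DescentDatum p} (Φ : A ⟶ B) (h : IsIso Φ.hom) : IsIso Φ := by
  refine ⟨⟨inv Φ.hom, ?_⟩, Hom.ext (IsIso.hom_inv_id Φ.hom), Hom.ext (IsIso.inv_hom_id Φ.hom)⟩
  rw [Functor.map_inv, Functor.map_inv, IsIso.inv_comp_eq, ← Category.assoc, IsIso.eq_comp_inv]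
  exact Φ.comm.symm

variable (h : ∀ x : S, ∃ (V : Scheme.{u}) (i : V ⟶ X) (j : V ⟶ S) (_ : IsOpenImmersion i)
    (_ : IsOpenImmersion j), i ≫ p = j ∧ x ∈ j.opensRange)
include h

omit [IsLocalIso p] in
theorem isZero_of_isZero_pullback {M : S.Modules} (hz : IsZero ((Scheme.Modules.pullback p).obj M)) : IsZero M := by
  refine Scheme.Modules.isZero_iff_forall_vanishesAt.2 fun x ↦ ?_
  obtain ⟨V, i, j, hi, hj, w, hx⟩ := h x
  exact (Scheme.Modules.isZero_pullback_iff j _).1 (((Scheme.Modules.pullback i).map_isZero hz).of_iso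
    ((pullbackComp i p j w).symm.app _)) x hx

/-- Coherence and vanishing of cohomology sheaves are local on `S`, and `S` is covered by open
subschemes which factor through `X`. -/
theorem Dbcoh_of_pullbackD {H : DMod S} (hH : Dbcoh X ((pullbackD p).obj H)) : Dbcoh S H := by
  have hc (n : ℤ) : coherent X ((Scheme.Modules.pullback p).obj ((cohomology S n).obj H)) := by
    obtain ⟨e⟩ := nonempty_homology_pullbackD p H n
    exact coherent_of_iso e (hH.1 n)
  refine ⟨fun n ↦ coherent_of_pullback _ fun x ↦ ?_, hH.2.subset fun n hn hz ↦ hn ?_⟩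
  · obtain ⟨V, i, j, hi, hj, w, hx⟩ := h x
    exact ⟨V, j, hj, hx, coherent_of_iso ((pullbackComp i p j w).app _)
      ⟨isQuasicoherent_pullback i _ (hc n).1, isFiniteType_pullback i _ (hc n).2⟩⟩
  · obtain ⟨e⟩ := nonempty_homology_pullbackD p H n
    exact isZero_of_isZero_pullback h (hz.of_iso e.symm)
end

section
variable {R : CommRingCat.{u}} [IsDomain R] [IsPrincipalIdealRing R] {X U₁ U₂ : Scheme.{u}} {p : X ⟶ Spec R} [IsLocalIso p]
  {i₁ : U₁ ⟶ X} {i₂ : U₂ ⟶ X} {j₁ : U₁ ⟶ Spec R} {j₂ : U₂ ⟶ Spec R} [IsOpenImmersion i₁] [IsOpenImmersion i₂]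
  [IsOpenImmersion j₁] [IsOpenImmersion j₂] {f₁ f₂ : R}

/-- Fullness and the gluing of objects are inherited from all of `D(𝒪)`; coherence and boundedness
enter through faithfulness, and through the check that the glued object stays in the subcategory. -/
theorem isEquivalence_comparisonDbcoh (w₁ : i₁ ≫ p = j₁) (w₂ : i₂ ≫ p = j₂) (h : i₁.opensRange ⊓ i₂.opensRange = ⊥)
    (h' : i₁.opensRange ⊔ i₂.opensRange = ⊤) (hj₁ : j₁.opensRange = specBasicOpen f₁)
    (hj₂ : j₂.opensRange = specBasicOpen f₂) (hf : IsCoprime f₁ f₂) (hj : j₁.opensRange ⊔ j₂.opensRange = ⊤) :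
    (comparisonDbcoh p).IsEquivalence := by
  have hcov (x : Spec R) : ∃ (V : Scheme.{u}) (i : V ⟶ X) (j : V ⟶ Spec R) (_ : IsOpenImmersion i)
      (_ : IsOpenImmersion j), i ≫ p = j ∧ x ∈ j.opensRange := by
    have hx : x ∈ j₁.opensRange ⊔ j₂.opensRange := hj ▸ trivial
    rcases hx with hx | hx
    · exact ⟨_, i₁, j₁, inferInstance, inferInstance, w₁, hx⟩
    · exact ⟨_, i₂, j₂, inferInstance, inferInstance, w₂, hx⟩
  have : (DescentDatum.comparison p).Full := comparison_full p w₁ w₂ h h' hj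
  have : (comparisonDbcoh p).Full := by
    have : ((Dbcoh (Spec R)).ι ⋙ DescentDatum.comparison p).Full := inferInstance
    exact ⟨fun {K L} f ↦ by
      obtain ⟨g, hg⟩ := ((Dbcoh (Spec R)).ι ⋙ DescentDatum.comparison p).map_surjective f.hom
      exact ⟨g, ObjectProperty.hom_ext _ hg⟩⟩
  have : (comparisonDbcoh p).Faithful := ⟨fun {K L φ ψ} e ↦ by
    have e' : (pullbackD p).map (φ.hom - ψ.hom) = 0 := by
      rw [Functor.map_sub, sub_eq_zero]
      exact congrArg (fun a ↦ a.hom.hom) e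
    exact ObjectProperty.hom_ext _ (sub_eq_zero.1 (eq_zero_of_isCoprime hj₁ hj₂ hf K.property L.property _
      (pullbackD_map_eq_zero_of_comp p w₁ _ e') (pullbackD_map_eq_zero_of_comp p w₂ _ e')))⟩
  have : (comparisonDbcoh p).EssSurj := ⟨fun D ↦ by
    obtain ⟨H, Φ, hΦ⟩ := exists_comparison_obj_iso p w₁ w₂ h h' D.obj
    have hH : Dbcoh _ H := Dbcoh_of_pullbackD hcov
      (Dbcoh_of_iso (@asIso _ _ _ _ Φ.hom hΦ) D.property)
    exact ⟨⟨H, hH⟩, ⟨ObjectProperty.isoMk _ (@asIso _ _ _ _ Φ (DescentDatum.isIso_of_isIso_hom Φ hΦ)).symm⟩⟩⟩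
  exact { }
end
end DerivedDescent

/-! ### Closed points of a principal ideal spectrum and idempotents divisible by powers -/

theorem PrimeSpectrum.exists_compl_singleton_eq_basicOpen {R : Type*} [CommRing R] [IsPrincipalIdealRing R] (P : PrimeSpectrum R)
    (hP : IsClosed {P}) : ∃ f : R, P.asIdeal = Ideal.span {f} ∧ ({P}ᶜ : Set (PrimeSpectrum R)) = PrimeSpectrum.basicOpen f := by
  obtain ⟨f, hf⟩ := (IsPrincipalIdealRing.principal P.asIdeal).principal
  have hm : P.asIdeal.IsMaximal := (PrimeSpectrum.isClosed_singleton_iff_isMaximal P).1 hP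
  refine ⟨f, hf, Set.ext fun x ↦ ?_⟩
  have e : f ∈ x.asIdeal ↔ x = P := by
    rw [← Ideal.span_singleton_le_iff_mem]
    refine ⟨fun h ↦ PrimeSpectrum.ext (hm.eq_of_le x.isPrime.ne_top (hf.le.trans h)).symm, ?_⟩
    rintro rfl
    exact hf.ge
  simp [e]

theorem PrimeSpectrum.isCoprime_of_asIdeal_eq_span {R : Type*} [CommRing R] {P Q : PrimeSpectrum R} (hP : IsClosed {P})
    (hQ : IsClosed {Q}) (h : P ≠ Q) {f g : R} (hf : P.asIdeal = Ideal.span {f}) (hg : Q.asIdeal = Ideal.span {g}) :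
    IsCoprime f g := by
  have hm := (PrimeSpectrum.isClosed_singleton_iff_isMaximal P).1 hP
  have hm' := (PrimeSpectrum.isClosed_singleton_iff_isMaximal Q).1 hQ
  rw [← Ideal.isCoprime_span_singleton_iff, ← hf, ← hg, Ideal.isCoprime_iff_sup_eq]
  exact hm.coprime_of_ne hm' fun e ↦ h (PrimeSpectrum.ext e)

/-- A linear form on an algebra that is generated by two idempotents, which are divisible by all powers of
non-units of the base ring, vanishes at `1`. -/
theorem map_one_eq_zero_of_isIdempotentElem {A B : Type*} [CommRing A] [IsDomain A] [IsNoetherianRing A] [CommRing B]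
    (i : A →+* B) (r : B →+ A) (hr : ∀ a b, r (i a * b) = a * r b) {s₁ s₂ : A} (hs₁ : ¬ IsUnit s₁) (hs₂ : ¬ IsUnit s₂)
    {b₁ b₂ : B} (h₁ : IsIdempotentElem (i s₁ * b₁)) (h₂ : IsIdempotentElem (i s₂ * b₂)) (h : i s₁ * b₁ + i s₂ * b₂ = 1) :
    r 1 = 0 := by
  have key {s : A} (hs : ¬ IsUnit s) {b : B} (hb : IsIdempotentElem (i s * b)) : r (i s * b) = 0 := by
    -- An idempotent `e = i s * b` equals `e ^ (n + 1)`, so `r e` is divisible by `s ^ (n + 1)` for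
    -- all `n`; by Krull's intersection theorem it is zero.
    have h := Ideal.iInf_pow_eq_bot_of_isDomain (Ideal.span {s}) (by rwa [Ne, Ideal.span_singleton_eq_top])
    rw [← Ideal.mem_bot, ← h, Ideal.mem_iInf]
    intro n
    rw [Ideal.span_singleton_pow, Ideal.mem_span_singleton]
    rcases n with _ | n
    · simp
    · rw [← hb.pow_succ_eq n, mul_pow, ← map_pow, hr]
      exact dvd_mul_right _ _
  rw [← h, map_add, key hs₁ h₁, key hs₂ h₂, add_zero]

/-! ### Functions on a disjoint union -/

namespace AlgebraicGeometry.Scheme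
open DerivedDescent (structureSheaf)
variable {X : Scheme.{u}}

theorem eq_of_res_eq {W₁ W₂ : X.Opens} (h' : W₁ ⊔ W₂ = ⊤) {a b : Γ(X, ⊤)}
    (h₁ : X.presheaf.map (homOfLE (le_top : W₁ ≤ ⊤)).op a = X.presheaf.map (homOfLE (le_top : W₁ ≤ ⊤)).op b)
    (h₂ : X.presheaf.map (homOfLE (le_top : W₂ ≤ ⊤)).op a = X.presheaf.map (homOfLE (le_top : W₂ ≤ ⊤)).op b) : a = b := by
  refine Modules.eq_of_forall_exists_res_eq (M := structureSheaf X) fun x _ ↦ ?_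
  have hx : x ∈ W₁ ⊔ W₂ := h' ▸ trivial
  rcases hx with hx | hx
  · exact ⟨W₁, le_top, hx, h₁⟩
  · exact ⟨W₂, le_top, hx, h₂⟩

theorem exists_res_eq {W₁ W₂ : X.Opens} (h : W₁ ⊓ W₂ = ⊥) (h' : W₁ ⊔ W₂ = ⊤) (a : Γ(X, W₁)) (b : Γ(X, W₂)) :
    ∃ c : Γ(X, ⊤), X.presheaf.map (homOfLE (le_top : W₁ ≤ ⊤)).op c = a ∧
      X.presheaf.map (homOfLE (le_top : W₂ ≤ ⊤)).op c = b := by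
  have hz {V : X.Opens} (hV : V ≤ ⊥) (s t : Γ(structureSheaf X, V)) : s = t :=
    Modules.eq_of_forall_exists_res_eq fun x hx ↦ (hV hx).elim
  obtain ⟨c, hc⟩ := Modules.exists_glue (M := structureSheaf X) (U := ⊤) (ι := ULift Bool)
    (fun i ↦ match i with | ⟨false⟩ => W₁ | ⟨true⟩ => W₂) (fun _ ↦ le_top)
    (fun x _ ↦ by
      have hx : x ∈ W₁ ⊔ W₂ := h' ▸ trivial
      rcases hx with hx | hx
      exacts [⟨⟨false⟩, hx⟩, ⟨⟨true⟩, hx⟩])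
    (fun | ⟨false⟩ => a | ⟨true⟩ => b)
    (fun
      | ⟨false⟩, ⟨false⟩ => rfl
      | ⟨true⟩, ⟨true⟩ => rfl
      | ⟨false⟩, ⟨true⟩ => hz h.le _ _
      | ⟨true⟩, ⟨false⟩ => hz ((inf_comm W₂ W₁).le.trans h.le) _ _)
  exact ⟨c, hc ⟨false⟩, hc ⟨true⟩⟩

/-- `s` is invertible on `W₁`; extending its inverse by zero to `W₂` gives `b`, and `s * b` is the
idempotent of `W₁`. -/
theorem exists_mul_res_eq_one {W₁ W₂ : X.Opens} (h : W₁ ⊓ W₂ = ⊥) (h' : W₁ ⊔ W₂ = ⊤) (s : Γ(X, ⊤))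
    (hs : W₁ ≤ X.basicOpen s) :
    ∃ b : Γ(X, ⊤), X.presheaf.map (homOfLE (le_top : W₁ ≤ ⊤)).op (s * b) = 1 ∧
      X.presheaf.map (homOfLE (le_top : W₂ ≤ ⊤)).op (s * b) = 0 := by
  have hu : IsUnit (X.presheaf.map (homOfLE (le_top : W₁ ≤ ⊤)).op s) := by
    have := (RingedSpace.isUnit_res_basicOpen X.toRingedSpace s).map (X.presheaf.map (homOfLE hs).op).hom
    have e : X.presheaf.map (homOfLE (X.basicOpen_le s)).op ≫ X.presheaf.map (homOfLE hs).op =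
        X.presheaf.map (homOfLE (le_top : W₁ ≤ ⊤)).op := (X.presheaf.map_comp _ _).symm
    rw [← e]
    exact this
  obtain ⟨b, hb⟩ := hu.exists_right_inv
  obtain ⟨c, h₁, h₂⟩ := exists_res_eq h h' b 0
  exact ⟨c, by rw [map_mul, h₁, hb], by rw [map_mul, h₂, mul_zero]⟩
end AlgebraicGeometry.Scheme

theorem DerivedCategory.Q_map_comp_eq_id {C : Type*} [Category* C] [Abelian C] [HasDerivedCategory C]
    {K L : CochainComplex C ℤ} (f : K ⟶ L)
    (τ : (HomotopyCategory.quotient C (ComplexShape.up ℤ) ⋙ Qh).obj L ⟶ (HomotopyCategory.quotient C (ComplexShape.up ℤ) ⋙ Qh).obj K)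
    (h : (HomotopyCategory.quotient C (ComplexShape.up ℤ) ⋙ Qh).map f ≫ τ = 𝟙 _) :
    Q.map f ≫ ((quotientCompQhIso C).inv.app L ≫ τ ≫ (quotientCompQhIso C).hom.app K) = 𝟙 _ := by
  rw [(quotientCompQhIso C).inv.naturality_assoc f, ← Category.assoc _ τ, h, Category.id_comp, Iso.inv_hom_id_app]

/-! ### Non-splitting of the unit -/

namespace DerivedDescent
open Scheme.Modules
section
variable {X S : Scheme.{u}} (p : X ⟶ S)

/-- The morphism to `Rp_* 𝒪_X` factors through `p_* 𝒪_X`, so a left inverse restricts to one of `𝒪_S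
⟶ p_* 𝒪_X` in the derived category; sheaves embed there fully faithfully. -/
theorem isSplitMono_unitToPushforward (h : IsSplitMono (toDerivedPushforward p)) : IsSplitMono (unitToPushforward p) := by
  obtain ⟨⟨ρ, hρ⟩⟩ := h
  let C := S.Modules
  let s := structureComplexToPushforward p
  let e := DerivedCategory.quotientCompQhIso C
  have h₁ : DerivedCategory.Qh.map ((HomotopyCategory.quotient C (ComplexShape.up ℤ)).map s.hom) ≫
      (DerivedCategory.Plus.ι.map ((Scheme.Modules.pushforward p).rightDerivedFunctorPlusUnit.app
      ((HomotopyCategory.Plus.quotient X.Modules).obj (structureComplex X))) ≫ ρ) = 𝟙 _ := by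
    refine Eq.trans ?_ hρ
    refine (Category.assoc _ _ _).symm.trans (congrArg (· ≫ ρ) ?_)
    exact (DerivedCategory.Plus.ι.map_comp (DerivedCategory.Plus.Q.map s) _).symm
  let τ := DerivedCategory.Plus.ι.map ((Scheme.Modules.pushforward p).rightDerivedFunctorPlusUnit.app
      ((HomotopyCategory.Plus.quotient X.Modules).obj (structureComplex X))) ≫ ρ
  let t := (HomologicalComplex.singleMapHomologicalComplex (Scheme.Modules.pushforward p)
        (ComplexShape.up ℤ) 0).inv.app (structureSheaf X)
  let v := (HomologicalComplex.single C (ComplexShape.up ℤ) 0).map (unitToPushforward p)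
  obtain ⟨χ, hχ⟩ := (DerivedCategory.singleFunctor C 0).map_surjective
    (DerivedCategory.Q.map t ≫ (e.inv.app _ ≫ τ ≫ e.hom.app _))
  have h₂ : DerivedCategory.Q.map v ≫ (DerivedCategory.Q.map t ≫ (e.inv.app _ ≫ τ ≫ e.hom.app _)) = 𝟙 _ :=
    (Category.assoc _ _ _).symm.trans ((congrArg (· ≫ (e.inv.app _ ≫ τ ≫ e.hom.app _))
      (DerivedCategory.Q.map_comp v t).symm).trans (DerivedCategory.Q_map_comp_eq_id (v ≫ t) τ h₁))
  refine ⟨⟨χ, (DerivedCategory.singleFunctor C 0).map_injective ?_⟩⟩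
  rw [CategoryTheory.Functor.map_comp, hχ, CategoryTheory.Functor.map_id]
  exact h₂

variable {p} in
-- On global sections a retraction is `Γ(S)`-linear and sends `1` to `1`. But `1` is the sum of the
-- idempotents of `W₁` and `W₂`, which are multiples of `s₁` and `s₂`, so
-- `map_one_eq_zero_of_isIdempotentElem` applies.
theorem not_isSplitMono_unitToPushforward [IsDomain Γ(S, ⊤)] [IsNoetherianRing Γ(S, ⊤)] {W₁ W₂ : X.Opens}
    (h : W₁ ⊓ W₂ = ⊥) (h' : W₁ ⊔ W₂ = ⊤) {s₁ s₂ : Γ(S, ⊤)} (hs₁ : ¬ IsUnit s₁) (hs₂ : ¬ IsUnit s₂)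
    (hW₁ : W₁ ≤ p ⁻¹ᵁ S.basicOpen s₁) (hW₂ : W₂ ≤ p ⁻¹ᵁ S.basicOpen s₂) : ¬ IsSplitMono (unitToPushforward p) := by
  rintro ⟨⟨r, hr⟩⟩
  obtain ⟨b₁, h₁, h₁'⟩ := X.exists_mul_res_eq_one h h' (p.appTop s₁) (by rwa [← Scheme.preimage_basicOpen_top])
  obtain ⟨b₂, h₂, h₂'⟩ := X.exists_mul_res_eq_one ((inf_comm _ _).trans h) ((sup_comm _ _).trans h') (p.appTop s₂)
    (by rwa [← Scheme.preimage_basicOpen_top])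
  let ρ : Γ(X, ⊤) →+ Γ(S, ⊤) := (r.app ⊤).hom
  have hρ : ρ 1 = 1 := by
    have e : r.app ⊤ ((unitToPushforward p).app ⊤ (one ⊤)) = one ⊤ := by
      rw [← comp_app_apply, hr]
      rfl
    refine Eq.trans (congrArg ρ ?_) e
    exact (map_one p.appTop.hom).symm
  refine one_ne_zero (hρ.symm.trans (map_one_eq_zero_of_isIdempotentElem p.appTop.hom ρ (fun a b ↦ ?_) hs₁ hs₂
    (b₁ := b₁) (b₂ := b₂) (Scheme.eq_of_res_eq h' ?_ ?_) (Scheme.eq_of_res_eq h' ?_ ?_) (Scheme.eq_of_res_eq h' ?_ ?_)))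
  · exact r.app_smul a b
  · rw [map_mul, h₁, mul_one]
  · rw [map_mul, h₁', mul_zero]
  · rw [map_mul, h₂', mul_zero]
  · rw [map_mul, h₂, mul_one]
  · rw [map_add, h₁, h₂', add_zero, map_one]
  · rw [map_add, h₁', h₂, zero_add, map_one]
end
end DerivedDescent

/-! ### Quasi-coherence of the cokernel of the unit, and its splitting after pullback -/

namespace AlgebraicGeometry.Scheme.Modules
open DerivedDescent (structureSheaf quasiCoherent unitToPushforward tildeUnit)
section
variable {R : CommRingCat.{u}}

/-- The functor `N ↦ N^~` is full and preserves cokernels. -/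
theorem quasiCoherent_cokernel {M N : (Spec R).Modules} (hM : quasiCoherent _ M) (hN : quasiCoherent _ N) (φ : M ⟶ N) :
    quasiCoherent _ (cokernel φ) := by
  obtain ⟨A, ⟨e⟩⟩ := exists_iso_tilde hM
  obtain ⟨B, ⟨e'⟩⟩ := exists_iso_tilde hN
  let e₁ : (tilde.functor R).obj A ≅ M := e
  let e₂ : (tilde.functor R).obj B ≅ N := e'
  obtain ⟨g, hg⟩ := (tilde.functor R).map_surjective (e₁.hom ≫ φ ≫ e₂.inv)
  refine (quasiCoherent _).prop_of_iso ?_ (quasiCoherent_tilde (cokernel g))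
  exact PreservesCokernel.iso (tilde.functor R) g ≪≫ cokernel.mapIso _ _ e₁ e₂ (by rw [hg]; simp)

theorem quasiCoherent_pushforward_SpecMap {A : CommRingCat.{u}} (φ : R ⟶ A) {M : (Spec A).Modules} (hM : quasiCoherent _ M) :
    quasiCoherent _ ((pushforward (Spec.map φ)).obj M) := by
  have := (isQuasicoherent_iff_isIso_fromTildeΓ M).1 hM
  exact (isQuasicoherent_iff_isIso_fromTildeΓ _).2 (isIso_fromTildeΓ_pushforward φ M)

theorem isIso_unitToPushforward {X Y : Scheme.{u}} (e : X ⟶ Y) [IsIso e] : IsIso (unitToPushforward e) := by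
  refine isIso_of_isIso_app _ fun U ↦ (ConcreteCategory.isIso_iff_bijective _).2 ?_
  exact (ConcreteCategory.isIso_iff_bijective (e.app U)).1 inferInstance

theorem quasiCoherent_pushforward_structureSheaf {X : Scheme.{u}} [IsAffine X] (p : X ⟶ Spec R) :
    quasiCoherent _ ((pushforward p).obj (structureSheaf X)) := by
  obtain ⟨φ, hφ⟩ := Spec.map_surjective (X.isoSpec.inv ≫ p)
  have hp : X.isoSpec.hom ≫ Spec.map φ = p := by rw [hφ, Iso.hom_inv_id_assoc]
  have := isIso_unitToPushforward X.isoSpec.hom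
  refine (quasiCoherent _).prop_of_iso ?_ (quasiCoherent_pushforward_SpecMap φ
    ((quasiCoherent _).prop_of_iso tildeUnit (quasiCoherent_tilde (ModuleCat.of _ _))))
  exact (pushforward (Spec.map φ)).mapIso (asIso (unitToPushforward X.isoSpec.hom)) ≪≫
    (pushforwardComp X.isoSpec.hom (Spec.map φ)).app _ ≪≫ (pushforwardCongr hp).app _
end

/-- The retraction is the counit `p^* p_* 𝒪_X ⟶ 𝒪_X` followed by the morphism `𝒪_X ⟶ p^* 𝒪_S` given
by the section `1`; that it is one follows from a triangle identity. -/
theorem isSplitMono_pullback_map_unitToPushforward {X S : Scheme.{u}} (p : X ⟶ S) :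
    IsSplitMono ((pullback p).map (unitToPushforward p)) := by
  let adj := pullbackPushforwardAdjunction p
  let η := adj.unit.app (structureSheaf S)
  let a : structureSheaf X ⟶ (pullback p).obj (structureSheaf S) := unitTo _ (η.app ⊤ (one ⊤))
  have h : unitToPushforward p ≫ (pushforward p).map a = η := by
    refine unit_hom_ext ?_
    have e : (unitToPushforward p).app ⊤ (one ⊤) = (one (p ⁻¹ᵁ ⊤) : Γ(structureSheaf X, p ⁻¹ᵁ ⊤)) :=
      map_one p.appTop.hom
    rw [comp_app_apply, e]
    exact unitTo_app_one _
  refine ⟨⟨adj.counit.app _ ≫ a, ?_⟩⟩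
  refine (adj.homEquiv _ _).injective ?_
  rw [adj.homEquiv_unit, adj.homEquiv_unit, CategoryTheory.Functor.map_id, CategoryTheory.Functor.map_comp,
    CategoryTheory.Functor.map_comp]
  refine Eq.trans ?_ (Category.comp_id _).symm
  have n := adj.unit.naturality (unitToPushforward p)
  dsimp at n
  rw [← reassoc_of% n, adj.right_triangle_components_assoc, h]
end AlgebraicGeometry.Scheme.Modules

/-! ### The extension class killed by pullback -/

namespace DerivedDescent
open Scheme.Modules DerivedCategory Pretriangulated
section
variable {X S : Scheme.{u}} {p : X ⟶ S} [IsLocalIso p]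

/-- The pullback of the unit is split mono, so the exact functor `p^*` kills the kernel; as `p`
covers `S`, the kernel is zero. -/
theorem mono_unitToPushforward (h : ∀ x : S, ∃ (V : Scheme.{u}) (i : V ⟶ X) (j : V ⟶ S) (_ : IsOpenImmersion i)
    (_ : IsOpenImmersion j), i ≫ p = j ∧ x ∈ j.opensRange) : Mono (unitToPushforward p) := by
  refine Preadditive.mono_of_isZero_kernel _ (isZero_of_isZero_pullback h ?_)
  have := isSplitMono_pullback_map_unitToPushforward p
  have e : (Scheme.Modules.pullback p).map (kernel.ι (unitToPushforward p)) = 0 := by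
    rw [← cancel_mono ((Scheme.Modules.pullback p).map (unitToPushforward p)), ← Functor.map_comp, kernel.condition,
      Functor.map_zero, zero_comp]
  exact IsZero.of_mono_eq_zero _ e

/-- After pullback the first morphism of the triangle is mono, which forces the connecting morphism
to vanish. -/
theorem pullbackD_map_eq_zero_of_isSplitMono {T : ShortComplex S.Modules} (hT : IsSplitMono ((Scheme.Modules.pullback p).map T.f))
    {δ} (hδ : Triangle.mk ((singleFunctor S.Modules 0).map T.f) ((singleFunctor S.Modules 0).map T.g) δ ∈ distTriang (DMod S)) :
    (pullbackD p).map δ = 0 := by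
  have h : Mono ((pullbackD p).map ((singleFunctor S.Modules 0).map T.f)) := by
    have : IsSplitMono ((singleFunctor X.Modules 0).map ((Scheme.Modules.pullback p).map T.f)) := inferInstance
    have n := (pullbackDSingle p 0).hom.naturality T.f
    dsimp at n
    have : Mono ((pullbackD p).map ((singleFunctor S.Modules 0).map T.f) ≫ (pullbackDSingle p 0).hom.app T.X₂) := by
      rw [n]
      exact mono_comp _ _
    exact mono_of_mono _ ((pullbackDSingle p 0).hom.app T.X₂)
  have h₃ := Triangle.mor₃_eq_zero_of_mono₁ _ ((pullbackD p).map_distinguished _ hδ) h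
  change (pullbackD p).map δ ≫ ((pullbackD p).commShiftIso (1 : ℤ)).hom.app _ = 0 at h₃
  exact (cancel_mono _).1 (h₃.trans zero_comp.symm)
end

section
variable {R : CommRingCat.{u}}

theorem quasiCoherent_of_isZero {M : (Spec R).Modules} (h : IsZero M) : quasiCoherent _ M :=
  (quasiCoherent _).prop_of_iso (((tilde.functor R).map_isZero (isZero_zero (ModuleCat.{u} R))).iso h) (quasiCoherent_tilde _)

theorem Dqcoh_single {M : (Spec R).Modules} (h : quasiCoherent _ M) : Dqcoh _ ((singleFunctor _ 0).obj M) := by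
  intro n
  rcases lt_trichotomy n 0 with hn | rfl | hn
  · exact quasiCoherent_of_isZero (isZero_of_isGE _ 0 n hn)
  · exact (quasiCoherent _).prop_of_iso ((singleFunctorCompHomologyFunctorIso _ 0).symm.app M) h
  · exact quasiCoherent_of_isZero (isZero_of_isLE _ 0 n hn)

theorem Dqcoh_shift {K : DMod (Spec R)} (h : Dqcoh _ K) (a : ℤ) : Dqcoh _ (K⟦a⟧) := fun n ↦ by
  obtain ⟨e⟩ := nonempty_homology_shift K n a
  exact (quasiCoherent _).prop_of_iso e.symm (h _)

/-- Faithfulness fails: the class `δ` of `0 ⟶ 𝒪_S ⟶ p_* 𝒪_X ⟶ C ⟶ 0` is nonzero and becomes zero on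
`X`. Affineness of `X` makes `C` quasi-coherent, so that `δ` lies in the subcategory. -/
theorem not_isEquivalence_comparisonDqcoh {X : Scheme.{u}} [IsAffine X] {p : X ⟶ Spec R} [IsLocalIso p]
    (h : ∀ x : Spec R, ∃ (V : Scheme.{u}) (i : V ⟶ X) (j : V ⟶ Spec R) (_ : IsOpenImmersion i)
      (_ : IsOpenImmersion j), i ≫ p = j ∧ x ∈ j.opensRange) (hp : ¬ IsSplitMono (unitToPushforward p)) :
    ¬ (comparisonDqcoh p).IsEquivalence := by
  intro he
  have := mono_unitToPushforward h
  let T : ShortComplex (Spec R).Modules := .mk (unitToPushforward p) (cokernel.π _) (cokernel.condition _)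
  have hT : T.ShortExact := .mk' (ShortComplex.exact_cokernel _) inferInstance inferInstance
  obtain ⟨δ, hδ⟩ := exists_singleTriangle hT 0
  have hO : quasiCoherent _ (structureSheaf (Spec R)) :=
    (quasiCoherent _).prop_of_iso tildeUnit (quasiCoherent_tilde _)
  have hC : quasiCoherent _ T.X₃ := quasiCoherent_cokernel hO (quasiCoherent_pushforward_structureSheaf p) _
  let K : (Dqcoh (Spec R)).FullSubcategory := ⟨_, Dqcoh_single hC⟩
  let L : (Dqcoh (Spec R)).FullSubcategory := ⟨_, Dqcoh_shift (Dqcoh_single hO) 1⟩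
  let φ : K ⟶ L := ObjectProperty.homMk δ
  let ψ : K ⟶ L := ObjectProperty.homMk 0
  have hφ : (comparisonDqcoh p).map φ = (comparisonDqcoh p).map ψ := by
    refine ObjectProperty.hom_ext _ (DescentDatum.Hom.ext ?_)
    exact (pullbackD_map_eq_zero_of_isSplitMono (isSplitMono_pullback_map_unitToPushforward p) hδ).trans
      ((pullbackD p).map_zero _ _).symm
  have hδ' : δ = 0 := congrArg (fun a ↦ a.hom) ((comparisonDqcoh p).map_injective hφ)
  -- If `δ = 0`, the first morphism of the triangle is mono, hence split mono as in any triangulated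
  -- category; the retraction comes from a morphism of sheaves.
  have hm : Mono ((singleFunctor _ 0).map (unitToPushforward p)) := Triangle.mono₁ _ hδ hδ'
  obtain ⟨⟨ρ, hρ⟩⟩ := isSplitMono_of_mono ((singleFunctor _ 0).map (unitToPushforward p))
  obtain ⟨χ, rfl⟩ := (singleFunctor _ 0).map_surjective ρ
  exact hp ⟨⟨χ, (singleFunctor _ 0).map_injective (by rw [Functor.map_comp, hρ, CategoryTheory.Functor.map_id])⟩⟩
end
end DerivedDescent

/-! ### Complements of two closed points -/

namespace DerivedDescent
open Scheme.Modules
section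
variable {R : CommRingCat.{u}} [IsPrincipalIdealRing R]

theorem exists_complement_eq_specBasicOpen (P : Spec R) (hP : IsClosed ({P} : Set (Spec R))) :
    ∃ f : R, P.asIdeal = Ideal.span {f} ∧ complement P hP = specBasicOpen f := by
  obtain ⟨f, hf, h⟩ := PrimeSpectrum.exists_compl_singleton_eq_basicOpen P hP
  exact ⟨f, hf, Opens.ext h⟩

/-- The comparison functors for the two complements of distinct closed points of the spectrum of a principal ideal
domain. -/
theorem twoComplementsMap_comparison [IsDomain R] (P₁ P₂ : Spec R) (h₁ : IsClosed ({P₁} : Set (Spec R)))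
    (h₂ : IsClosed ({P₂} : Set (Spec R))) (hne : P₁ ≠ P₂) :
    (comparisonDbcoh (twoComplementsMap P₁ P₂ h₁ h₂)).IsEquivalence ∧
      ¬ IsSplitMono (toDerivedPushforward (twoComplementsMap P₁ P₂ h₁ h₂)) ∧
      ¬ (comparisonDqcoh (twoComplementsMap P₁ P₂ h₁ h₂)).IsEquivalence := by
  obtain ⟨f₁, hf₁, e₁⟩ := exists_complement_eq_specBasicOpen P₁ h₁
  obtain ⟨f₂, hf₂, e₂⟩ := exists_complement_eq_specBasicOpen P₂ h₂
  let p := twoComplementsMap P₁ P₂ h₁ h₂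
  let i₁ : (complement P₁ h₁ : Scheme.{u}) ⟶ TwoComplements P₁ P₂ h₁ h₂ := coprod.inl
  let i₂ : (complement P₂ h₂ : Scheme.{u}) ⟶ TwoComplements P₁ P₂ h₁ h₂ := coprod.inr
  have w₁ : i₁ ≫ p = (complement P₁ h₁).ι := coprod.inl_desc _ _
  have w₂ : i₂ ≫ p = (complement P₂ h₂).ι := coprod.inr_desc _ _
  have hc : IsCompl i₁.opensRange i₂.opensRange := isCompl_opensRange_inl_inr _ _
  have hj : (complement P₁ h₁).ι.opensRange ⊔ (complement P₂ h₂).ι.opensRange = ⊤ := by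
    rw [Scheme.Opens.opensRange_ι, Scheme.Opens.opensRange_ι, eq_top_iff]
    intro x _
    by_cases hx : x = P₁
    · exact Or.inr (hx ▸ hne)
    · exact Or.inl hx
  have hj₁ : (complement P₁ h₁).ι.opensRange = specBasicOpen f₁ := by rw [Scheme.Opens.opensRange_ι, e₁]
  have hj₂ : (complement P₂ h₂).ι.opensRange = specBasicOpen f₂ := by rw [Scheme.Opens.opensRange_ι, e₂]
  have hcov (x : Spec R) : ∃ (V : Scheme.{u}) (i : V ⟶ TwoComplements P₁ P₂ h₁ h₂) (j : V ⟶ Spec R) (_ : IsOpenImmersion i)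
      (_ : IsOpenImmersion j), i ≫ p = j ∧ x ∈ j.opensRange := by
    have hx : x ∈ (complement P₁ h₁).ι.opensRange ⊔ (complement P₂ h₂).ι.opensRange := hj ▸ trivial
    rcases hx with hx | hx
    · exact ⟨_, i₁, _, inferInstance, inferInstance, w₁, hx⟩
    · exact ⟨_, i₂, _, inferInstance, inferInstance, w₂, hx⟩
  let e := (Scheme.ΓSpecIso R).symm.commRingCatIsoToRingEquiv
  have : IsDomain Γ(Spec R, ⊤) := e.symm.toMulEquiv.isDomain R
  have : IsNoetherianRing Γ(Spec R, ⊤) := isNoetherianRing_of_ringEquiv R e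
  have hu {P : Spec R} {f : R} (hf : P.asIdeal = Ideal.span {f}) : ¬ IsUnit (e f) := by
    rw [MulEquiv.isUnit_map, ← Ideal.span_singleton_eq_top, ← hf]
    exact P.isPrime.ne_top
  have hr {P : Spec R} {h : IsClosed ({P} : Set (Spec R))} {f : R} (hf : complement P h = specBasicOpen f)
      (i : (complement P h : Scheme.{u}) ⟶ TwoComplements P₁ P₂ h₁ h₂) [IsOpenImmersion i] (w : i ≫ p = (complement P h).ι) :
      i.opensRange ≤ p ⁻¹ᵁ (Spec R).basicOpen (e f) := by
    have hb : (Spec R).basicOpen (e f) = specBasicOpen f := basicOpen_eq_of_affine f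
    rintro _ ⟨y, rfl⟩
    rw [hb, ← hf]
    change (i ≫ p) y ∈ complement P h
    rw [w]
    exact y.2
  have hs : ¬ IsSplitMono (unitToPushforward p) := not_isSplitMono_unitToPushforward hc.inf_eq_bot hc.sup_eq_top
    (hu hf₁) (hu hf₂) (hr e₁ i₁ w₁) (hr e₂ i₂ w₂)
  have ha {P : Spec R} {h : IsClosed ({P} : Set (Spec R))} {f : R} (hf : complement P h = specBasicOpen f) :
      IsAffine (complement P h) := by
    have : IsAffineOpen (specBasicOpen f) := IsAffineOpen.Spec_basicOpen f
    exact hf ▸ this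
  have := ha e₁
  have := ha e₂
  exact ⟨isEquivalence_comparisonDbcoh w₁ w₂ hc.inf_eq_bot hc.sup_eq_top hj₁ hj₂
      (PrimeSpectrum.isCoprime_of_asIdeal_eq_span h₁ h₂ hne hf₁ hf₂) hj,
    fun h ↦ hs (isSplitMono_unitToPushforward p h), not_isEquivalence_comparisonDqcoh hcov hs⟩
end
end DerivedDescent

theorem mainTheorem11 (k : Type u) [Field k] [IsAlgClosed k]
    (P₁ P₂ : DerivedDescent.AffineLine k)
    (h₁ : IsClosed ({P₁} : Set (DerivedDescent.AffineLine k)))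
    (h₂ : IsClosed ({P₂} : Set (DerivedDescent.AffineLine k)))
    (hne : P₁ ≠ P₂) :
    (DerivedDescent.comparisonDbcoh
        (DerivedDescent.twoComplementsMap P₁ P₂ h₁ h₂)).IsEquivalence ∧
      ¬ IsSplitMono (DerivedDescent.toDerivedPushforward
        (DerivedDescent.twoComplementsMap P₁ P₂ h₁ h₂)) ∧
      ¬ (DerivedDescent.comparisonDqcoh
        (DerivedDescent.twoComplementsMap P₁ P₂ h₁ h₂)).IsEquivalence := by
  have : IsDomain (CommRingCat.of (Polynomial k)) := inferInstanceAs (IsDomain (Polynomial k))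
  have : IsPrincipalIdealRing (CommRingCat.of (Polynomial k)) :=
    inferInstanceAs (IsPrincipalIdealRing (Polynomial k))
  exact DerivedDescent.twoComplementsMap_comparison P₁ P₂ h₁ h₂ hne
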